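/- **Definitions.** Let $n\ge 0$, and let $c_n\subset\mathbb R[p_1,\dots,p_n,q_1,\dots,q_n]$ be the Lie algebra of polynomials without constant and linear terms, with the Poisson bracket $\{f,g\}=\sum_i\left(\frac{\partial f}{\partial p_i}\frac{\partial g}{\partial q_i}-\frac{\partial f}{\partial q_i}\frac{\partial g}{\partial p_i}\right)$. The homogeneous quadratic polynomials form the subalgebra $\mathfrak{sp}(2n)\subset c_n$; it acts on the exterior algebra $\Lambda c_n$ by the adjoint action, and $(\Lambda c_n)^{\mathfrak{sp}(2n)}$ is the space of invariants. The Schouten bracket on $\Lambda c_n$ is the bilinear map with $$[v_1\wedge\dots\wedge v_p,\;w_1\wedge\dots\wedge w_q]=\sum_{i,j}(-1)^{i+j+p+1}\{v_i,w_j\}\wedge v_1\wedge\dots\widehat{v_i}\dots\wedge v_p\wedge w_1\wedge\dots\widehat{w_j}\dots\wedge w_q .$$ For $m\ge 2$ let $\mathcal G^{(m)}$ be the real vector space spanned by the finite graphs (possibly empty or disconnected) all of whose vertices have valence at least $m$, with numbered vertices and an arrow on each edge, modulo the relations that reversing an arrow changes the sign and that renumbering the vertices by $\sigma$ multiplies by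 $\operatorname{sgn}\sigma$. It is graded by the number $k$ of vertices, with components $\mathcal G^{(m)}_k$. The commutative graph complex is $\mathcal G=\mathcal G^{(3)}$. Let $r:\mathcal G^{(2)}\to\mathcal G$ be the projection that kills the graphs with a bivalent vertex. The graph bracket on $\mathcal G^{(m)}$ is $[X,Y]=\sum_{h\in X,\,k\in Y}(X\cdot Y)_{hk}$, over the half-edges $h$ of $X$ and $k$ of $Y$. Here $X\cdot Y$ is the disjoint union, with the vertices of $Y$ numbered after those of $X$. To form $(X\cdot Y)_{hk}$, choose a representative in which $h$ is the initial half-edge of its edge, $k$ is the terminal half-edge of its edge, the vertex of $h$ has number 1 and the vertex of $k$ has number 2; replace the edges $h\cup\bar h$ and $k\cup\bar k$ by an arrow $h\cup k$ from $h$ to $k$ and an arrow from $\bar k$ to $\bar h$; collapse $h\cup k$ to a vertex with number 1, and lower the numbers of the other vertices by 1. Let $\psi_n:\mathcal G^{(2)}\to\Lambda c_n$ be the sum over states: a state of a graph $X$ with $k$ vertices labels each arrow either with $p_i$ at its tail and $q_i$ at its head (sign $+$), or with $q_i$ at its tail and $p_i$ at its head (sign $-$), for some $i$; and $\psi_n(X)$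 is the sum over all states of the product of the signs times $M_1\wedge\dots\wedge M_k$, where $M_v$ is the product of the labels at the $v$-th vertex. **Statement.** For every $n\ge 0$: 1. The image of $\psi_n$ is $(\Lambda c_n)^{\mathfrak{sp}(2n)}$, and for every $k\le 2n+1$ the map $\psi_n$ restricts to a bijection $\mathcal G^{(2)}_k\to(\Lambda^kc_n)^{\mathfrak{sp}(2n)}$. Hence Kontsevich's map $$\varphi_n=r\circ\psi_n^{-1}:\ \bigoplus_{k\le 2n+1}(\Lambda^kc_n)^{\mathfrak{sp}(2n)}\to\mathcal G$$ is a well-defined linear map. 2. $\varphi_n$ maps the Schouten bracket to the graph bracket: if $x\in(\Lambda^pc_n)^{\mathfrak{sp}(2n)}$ and $y\in(\Lambda^qc_n)^{\mathfrak{sp}(2n)}$ are in the domain of $\varphi_n$ and $p+q\le 2n+2$, then $[x,y]$ is in the domain of $\varphi_n$ and $\varphi_n([x,y])=[\varphi_n(x),\varphi_n(y)]$. 3. Without restriction on degrees, $[\psi_n(X),\psi_n(Y)]=\psi_n([X,Y])$ and $r([X,Y])=[r(X),r(Y)]$ for all $X,Y\in\mathcal G^{(2)}$. So whenever invariants $x,y$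 are represented by $r(X),r(Y)\in\mathcal G$, where $\psi_n(X)=x$ and $\psi_n(Y)=y$, then $[x,y]$ is represented by the graph bracket $[r(X),r(Y)]$. -/

import Mathlib

noncomputable section

open MvPolynomial

namespace KGraph

/-- Polynomial functions on `ℝ²ⁿ`: the variable `Sum.inl i` is `pᵢ`, `Sum.inr i` is `qᵢ`. -/
abbrev Poly (n : ℕ) := MvPolynomial (Fin n ⊕ Fin n) ℝ

/-- The Poisson bracket `{f, g} = ∑ᵢ (∂f/∂pᵢ ∂g/∂qᵢ - ∂f/∂qᵢ ∂g/∂pᵢ)`. -/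
def poisson {n : ℕ} (f g : Poly n) : Poly n :=
  ∑ i : Fin n, (pderiv (Sum.inl i) f * pderiv (Sum.inr i) g
    - pderiv (Sum.inr i) f * pderiv (Sum.inl i) g)

/-- `cₙ`: the polynomials without constant and linear terms. -/
def polyLie (n : ℕ) : Submodule ℝ (Poly n) where
  carrier := {f | coeff 0 f = 0 ∧ ∀ b, coeff (Finsupp.single b 1) f = 0}
  add_mem' hf hg := ⟨by simp [hf.1, hg.1], fun b => by simp [hf.2 b, hg.2 b]⟩
  zero_mem' := by simp
  smul_mem' r f hf := ⟨by simp [hf.1], fun b => by simp [hf.2 b]⟩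

theorem mem_polyLie_iff {n : ℕ} (f : Poly n) :
    f ∈ polyLie n ↔ constantCoeff f = 0 ∧ ∀ b, constantCoeff (pderiv b f) = 0 := by
  simp [polyLie, constantCoeff_eq, coeff_pderiv]

theorem poisson_mem {n : ℕ} {f g : Poly n} (hf : f ∈ polyLie n) (hg : g ∈ polyLie n) : poisson f g ∈ polyLie n := by
  rw [mem_polyLie_iff] at *
  refine ⟨?_, fun b => ?_⟩ <;> simp [poisson, map_sum, hf.2, hg.2]

theorem pderiv_comm {n : ℕ} (a b : Fin n ⊕ Fin n) (f : Poly n) :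
    pderiv a (pderiv b f) = pderiv b (pderiv a f) := by
  have h : ⁅(pderiv a : Derivation ℝ (Poly n) (Poly n)), (pderiv b : Derivation ℝ (Poly n) (Poly n))⁆ = 0 := by
    apply MvPolynomial.derivation_ext
    intro i
    classical
    simp [Derivation.commutator_apply, pderiv_X, Pi.single_apply, apply_ite]
  have := DFunLike.congr_fun h f
  rw [Derivation.commutator_apply] at this
  exact sub_eq_zero.mp this

theorem pderiv_poisson {n : ℕ} (a : Fin n ⊕ Fin n) (f g : Poly n) :
    pderiv a (poisson f g) = poisson (pderiv a f) g + poisson f (pderiv a g) := by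
  simp only [poisson, map_sum, map_sub, pderiv_mul, ← Finset.sum_add_distrib]
  refine Finset.sum_congr rfl fun i _ => ?_
  rw [pderiv_comm a (Sum.inl i) f, pderiv_comm a (Sum.inr i) f, pderiv_comm a (Sum.inl i) g,
    pderiv_comm a (Sum.inr i) g]
  ring

/-- The derivation `g ↦ {f, g}`. -/
def hamiltonian {n : ℕ} (f : Poly n) : Derivation ℝ (Poly n) (Poly n) :=
  ∑ i : Fin n, (pderiv (Sum.inl i) f • pderiv (Sum.inr i)
    - pderiv (Sum.inr i) f • pderiv (Sum.inl i))

theorem hamiltonian_apply {n : ℕ} (f g : Poly n) : hamiltonian f g = poisson f g := by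
  simp only [hamiltonian, poisson]
  rw [← Derivation.coeFnAddMonoidHom_apply, map_sum, Finset.sum_apply]
  simp [Derivation.coeFnAddMonoidHom]

theorem poisson_X_inl {n : ℕ} (f : Poly n) (i : Fin n) :
    poisson f (X (Sum.inl i)) = - pderiv (Sum.inr i) f := by
  classical
  simp [poisson, pderiv_X, Pi.single_apply]

theorem poisson_X_inr {n : ℕ} (f : Poly n) (i : Fin n) :
    poisson f (X (Sum.inr i)) = pderiv (Sum.inl i) f := by
  classical
  simp [poisson, pderiv_X, Pi.single_apply]

theorem poisson_swap {n : ℕ} (f g : Poly n) : poisson f g = - poisson g f := by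
  simp only [poisson, ← Finset.sum_neg_distrib]
  exact Finset.sum_congr rfl fun i _ => by ring

theorem poisson_jacobi {n : ℕ} (f g h : Poly n) :
    poisson f (poisson g h) = poisson (poisson f g) h + poisson g (poisson f h) := by
  have key : ⁅hamiltonian f, hamiltonian g⁆ = hamiltonian (poisson f g) := by
    apply MvPolynomial.derivation_ext
    rintro (i | i)
    · simp only [Derivation.commutator_apply, hamiltonian_apply, poisson_X_inl, pderiv_poisson]
      rw [← hamiltonian_apply, ← hamiltonian_apply, map_neg, map_neg, hamiltonian_apply,
        hamiltonian_apply, poisson_swap g]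
      ring
    · simp only [Derivation.commutator_apply, hamiltonian_apply, poisson_X_inr, pderiv_poisson]
      rw [poisson_swap g]
      ring
  have := DFunLike.congr_fun key h
  simp only [Derivation.commutator_apply, hamiltonian_apply] at this
  rw [← this]; ring

/-- `cₙ` is a Lie algebra under the Poisson bracket. -/
instance (n : ℕ) : LieRing (polyLie n) where
  bracket f g := ⟨poisson f.1 g.1, poisson_mem f.2 g.2⟩
  add_lie f g h := by
    ext1
    simp only [poisson, Submodule.coe_add, map_add, ← Finset.sum_add_distrib]
    exact Finset.sum_congr rfl fun i _ => by ring
  lie_add f g h := by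
    ext1
    simp only [poisson, Submodule.coe_add, map_add, ← Finset.sum_add_distrib]
    exact Finset.sum_congr rfl fun i _ => by ring
  lie_self f := by
    ext1
    simp only [poisson, Submodule.coe_zero]
    exact Finset.sum_eq_zero fun i _ => by ring
  leibniz_lie f g h := by
    ext1
    exact poisson_jacobi _ _ _

instance (n : ℕ) : LieAlgebra ℝ (polyLie n) where
  lie_smul r f g := by
    ext1
    change poisson f.1 (r • g.1) = r • poisson f.1 g.1
    rw [← hamiltonian_apply, ← hamiltonian_apply]
    exact (hamiltonian f.1).map_smul r g.1

section Schouten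

variable {L N : Type*} [LieRing L] [LieAlgebra ℝ L] [AddCommGroup N] [Module ℝ N]

open ExteriorAlgebra

/-- The linear map with `v₀ ∧ ⋯ ∧ vₚ ↦ ∑ᵢ (-1)ⁱ f(vᵢ)(v₀ ∧ ⋯ v̂ᵢ ⋯ ∧ vₚ)`, and `1 ↦ 0`. -/
def pick (f : L →ₗ[ℝ] ExteriorAlgebra ℝ L →ₗ[ℝ] N) : ExteriorAlgebra ℝ L →ₗ[ℝ] N :=
  liftAlternating fun p => match p with
    | 0 => 0
    | p + 1 => AlternatingMap.alternatizeUncurryFin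
        { toFun := fun v => (f v).compAlternatingMap (ιMulti ℝ p)
          map_add' := fun v w => by ext; simp
          map_smul' := fun r v => by ext; simp }

theorem pick_one (f : L →ₗ[ℝ] ExteriorAlgebra ℝ L →ₗ[ℝ] N) : pick f 1 = 0 := by
  simp [pick]

theorem pick_ιMulti (f : L →ₗ[ℝ] ExteriorAlgebra ℝ L →ₗ[ℝ] N) {p : ℕ} (v : Fin (p + 1) → L) :
    pick f (ιMulti ℝ (p + 1) v)
      = ∑ i : Fin (p + 1), (-1 : ℝ) ^ (i : ℕ) • f (v i) (ιMulti ℝ p (i.removeNth v)) := by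
  simp only [pick, liftAlternating_apply_ιMulti, AlternatingMap.alternatizeUncurryFin_apply]
  refine Finset.sum_congr rfl fun i _ => ?_
  rcases Nat.even_or_odd (i : ℕ) with h | h <;> simp [h.neg_one_pow]

theorem hom_ext_ιMulti {f g : ExteriorAlgebra ℝ L →ₗ[ℝ] N}
    (h : ∀ (p : ℕ) (v : Fin p → L), f (ιMulti ℝ p v) = g (ιMulti ℝ p v)) : f = g :=
  lhom_ext fun p => AlternatingMap.ext fun v => h p v

theorem pick_add (f g : L →ₗ[ℝ] ExteriorAlgebra ℝ L →ₗ[ℝ] N) :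
    pick (f + g) = pick f + pick g := by
  refine hom_ext_ιMulti fun p v => ?_
  cases p with
  | zero => simp [pick_one]
  | succ p => simp only [pick_ιMulti, LinearMap.add_apply, smul_add, Finset.sum_add_distrib]

theorem pick_smul (r : ℝ) (f : L →ₗ[ℝ] ExteriorAlgebra ℝ L →ₗ[ℝ] N) :
    pick (r • f) = r • pick f := by
  refine hom_ext_ιMulti fun p v => ?_
  cases p with
  | zero => simp [pick_one]
  | succ p =>
    simp only [pick_ιMulti, LinearMap.smul_apply, Finset.smul_sum]
    exact Finset.sum_congr rfl fun i _ => smul_comm _ _ _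

/-- For `v ∈ L` and `A ∈ ΛL`, the linear map
`w₀ ∧ ⋯ ∧ w_q ↦ ∑ⱼ (-1)ʲ [v, wⱼ] ∧ A ∧ w₀ ∧ ⋯ ŵⱼ ⋯ ∧ w_q`. -/
def schoutenInner (v : L) (A : ExteriorAlgebra ℝ L) :
    ExteriorAlgebra ℝ L →ₗ[ℝ] ExteriorAlgebra ℝ L :=
  pick
    { toFun := fun w => LinearMap.mulLeft ℝ (ι ℝ ⁅v, w⁆ * A)
      map_add' := fun w w' => by ext; simp [add_mul, mul_assoc]
      map_smul' := fun r w => by ext; simp [mul_assoc] }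

/-- The Schouten bracket on `ΛL`, see `schouten_ιMulti` for its value on wedge products
(`involute` is multiplication by `(-1)ᵏ` on `ΛᵏL`). -/
def schouten : ExteriorAlgebra ℝ L →ₗ[ℝ] ExteriorAlgebra ℝ L →ₗ[ℝ] ExteriorAlgebra ℝ L :=
  pick <| LinearMap.mk₂ ℝ (fun v A => schoutenInner v (CliffordAlgebra.involute A))
    (fun v v' A => by
      simp only [schoutenInner]
      rw [← pick_add]; congr 1; ext; simp [add_mul, mul_assoc])
    (fun r v A => by
      simp only [schoutenInner]
      rw [← pick_smul]; congr 1; ext; simp [mul_assoc])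
    (fun v A A' => by
      simp only [schoutenInner]
      rw [← pick_add]; congr 1; ext; simp [add_mul, mul_add, mul_assoc])
    (fun r v A => by
      simp only [schoutenInner]
      rw [← pick_smul]; congr 1; ext; simp [mul_assoc])

theorem involute_ιMulti {p : ℕ} (v : Fin p → L) :
    CliffordAlgebra.involute (ιMulti ℝ p v) = (-1 : ℝ) ^ p • ιMulti ℝ p v := by
  induction p with
  | zero => simp
  | succ p ih =>
    rw [ιMulti_succ_apply, map_mul, ih]
    simp [pow_succ, ι]

/-- With 0-based indices:
`[v₀ ∧ ⋯ ∧ vₚ, w₀ ∧ ⋯ ∧ w_q] = ∑ᵢⱼ (-1)^(i+j+p) [vᵢ, wⱼ] ∧ v₀ ∧ ⋯ v̂ᵢ ⋯ ∧ vₚ ∧ w₀ ∧ ⋯ ŵⱼ ⋯ ∧ w_q`. -/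
theorem schouten_ιMulti {p q : ℕ} (v : Fin (p + 1) → L) (w : Fin (q + 1) → L) :
    schouten (ιMulti ℝ (p + 1) v) (ιMulti ℝ (q + 1) w)
      = ∑ i : Fin (p + 1), ∑ j : Fin (q + 1), (-1 : ℝ) ^ ((i : ℕ) + (j : ℕ) + p) •
        (ι ℝ ⁅v i, w j⁆ * ιMulti ℝ p (i.removeNth v) * ιMulti ℝ q (j.removeNth w)) := by
  simp only [schouten, pick_ιMulti, LinearMap.sum_apply, LinearMap.smul_apply,
    LinearMap.mk₂_apply, schoutenInner, Finset.smul_sum, LinearMap.coe_mk, AddHom.coe_mk,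
    LinearMap.mulLeft_apply, involute_ιMulti]
  refine Finset.sum_congr rfl fun i _ => Finset.sum_congr rfl fun j _ => ?_
  simp only [mul_smul_comm, smul_mul_assoc, smul_smul]
  congr 1
  ring

theorem schouten_one_left (y : ExteriorAlgebra ℝ L) : schouten 1 y = 0 := by
  simp [schouten, pick_one]

theorem schouten_one_right (x : ExteriorAlgebra ℝ L) : schouten x 1 = 0 := by
  have : schouten.flip (1 : ExteriorAlgebra ℝ L) = 0 := by
    refine hom_ext_ιMulti fun p v => ?_
    cases p with
    | zero => simp [schouten_one_left]
    | succ p =>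
      simp only [LinearMap.flip_apply, schouten, pick_ιMulti, LinearMap.sum_apply,
        LinearMap.smul_apply, LinearMap.mk₂_apply, schoutenInner, pick_one, smul_zero,
        Finset.sum_const_zero, LinearMap.zero_apply]
  exact DFunLike.congr_fun this x

end Schouten

/-! ### Graphs -/

/-- A labelled graph: vertices numbered by `Fin k` and a finite multiset of arrows
`(tail, head)`; multiple edges and loops are allowed, and so is the empty graph. -/
structure LGraph where
  k : ℕ
  arrows : Multiset (Fin k × Fin k)

/-- The valence of a vertex: the number of half-edges at it (a loop counts twice). -/
def LGraph.valence (X : LGraph) (v : Fin X.k) : ℕ :=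
  X.arrows.countP (fun a => a.1 = v) + X.arrows.countP (fun a => a.2 = v)

/-- Apply a function of vertices to the tails and heads of arrows. -/
def mapArrows {k l : ℕ} (f : Fin k → Fin l) (E : Multiset (Fin k × Fin k)) :
    Multiset (Fin l × Fin l) :=
  E.map (Prod.map f f)

/-- Renumber the vertices. -/
def LGraph.relabel (X : LGraph) (σ : Equiv.Perm (Fin X.k)) : LGraph :=
  ⟨X.k, mapArrows σ X.arrows⟩

/-- `Y` is obtained from `X` by reversing one arrow. -/
def LGraph.IsReversal (X Y : LGraph) : Prop :=
  ∃ (k : ℕ) (a b : Fin k) (E : Multiset (Fin k × Fin k)),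
    X = ⟨k, (a, b) ::ₘ E⟩ ∧ Y = ⟨k, (b, a) ::ₘ E⟩

/-- Labelled graphs all of whose vertices have valence at least `m`. -/
abbrev AGraph (m : ℕ) := {X : LGraph // ∀ v, m ≤ X.valence v}

/-- The sign of a permutation as a real number. -/
def sgn {k : ℕ} (σ : Equiv.Perm (Fin k)) : ℝ := ((Equiv.Perm.sign σ : ℤ) : ℝ)

/-- The orientation relations: reversing an arrow changes the sign, and renumbering the vertices
multiplies by the sign of the permutation. -/
def orientationRelations (m : ℕ) : Set (AGraph m →₀ ℝ) :=
  {r | ∃ X Y : AGraph m, X.1.IsReversal Y.1 ∧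
    r = Finsupp.single Y 1 + Finsupp.single X 1} ∪
  {r | ∃ (X Y : AGraph m) (σ : Equiv.Perm (Fin X.1.k)), Y.1 = X.1.relabel σ ∧
    r = Finsupp.single Y 1 - sgn σ • Finsupp.single X 1}

/-- The real vector space spanned by the oriented graphs whose vertices have valence at least `m`,
modulo `(X, or) = -(X, -or)`. The commutative graph complex `𝒢` is `GraphSpace 3`. -/
abbrev GraphSpace (m : ℕ) := (AGraph m →₀ ℝ) ⧸ Submodule.span ℝ (orientationRelations m)

open Classical in
/-- The class of a labelled graph in `GraphSpace m`; it is `0` if some vertex has valence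
less than `m`. -/
def cls (m : ℕ) (X : LGraph) : GraphSpace m :=
  if h : ∀ v, m ≤ X.valence v then Submodule.Quotient.mk (Finsupp.single ⟨X, h⟩ 1) else 0

/-- The space of `k`-chains: it is spanned by the graphs with `k` vertices. -/
def chains (m k : ℕ) : Submodule ℝ (GraphSpace m) :=
  Submodule.span ℝ {x | ∃ X : AGraph m, X.1.k = k ∧ x = cls m X.1}

theorem mk_single (m : ℕ) (X : AGraph m) :
    (Submodule.Quotient.mk (Finsupp.single X 1) : GraphSpace m) = cls m X.1 := by
  rw [cls, dif_pos X.2]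

theorem valence_reversal {k : ℕ} (a b : Fin k) (E : Multiset (Fin k × Fin k)) (v : Fin k) :
    LGraph.valence ⟨k, (b, a) ::ₘ E⟩ v = LGraph.valence ⟨k, (a, b) ::ₘ E⟩ v := by
  simp only [LGraph.valence, Multiset.countP_cons]
  omega

theorem valence_relabel {k : ℕ} (E : Multiset (Fin k × Fin k)) (σ : Equiv.Perm (Fin k))
    (v : Fin k) : LGraph.valence ⟨k, mapArrows σ E⟩ (σ v) = LGraph.valence ⟨k, E⟩ v := by
  rw [LGraph.valence, LGraph.valence, mapArrows, Multiset.countP_map, Multiset.countP_map,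
    Multiset.countP_eq_card_filter, Multiset.countP_eq_card_filter]
  simp

theorem cls_reversal (m : ℕ) {k : ℕ} (a b : Fin k) (E : Multiset (Fin k × Fin k)) :
    cls m ⟨k, (b, a) ::ₘ E⟩ = - cls m ⟨k, (a, b) ::ₘ E⟩ := by
  by_cases h : ∀ v, m ≤ LGraph.valence ⟨k, (a, b) ::ₘ E⟩ v
  · have h' : ∀ v, m ≤ LGraph.valence ⟨k, (b, a) ::ₘ E⟩ v := fun v => by
      rw [valence_reversal]; exact h v
    rw [cls, cls, dif_pos h, dif_pos h', eq_neg_iff_add_eq_zero, ← Submodule.Quotient.mk_add,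
      Submodule.Quotient.mk_eq_zero]
    exact Submodule.subset_span (Or.inl ⟨⟨_, h⟩, ⟨_, h'⟩, ⟨k, a, b, E, rfl, rfl⟩, rfl⟩)
  · have h' : ¬ ∀ v, m ≤ LGraph.valence ⟨k, (b, a) ::ₘ E⟩ v := fun H => h fun v => by
      rw [← valence_reversal]; exact H v
    rw [cls, cls, dif_neg h, dif_neg h', neg_zero]

theorem cls_relabel (m : ℕ) {k : ℕ} (E : Multiset (Fin k × Fin k)) (σ : Equiv.Perm (Fin k)) :
    cls m ⟨k, mapArrows σ E⟩ = sgn σ • cls m ⟨k, E⟩ := by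
  by_cases h : ∀ v, m ≤ LGraph.valence ⟨k, E⟩ v
  · have h' : ∀ v, m ≤ LGraph.valence ⟨k, mapArrows σ E⟩ v := fun v => by
      obtain ⟨w, rfl⟩ := σ.surjective v
      rw [valence_relabel]; exact h w
    rw [cls, cls, dif_pos h, dif_pos h', ← sub_eq_zero, ← Submodule.Quotient.mk_smul,
      ← Submodule.Quotient.mk_sub, Submodule.Quotient.mk_eq_zero]
    exact Submodule.subset_span (Or.inr ⟨⟨_, h⟩, ⟨_, h'⟩, σ, rfl, rfl⟩)
  · have h' : ¬ ∀ v, m ≤ LGraph.valence ⟨k, mapArrows σ E⟩ v := fun H => h fun v => by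
      rw [← valence_relabel]; exact H (σ v)
    rw [cls, cls, dif_neg h, dif_neg h', smul_zero]

/-- A linear map out of `GraphSpace m` given by its values on labelled graphs. -/
def liftGraph {N : Type*} [AddCommGroup N] [Module ℝ N] (m : ℕ)
    (f : ∀ k : ℕ, Multiset (Fin k × Fin k) → N)
    (hrev : ∀ (k : ℕ) (a b : Fin k) (E : Multiset (Fin k × Fin k)),
      f k ((b, a) ::ₘ E) = - f k ((a, b) ::ₘ E))
    (hrel : ∀ (k : ℕ) (E : Multiset (Fin k × Fin k)) (σ : Equiv.Perm (Fin k)),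
      f k (mapArrows σ E) = sgn σ • f k E) :
    GraphSpace m →ₗ[ℝ] N :=
  Submodule.liftQ _ (Finsupp.linearCombination ℝ fun X : AGraph m => f X.1.k X.1.arrows) <| by
    rw [Submodule.span_le]
    rintro r (⟨X, Y, ⟨k, a, b, E, hX, hY⟩, rfl⟩ | ⟨⟨⟨k, E⟩, hX⟩, ⟨⟨l, F⟩, hY⟩, σ, h, rfl⟩)
    · obtain ⟨X, h⟩ := X
      obtain ⟨Y, h'⟩ := Y
      subst hX hY
      simp [hrev k a b E]
    · obtain ⟨rfl, h⟩ := LGraph.mk.inj h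
      obtain rfl := eq_of_heq h
      simp [hrel]

theorem liftGraph_cls {N : Type*} [AddCommGroup N] [Module ℝ N] (m : ℕ)
    (f : ∀ k : ℕ, Multiset (Fin k × Fin k) → N) (hrev) (hrel) (X : AGraph m) :
    liftGraph m f hrev hrel (cls m X.1) = f X.1.k X.1.arrows := by
  rw [← mk_single]
  simp [liftGraph]

theorem graphSpace_hom_ext {N : Type*} [AddCommGroup N] [Module ℝ N] {m : ℕ}
    {f g : GraphSpace m →ₗ[ℝ] N} (h : ∀ X : AGraph m, f (cls m X.1) = g (cls m X.1)) : f = g :=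
  Submodule.linearMap_qext _ <| Finsupp.lhom_ext' fun X => LinearMap.ext_ring <| by
    have := h X
    rwa [← mk_single] at this

/-- The projection to `𝒢` that kills the graphs with a bivalent vertex. -/
def reduce : GraphSpace 2 →ₗ[ℝ] GraphSpace 3 :=
  liftGraph 2 (fun k E => cls 3 ⟨k, E⟩) (fun _ a b E => cls_reversal 3 a b E)
    (fun _ E σ => cls_relabel 3 E σ)

/-! ### The graph bracket -/

/-- The renumbering which makes `i` the first vertex and `j ≠ i` the second one, and keeps the
order of the other vertices. -/
def frontPerm {k : ℕ} (i j : Fin k) : Equiv.Perm (Fin k) :=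
  (Fin.cycleRange j).trans (Fin.cycleRange (Fin.cycleRange j i))

/-- The new number of a vertex after `i` and `j` are made the first two vertices and then merged
into one vertex, which becomes the first one; the other numbers go down by one. -/
def mergeMap {k : ℕ} (i j : Fin k) (h : i ≠ j) (v : Fin k) : Fin (k - 1) :=
  ⟨(frontPerm i j v : ℕ) - 1, by
    have h1 := i.2
    have h2 := j.2
    have h3 : (i : ℕ) ≠ j := fun e => h (Fin.ext e)
    have h4 := (frontPerm i j v).2
    omega⟩

/-- Collapse an arrow from `i` to `j` in a graph with vertices `Fin k`, where `E` consists of the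
other arrows. A loop gives `0`. -/
def collapse (m : ℕ) {k : ℕ} (i j : Fin k) (E : Multiset (Fin k × Fin k)) : GraphSpace m :=
  if h : i = j then 0
  else sgn (frontPerm i j) • cls m ⟨k - 1, mapArrows (mergeMap i j h) E⟩

/-- The vertex of the initial (`false`) or terminal (`true`) half-edge of an arrow. -/
def vtx {k : ℕ} (a : Fin k × Fin k) (s : Bool) : Fin k := if s then a.2 else a.1

/-- The sign for making a half-edge the initial one of its edge. -/
def halfSign (s : Bool) : ℝ := if s then -1 else 1

/-- `X_{hk}` for half-edges `h = (a, s)` and `k = (b, t)` on different edges of `X`, where `E`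
consists of the other arrows of `X`: the sign makes `h` initial and `k` terminal, the arrow
`h ∪ k` from `h` to `k` is collapsed, and a new arrow goes from `k̄` to `h̄`. -/
def contractPair (m : ℕ) {k : ℕ} (a : Fin k × Fin k) (s : Bool) (b : Fin k × Fin k) (t : Bool)
    (E : Multiset (Fin k × Fin k)) : GraphSpace m :=
  (halfSign s * halfSign (!t)) •
    collapse m (vtx a s) (vtx b t) ((vtx b (!t), vtx a (!s)) ::ₘ E)

/-- The sum of `(X·Y)_{hk}` over all half-edges `h` of `X` and `k` of `Y`, where `X` and `Y` have
the arrows `E` and `F`. Here `X·Y` is the disjoint union, in which the vertices of `Y` are numbered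
after those of `X`. -/
def bracketArrows (m : ℕ) {x y : ℕ} (E : Multiset (Fin x × Fin x)) (F : Multiset (Fin y × Fin y)) :
    GraphSpace m :=
  (E.map fun a => (F.map fun b => ∑ s : Bool, ∑ t : Bool,
    contractPair m (Prod.map (Fin.castAdd y) (Fin.castAdd y) a) s
      (Prod.map (Fin.natAdd x) (Fin.natAdd x) b) t
      (mapArrows (Fin.castAdd y) (E.erase a) + mapArrows (Fin.natAdd x) (F.erase b))).sum).sum

theorem frontPerm_left {k : ℕ} {i j : Fin k} : (frontPerm i j i : ℕ) = 0 := by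
  have : NeZero k := ⟨fun h => by subst h; exact i.elim0⟩
  simp [frontPerm]

theorem frontPerm_right {k : ℕ} {i j : Fin k} (h : i ≠ j) : (frontPerm i j j : ℕ) = 1 := by
  have : NeZero k := ⟨fun h => by subst h; exact i.elim0⟩
  obtain ⟨k, rfl⟩ : ∃ l, k = l + 2 := ⟨k - 2, by
    have := i.2; have := j.2; have : (i : ℕ) ≠ j := fun e => h (Fin.ext e)
    omega⟩
  have h0 : (Fin.cycleRange j i) ≠ 0 := fun e => h ((Fin.cycleRange j).injective (by simp [e]))
  simp only [frontPerm, Equiv.trans_apply, Fin.cycleRange_self]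
  rw [Fin.cycleRange_of_lt (Fin.pos_of_ne_zero h0)]
  simp

theorem mapArrows_mapArrows {k l m : ℕ} (f : Fin k → Fin l) (g : Fin l → Fin m)
    (E : Multiset (Fin k × Fin k)) : mapArrows g (mapArrows f E) = mapArrows (g ∘ f) E := by
  simp only [mapArrows, Multiset.map_map, Prod.map_comp_map]

theorem sgn_mul {k : ℕ} (σ τ : Equiv.Perm (Fin k)) : sgn (σ * τ) = sgn σ * sgn τ := by
  simp [sgn]

theorem sgn_mul_self {k : ℕ} (σ : Equiv.Perm (Fin k)) : sgn σ * sgn σ = 1 := by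
  rw [sgn, ← Int.cast_mul, ← Units.val_mul, Int.units_mul_self]; simp

/-- Any renumbering that makes `i` and `j` the first two vertices may be used in `collapse`. -/
theorem collapse_eq (m : ℕ) {k : ℕ} (i j : Fin k) (h : i ≠ j) (E : Multiset (Fin k × Fin k))
    (π : Equiv.Perm (Fin k)) (hi : (π i : ℕ) = 0) (hj : (π j : ℕ) = 1)
    (f : Fin k → Fin (k - 1)) (hf : ∀ v, (f v : ℕ) = (π v : ℕ) - 1) :
    collapse m i j E = sgn π • cls m ⟨k - 1, mapArrows f E⟩ := by
  obtain ⟨k, rfl⟩ : ∃ l, k = l + 2 := ⟨k - 2, by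
    have := i.2; have := j.2; have : (i : ℕ) ≠ j := fun e => h (Fin.ext e)
    omega⟩
  set ρ : Equiv.Perm (Fin (k + 2)) := frontPerm i j * π⁻¹ with hρ
  have hρπ : ∀ v, ρ (π v) = frontPerm i j v := fun v => by simp [hρ]
  have hπi : π i = 0 := Fin.ext (by simpa using hi)
  have hπj : π j = 1 := Fin.ext (by simpa using hj)
  have hρ0 : ρ 0 = 0 := by have h1 := hρπ i; rw [hπi] at h1; rw [h1]; exact Fin.ext frontPerm_left
  have hρ1 : ρ 1 = 1 := by have h1 := hρπ j; rw [hπj] at h1; rw [h1]; exact Fin.ext (by simpa using frontPerm_right h)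
  obtain ⟨⟨p, τ⟩, hpτ⟩ : ∃ x, Equiv.Perm.decomposeFin.symm x = ρ :=
    Equiv.Perm.decomposeFin.symm.surjective ρ
  have hp : p = 0 := by
    rw [← hρ0, ← hpτ, Equiv.Perm.decomposeFin_symm_apply_zero]
  subst hp
  have hτ : ∀ x : Fin (k + 1), ρ x.succ = (τ x).succ := fun x => by
    rw [← hpτ, Equiv.Perm.decomposeFin_symm_apply_succ]; simp
  have hτ0 : τ 0 = 0 := by
    have := hτ 0
    rw [Fin.succ_zero_eq_one, hρ1] at this
    exact (Fin.succ_injective _ (by simpa using this)).symm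
  have hsgn : sgn τ = sgn ρ := by
    rw [sgn, sgn, ← hpτ, Equiv.Perm.decomposeFin.symm_sign]; simp
  have hcomp : mergeMap i j h = τ ∘ f := by
    funext v
    apply Fin.ext
    change (frontPerm i j v : ℕ) - 1 = (τ (f v) : ℕ)
    rw [← hρπ]
    rcases Fin.eq_zero_or_eq_succ (π v) with h0 | ⟨x, hx⟩
    · have : f v = (0 : Fin (k + 1)) := Fin.ext (by rw [hf, h0]; simp)
      rw [h0, hρ0, this, hτ0]; simp
    · have : f v = x := Fin.ext (by rw [hf, hx]; simp)
      rw [hx, hτ, this]; simp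
  rw [collapse, dif_neg h, hcomp, ← mapArrows_mapArrows]
  have := cls_relabel m (mapArrows f E) τ
  refine (congrArg _ this).trans ?_
  rw [smul_smul]
  congr 1
  have h2 : frontPerm i j = ρ * π := by simp [hρ]
  rw [h2, hsgn, sgn_mul, mul_right_comm, sgn_mul_self, one_mul]

theorem collapse_relabel (m : ℕ) {k : ℕ} (i j : Fin k) (E : Multiset (Fin k × Fin k))
    (σ : Equiv.Perm (Fin k)) :
    collapse m (σ i) (σ j) (mapArrows σ E) = sgn σ • collapse m i j E := by
  by_cases h : i = j
  · simp [collapse, h]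
  · have h' : σ i ≠ σ j := fun e => h (σ.injective e)
    have key := collapse_eq m i j h E (frontPerm (σ i) (σ j) * σ)
      (by rw [Equiv.Perm.mul_apply]; exact frontPerm_left)
      (by rw [Equiv.Perm.mul_apply]; exact frontPerm_right h')
      (mergeMap (σ i) (σ j) h' ∘ σ) (fun v => by rw [Equiv.Perm.mul_apply]; rfl)
    rw [key, collapse, dif_neg h', mapArrows_mapArrows, smul_smul, sgn_mul,
      mul_comm (sgn (frontPerm _ _)), ← mul_assoc, sgn_mul_self, one_mul]

theorem collapse_reversal (m : ℕ) {k : ℕ} (i j a b : Fin k) (E : Multiset (Fin k × Fin k)) :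
    collapse m i j ((b, a) ::ₘ E) = - collapse m i j ((a, b) ::ₘ E) := by
  by_cases h : i = j
  · simp [collapse, h]
  · rw [collapse, collapse, dif_neg h, dif_neg h, ← smul_neg, mapArrows, mapArrows,
      Multiset.map_cons, Multiset.map_cons]
    congr 1
    exact cls_reversal m _ _ _

theorem vtx_map {k l : ℕ} (f : Fin k → Fin l) (a : Fin k × Fin k) (s : Bool) :
    vtx (Prod.map f f a) s = f (vtx a s) := by
  cases s <;> rfl

theorem contractPair_relabel (m : ℕ) {k : ℕ} (a : Fin k × Fin k) (s : Bool) (b : Fin k × Fin k)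
    (t : Bool) (E : Multiset (Fin k × Fin k)) (σ : Equiv.Perm (Fin k)) :
    contractPair m (Prod.map σ σ a) s (Prod.map σ σ b) t (mapArrows σ E)
      = sgn σ • contractPair m a s b t E := by
  have := collapse_relabel m (vtx a s) (vtx b t) ((vtx b (!t), vtx a (!s)) ::ₘ E) σ
  rw [contractPair, contractPair, smul_comm, ← this]
  simp [vtx_map, mapArrows]

theorem contractPair_reversal (m : ℕ) {k : ℕ} (a : Fin k × Fin k) (s : Bool) (b : Fin k × Fin k)
    (t : Bool) (x y : Fin k) (E : Multiset (Fin k × Fin k)) :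
    contractPair m a s b t ((y, x) ::ₘ E) = - contractPair m a s b t ((x, y) ::ₘ E) := by
  rw [contractPair, contractPair, Multiset.cons_swap, collapse_reversal, Multiset.cons_swap,
    smul_neg]

theorem contractPair_swap_left (m : ℕ) {k : ℕ} (x y : Fin k) (b : Fin k × Fin k) (t : Bool)
    (E : Multiset (Fin k × Fin k)) :
    ∑ s, contractPair m (y, x) s b t E = - ∑ s, contractPair m (x, y) s b t E := by
  cases t <;> simp [contractPair, vtx, halfSign, add_comm]

theorem contractPair_swap_right (m : ℕ) {k : ℕ} (a : Fin k × Fin k) (s : Bool) (x y : Fin k)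
    (E : Multiset (Fin k × Fin k)) :
    ∑ t, contractPair m a s (y, x) t E = - ∑ t, contractPair m a s (x, y) t E := by
  cases s <;> simp [contractPair, vtx, halfSign, add_comm]

/-- The permutation of the vertices of `X·Y` given by permutations for `X` and for `Y`. -/
def blockPerm {x y : ℕ} (σ : Equiv.Perm (Fin x)) (τ : Equiv.Perm (Fin y)) :
    Equiv.Perm (Fin (x + y)) :=
  finSumFinEquiv.permCongr (Equiv.Perm.sumCongr σ τ)

theorem blockPerm_castAdd {x y : ℕ} (σ : Equiv.Perm (Fin x)) (τ : Equiv.Perm (Fin y)) (v : Fin x) :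
    blockPerm σ τ (Fin.castAdd y v) = Fin.castAdd y (σ v) := by
  simp [blockPerm, Equiv.permCongr_apply]

theorem blockPerm_natAdd {x y : ℕ} (σ : Equiv.Perm (Fin x)) (τ : Equiv.Perm (Fin y)) (v : Fin y) :
    blockPerm σ τ (Fin.natAdd x v) = Fin.natAdd x (τ v) := by
  simp [blockPerm, Equiv.permCongr_apply]

theorem sgn_blockPerm {x y : ℕ} (σ : Equiv.Perm (Fin x)) (τ : Equiv.Perm (Fin y)) :
    sgn (blockPerm σ τ) = sgn σ * sgn τ := by
  simp [sgn, blockPerm, Equiv.Perm.sign_permCongr, Equiv.Perm.sign_sumCongr]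

theorem bracketArrows_relabel (m : ℕ) {x y : ℕ} (E : Multiset (Fin x × Fin x))
    (F : Multiset (Fin y × Fin y)) (σ : Equiv.Perm (Fin x)) (τ : Equiv.Perm (Fin y)) :
    bracketArrows m (mapArrows σ E) (mapArrows τ F) = (sgn σ * sgn τ) • bracketArrows m E F := by
  have hinj : ∀ {k : ℕ} (σ : Equiv.Perm (Fin k)), Function.Injective (Prod.map σ σ) :=
    fun σ => σ.injective.prodMap σ.injective
  have hσ : blockPerm σ τ ∘ Fin.castAdd y = Fin.castAdd y ∘ σ :=
    funext fun v => blockPerm_castAdd σ τ v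
  have hτ : blockPerm σ τ ∘ Fin.natAdd x = Fin.natAdd x ∘ τ :=
    funext fun v => blockPerm_natAdd σ τ v
  have herase : ∀ {k : ℕ} (σ : Equiv.Perm (Fin k)) (E : Multiset (Fin k × Fin k)) (a),
      (mapArrows σ E).erase (Prod.map σ σ a) = mapArrows σ (E.erase a) :=
    fun σ E a => (Multiset.map_erase _ (hinj σ) a E).symm
  have hadd : ∀ {k l : ℕ} (f : Fin k → Fin l) (E F : Multiset (Fin k × Fin k)),
      mapArrows f (E + F) = mapArrows f E + mapArrows f F := fun f E F => Multiset.map_add _ _ _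
  rw [bracketArrows, bracketArrows, Multiset.smul_sum, mapArrows, Multiset.map_map,
    Multiset.map_map]
  refine congrArg Multiset.sum (Multiset.map_congr rfl fun a _ => ?_)
  rw [Function.comp_apply, Function.comp_apply, Multiset.smul_sum]
  conv_lhs => arg 1; arg 2; rw [mapArrows]
  rw [Multiset.map_map, Multiset.map_map]
  refine congrArg Multiset.sum (Multiset.map_congr rfl fun b _ => ?_)
  rw [Function.comp_apply, Function.comp_apply, Finset.smul_sum]
  refine Finset.sum_congr rfl fun s _ => ?_
  rw [Finset.smul_sum]
  refine Finset.sum_congr rfl fun t _ => ?_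
  rw [← sgn_blockPerm, ← contractPair_relabel, hadd, mapArrows_mapArrows, mapArrows_mapArrows,
    hσ, hτ, ← mapArrows_mapArrows, ← mapArrows_mapArrows, ← herase, ← herase, Prod.map_map,
    Prod.map_map, Prod.map_map, Prod.map_map, hσ, hτ]
  rfl

theorem bracketArrows_reversal_left (m : ℕ) {k l : ℕ} (x y : Fin k) (E : Multiset (Fin k × Fin k))
    (F : Multiset (Fin l × Fin l)) :
    bracketArrows m ((y, x) ::ₘ E) F = - bracketArrows m ((x, y) ::ₘ E) F := by
  rw [bracketArrows, bracketArrows, Multiset.map_cons, Multiset.map_cons, Multiset.sum_cons,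
    Multiset.sum_cons, Multiset.erase_cons_head, Multiset.erase_cons_head, neg_add]
  congr 1
  · rw [← Multiset.sum_map_neg]
    refine congrArg Multiset.sum (Multiset.map_congr rfl fun b _ => ?_)
    rw [Finset.sum_comm, Finset.sum_comm (s := Finset.univ) (t := Finset.univ)
      (f := fun s t => contractPair m (Prod.map (Fin.castAdd l) (Fin.castAdd l) (x, y)) s _ t _),
      ← Finset.sum_neg_distrib]
    exact Finset.sum_congr rfl fun t _ => contractPair_swap_left m _ _ _ _ _
  · rw [← Multiset.sum_map_neg]
    refine congrArg Multiset.sum (Multiset.map_congr rfl fun a ha => ?_)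
    rw [← Multiset.sum_map_neg]
    refine congrArg Multiset.sum (Multiset.map_congr rfl fun b _ => ?_)
    rw [← Finset.sum_neg_distrib]
    refine Finset.sum_congr rfl fun s _ => ?_
    rw [← Finset.sum_neg_distrib]
    refine Finset.sum_congr rfl fun t _ => ?_
    rw [Multiset.erase_cons_tail_of_mem ha, Multiset.erase_cons_tail_of_mem ha, mapArrows,
      mapArrows, mapArrows, Multiset.map_cons, Multiset.map_cons, Multiset.cons_add, Multiset.cons_add]
    exact contractPair_reversal m _ _ _ _ _ _ _

theorem bracketArrows_reversal_right (m : ℕ) {k l : ℕ} (E : Multiset (Fin l × Fin l)) (x y : Fin k)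
    (F : Multiset (Fin k × Fin k)) :
    bracketArrows m E ((y, x) ::ₘ F) = - bracketArrows m E ((x, y) ::ₘ F) := by
  rw [bracketArrows, bracketArrows, ← Multiset.sum_map_neg]
  refine congrArg Multiset.sum (Multiset.map_congr rfl fun a _ => ?_)
  rw [Multiset.map_cons, Multiset.map_cons, Multiset.sum_cons, Multiset.sum_cons,
    Multiset.erase_cons_head, Multiset.erase_cons_head, neg_add]
  congr 1
  · rw [← Finset.sum_neg_distrib]
    exact Finset.sum_congr rfl fun s _ => contractPair_swap_right m _ _ _ _ _
  · rw [← Multiset.sum_map_neg]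
    refine congrArg Multiset.sum (Multiset.map_congr rfl fun b hb => ?_)
    rw [← Finset.sum_neg_distrib]
    refine Finset.sum_congr rfl fun s _ => ?_
    rw [← Finset.sum_neg_distrib]
    refine Finset.sum_congr rfl fun t _ => ?_
    rw [Multiset.erase_cons_tail_of_mem hb, Multiset.erase_cons_tail_of_mem hb]
    rw [mapArrows, mapArrows, mapArrows, Multiset.map_cons, Multiset.map_cons, Multiset.add_cons,
      Multiset.add_cons]
    exact contractPair_reversal m _ _ _ _ _ _ _

theorem mapArrows_one {k : ℕ} (E : Multiset (Fin k × Fin k)) :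
    mapArrows (1 : Equiv.Perm (Fin k)) E = E := by
  simp [mapArrows]

theorem sgn_one {k : ℕ} : sgn (1 : Equiv.Perm (Fin k)) = 1 := by simp [sgn]

/-- The graph bracket `[X, Y] = ∑_{h ∈ X, k ∈ Y} (X·Y)_{hk}`. For `m ≥ 2` all terms are zero or
have valence at least `m` at all vertices, since a merged vertex has valence
`|v(h)| + |v(k)| - 2` and the other valences do not change. -/
def graphBracket (m : ℕ) : GraphSpace m →ₗ[ℝ] GraphSpace m →ₗ[ℝ] GraphSpace m :=
  liftGraph m
    (fun _ E => liftGraph m (fun _ F => bracketArrows m E F)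
      (fun _ a b F => bracketArrows_reversal_right m E a b F)
      (fun _ F τ => by
        have := bracketArrows_relabel m E F 1 τ
        rwa [mapArrows_one, sgn_one, one_mul] at this))
    (fun k a b E => graphSpace_hom_ext fun Y => by
      rw [LinearMap.neg_apply, liftGraph_cls, liftGraph_cls]
      exact bracketArrows_reversal_left m a b E Y.1.arrows)
    (fun k E σ => graphSpace_hom_ext fun Y => by
      have := bracketArrows_relabel m E Y.1.arrows σ 1
      rw [mapArrows_one, sgn_one, mul_one] at this
      rw [LinearMap.smul_apply, liftGraph_cls, liftGraph_cls]
      exact this)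

theorem graphBracket_cls (m : ℕ) (X Y : AGraph m) :
    graphBracket m (cls m X.1) (cls m Y.1) = bracketArrows m X.1.arrows Y.1.arrows := by
  rw [graphBracket, liftGraph_cls, liftGraph_cls]

/-! ### From graphs to invariants -/

open Classical in
/-- A polynomial as an element of `cₙ`; `0` if it has a constant or linear term. -/
def toPolyLie {n : ℕ} (f : Poly n) : polyLie n := if h : f ∈ polyLie n then ⟨f, h⟩ else 0

/-- Polynomials in `k` vectors `x_v = (p^v, q^v)` of `ℝ²ⁿ`, i.e. elements of the `k`-fold tensor
power of `Poly n`, are mapped to the exterior power: a product `∏ᵥ Mᵥ(x_v)` of monomials goes to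
`M₀ ∧ ⋯ ∧ M_{k-1}`. Below this is applied to monomials `Mᵥ` of degree at least 2 only. -/
def wedgePoly (n k : ℕ) :
    MvPolynomial (Fin k × (Fin n ⊕ Fin n)) ℝ →ₗ[ℝ] ExteriorAlgebra ℝ (polyLie n) :=
  (basisMonomials (Fin k × (Fin n ⊕ Fin n)) ℝ).constr ℝ fun M =>
    ExteriorAlgebra.ιMulti ℝ k fun v => toPolyLie (monomial (M.curry v) 1)

/-- The sum over the states of an arrow: `pᵢ` at the tail and `qᵢ` at the head, or, with a minus
sign, `qᵢ` at the tail and `pᵢ` at the head. -/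
def arrowPoly (n : ℕ) {k : ℕ} (a : Fin k × Fin k) : MvPolynomial (Fin k × (Fin n ⊕ Fin n)) ℝ :=
  ∑ i : Fin n, (X (a.1, Sum.inl i) * X (a.2, Sum.inr i) - X (a.1, Sum.inr i) * X (a.2, Sum.inl i))

/-- The sum over all states of a graph of the signed wedge product, in the order of the vertices,
of the monomials which the labels of the half-edges form at the vertices. Expanding the product
over the arrows gives the sum over all states. -/
def stateArrows (n k : ℕ) (E : Multiset (Fin k × Fin k)) : ExteriorAlgebra ℝ (polyLie n) :=
  wedgePoly n k (E.map (arrowPoly n)).prod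

theorem arrowPoly_swap (n : ℕ) {k : ℕ} (a b : Fin k) :
    arrowPoly n (b, a) = - arrowPoly n (a, b) := by
  simp only [arrowPoly, ← Finset.sum_neg_distrib]
  exact Finset.sum_congr rfl fun i _ => by ring

theorem wedgePoly_rename (n k : ℕ) (σ : Equiv.Perm (Fin k))
    (P : MvPolynomial (Fin k × (Fin n ⊕ Fin n)) ℝ) :
    wedgePoly n k (rename (Prod.map σ id) P) = sgn σ • wedgePoly n k P := by
  have : wedgePoly n k ∘ₗ (rename (R := ℝ) (Prod.map σ id)).toLinearMap = sgn σ • wedgePoly n k := by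
    refine (basisMonomials (Fin k × (Fin n ⊕ Fin n)) ℝ).ext fun M => ?_
    have h1 : rename (Prod.map σ id) (monomial M (1 : ℝ))
        = basisMonomials _ ℝ (M.mapDomain (Prod.map σ id)) := by
      rw [rename_monomial, coe_basisMonomials]
    have h2 : ∀ v, (M.mapDomain (Prod.map σ id)).curry v = M.curry (σ⁻¹ v) := fun v => by
      ext b
      have hinj : Function.Injective (Prod.map σ (id : Fin n ⊕ Fin n → _)) :=
        σ.injective.prodMap Function.injective_id
      have := Finsupp.mapDomain_apply hinj M (σ⁻¹ v, b)
      simpa using this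
    simp only [LinearMap.comp_apply, AlgHom.toLinearMap_apply, LinearMap.smul_apply,
      coe_basisMonomials]
    have h3 : monomial M (1 : ℝ) = basisMonomials _ ℝ M := by rw [coe_basisMonomials]
    rw [h1, h3, wedgePoly, Module.Basis.constr_basis, Module.Basis.constr_basis]
    simp only [h2]
    have := (ExteriorAlgebra.ιMulti ℝ k).map_perm (fun v => toPolyLie (monomial (M.curry v) (1 : ℝ))) σ⁻¹
    simp only [Function.comp_def] at this
    rw [this, Equiv.Perm.sign_inv, sgn, Int.cast_smul_eq_zsmul, Units.smul_def]
  exact LinearMap.congr_fun this P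

/-- The map from graphs to `Λcₙ` given by the sum over all states. -/
def stateMap (n : ℕ) : GraphSpace 2 →ₗ[ℝ] ExteriorAlgebra ℝ (polyLie n) :=
  liftGraph 2 (stateArrows n)
    (fun k a b E => by
      simp only [stateArrows, Multiset.map_cons, Multiset.prod_cons, arrowPoly_swap n a b, neg_mul,
        map_neg])
    (fun k E σ => by
      have h : ((mapArrows σ E).map (arrowPoly n)).prod
          = rename (Prod.map σ id) (E.map (arrowPoly n)).prod := by
        rw [map_multiset_prod, mapArrows, Multiset.map_map, Multiset.map_map]
        refine congrArg Multiset.prod (Multiset.map_congr rfl fun a _ => ?_)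
        simp [arrowPoly]
      rw [stateArrows, stateArrows, h, wedgePoly_rename])

/-- The adjoint action of `u ∈ L` on `ΛL`. -/
def adWedge {L : Type*} [LieRing L] [LieAlgebra ℝ L] (u : L) :
    ExteriorAlgebra ℝ L →ₗ[ℝ] ExteriorAlgebra ℝ L :=
  pick (LinearMap.mul ℝ (ExteriorAlgebra ℝ L) ∘ₗ ExteriorAlgebra.ι ℝ ∘ₗ (LieAlgebra.ad ℝ L u : L →ₗ[ℝ] L))

/-- `u · (w₀ ∧ ⋯ ∧ wₖ) = ∑ⱼ w₀ ∧ ⋯ ∧ [u, wⱼ] ∧ ⋯ ∧ wₖ`. -/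
theorem adWedge_ιMulti {L : Type*} [LieRing L] [LieAlgebra ℝ L] (u : L) {k : ℕ} (w : Fin k → L) :
    adWedge u (ExteriorAlgebra.ιMulti ℝ k w)
      = ∑ j : Fin k, ExteriorAlgebra.ιMulti ℝ k (Function.update w j ⁅u, w j⁆) := by
  cases k with
  | zero => simp [adWedge, pick_one]
  | succ k =>
    rw [adWedge, pick_ιMulti]
    refine Finset.sum_congr rfl fun j _ => ?_
    have h1 : Function.update w j ⁅u, w j⁆ = j.insertNth ⁅u, w j⁆ (j.removeNth w) := by
      rw [Fin.insertNth_removeNth]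
    rw [h1, AlternatingMap.map_insertNth]
    rcases Nat.even_or_odd (j : ℕ) with h | h <;>
      simp [h.neg_one_pow, ExteriorAlgebra.ιMulti_succ_apply, Matrix.vecTail, Function.comp_def]

/-- `(Λcₙ)^{sp(2n)}`, where `sp(2n)` is the Lie subalgebra of `cₙ` which consists of the
homogeneous quadratic polynomials. -/
def spInvariants (n : ℕ) : Submodule ℝ (ExteriorAlgebra ℝ (polyLie n)) :=
  ⨅ u : {u : polyLie n // (u : Poly n).IsHomogeneous 2}, LinearMap.ker (adWedge u.1)

/-- The invariants of exterior degree at most `2n + 1`: the range in which an invariant determines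
the linear combination of graphs that it comes from. -/
def stableInvariants (n : ℕ) : Submodule ℝ (ExteriorAlgebra ℝ (polyLie n)) :=
  spInvariants n ⊓ ⨆ k ∈ Set.Iic (2 * n + 1), ⋀[ℝ]^k (polyLie n)

/-- The chains with at most `2n + 1` vertices, bivalent vertices allowed. -/
def stableChains (n : ℕ) : Submodule ℝ (GraphSpace 2) :=
  ⨆ k ∈ Set.Iic (2 * n + 1), chains 2 k

/-- The map `φₙ` from the invariants to the graph complex: the inverse of the sum over states,
followed by the projection that kills the graphs with a bivalent vertex. (The sum over states
restricts to a bijection from `stableChains n` to `stableInvariants n`, so that on the latter every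
left inverse of it is its inverse.) -/
def phi (n : ℕ) : stableInvariants n →ₗ[ℝ] GraphSpace 3 :=
  reduce ∘ₗ (stableChains n).subtype ∘ₗ
    (stateMap n ∘ₗ (stableChains n).subtype).leftInverse ∘ₗ (stableInvariants n).subtype

end KGraph

end

/-! Assign to a graph with k vertices the product over its arrows of the symplectic products ω(x_v,
x_w), a polynomial in k vectors of ℝ²ⁿ (`arrowProd`). Its degree in each vector is the valence of
the vertex, so the valence condition places it in `highDegree`, which plays the role of the k-fold
tensor power of `cₙ`. The map `wedgePoly` projects this to the exterior power, and `antisymmetrize`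
inverts it up to k! and up to signed symmetrization. Both respect the action of `sp(2n)`, so the
statement about ψₙ becomes classical invariant theory.

Surjectivity is the first fundamental theorem (`mem_span_arrowPoly_of_spAction_eq_zero`): an
invariant polynomial is a combination of products of symplectic products. In the Fischer inner
product, multiplication by a variable is adjoint to differentiation. Subtract from an invariant its
orthogonal projection to the span of such products. By induction on the degree, the difference is
killed by the adjoints of multiplication by ω(x_v, x_w). A Casimir identity then equates a sum of
squared norms with minus the sum of the squared norms of the partial derivatives, so the difference
is constant, and hence zero.

Injectivity for k ≤ 2n+1 is the easy range of the second fundamental theorem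
(`graphOfPoly_eq_zero`): a skew matrix of size at most 2n+1 has rank at most 2n, hence is the matrix
of symplectic products of vectors in ℝ²ⁿ (`exists_symplectic_vectors`). A relation among the
symplectic products therefore vanishes on all skew matrices, and holds already among graphs because
of the orientation relations.

For the brackets, the Poisson bracket of the factors at two vertices expands by Leibniz into a sum
over pairs of half-edges; summing over the contracted index leaves the new arrow from k̄ to h̄
(`pairPoisson_arrowPoly`), and the Schouten sign is the sign of the renumbering that brings the
merged vertices to the front (`sgn_frontPerm_castAdd_natAdd`).

Finally, r respects the brackets because the bracket with a graph having a bivalent vertex v has no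
component of valence at least three. Contractions away from v leave v bivalent. Contracting at v
inserts v's two neighbours as new ends of a cut arrow of the other graph; each result arises once
from each of the two half-edges at v, with opposite signs (`contractPair_cancel`). -/

noncomputable section

open MvPolynomial

namespace KGraph

/-! ### The Fischer inner product -/

section Fischer

variable {σ : Type*}

/-- The product of the factorials of the exponents of a monomial. -/
def multiFactorial (s : σ →₀ ℕ) : ℝ := s.prod fun _ e => (e.factorial : ℝ)

theorem multiFactorial_pos (s : σ →₀ ℕ) : 0 < multiFactorial s :=
  Finset.prod_pos fun _ _ => by positivity

theorem multiFactorial_add_single (s : σ →₀ ℕ) (i : σ) :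
    multiFactorial (s + Finsupp.single i 1) = multiFactorial s * (s i + 1) := by
  classical
  have h1 : s + Finsupp.single i 1 = s.update i (s i + 1) := by
    ext j
    by_cases h : j = i
    · subst h; simp
    · simp [h]
  have h2 := Finsupp.mul_prod_erase' s i (fun _ e => (e.factorial : ℝ)) (by simp)
  have h3 := Finsupp.mul_prod_erase' (s.update i (s i + 1)) i (fun _ e => (e.factorial : ℝ)) (by simp)
  rw [Finsupp.erase_update_eq_erase] at h3
  rw [multiFactorial, multiFactorial, h1, ← h2, ← h3]
  simp [Nat.factorial_succ]
  ring

/-- The bilinear form for which the monomials `x^s` are orthogonal with square `s!`. -/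
def fischer : MvPolynomial σ ℝ →ₗ[ℝ] MvPolynomial σ ℝ →ₗ[ℝ] ℝ :=
  (basisMonomials σ ℝ).constr ℝ fun s => multiFactorial s • lcoeff ℝ s

theorem fischer_monomial (s : σ →₀ ℕ) (g : MvPolynomial σ ℝ) :
    fischer (monomial s 1) g = multiFactorial s * coeff s g := by
  have : monomial s (1 : ℝ) = basisMonomials σ ℝ s := by rw [coe_basisMonomials]
  rw [fischer, this, Module.Basis.constr_basis]
  simp

theorem fischer_comm (f g : MvPolynomial σ ℝ) : fischer f g = fischer g f := by
  classical
  have : fischer (σ := σ) = fischer.flip := by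
    refine (basisMonomials σ ℝ).ext fun s => (basisMonomials σ ℝ).ext fun t => ?_
    simp only [coe_basisMonomials, LinearMap.flip_apply, fischer_monomial, coeff_monomial]
    by_cases h : s = t
    · subst h; simp
    · simp [h, Ne.symm h]
  exact LinearMap.congr_fun (LinearMap.congr_fun this f) g

/-- On monomials this is the identity `multiFactorial_add_single`: raising an exponent multiplies
the factorial by the very factor that differentiation produces. It makes multiplication by a
variable adjoint to the partial derivative. -/
theorem fischer_X_mul (i : σ) (f g : MvPolynomial σ ℝ) :
    fischer (X i * f) g = fischer f (pderiv i g) := by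
  have : fischer ∘ₗ LinearMap.mulLeft ℝ (X i : MvPolynomial σ ℝ)
      = (LinearMap.lcomp ℝ ℝ (pderiv i : Derivation ℝ (MvPolynomial σ ℝ) _).toLinearMap) ∘ₗ fischer := by
    refine (basisMonomials σ ℝ).ext fun s => LinearMap.ext fun g => ?_
    simp only [coe_basisMonomials, LinearMap.comp_apply, LinearMap.mulLeft_apply,
      LinearMap.lcomp_apply, Derivation.coeFn_coe]
    rw [X, monomial_mul, one_mul, add_comm, fischer_monomial, fischer_monomial,
      multiFactorial_add_single, coeff_pderiv]
    ring
  exact LinearMap.congr_fun (LinearMap.congr_fun this f) g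

theorem fischer_mul_X (i : σ) (f g : MvPolynomial σ ℝ) :
    fischer f (X i * g) = fischer (pderiv i f) g := by
  rw [fischer_comm, fischer_X_mul, fischer_comm]

theorem fischer_self (f : MvPolynomial σ ℝ) :
    fischer f f = ∑ s ∈ f.support, multiFactorial s * coeff s f ^ 2 := by
  conv_lhs => arg 1; rw [f.as_sum]
  simp only [map_sum, LinearMap.sum_apply]
  refine Finset.sum_congr rfl fun s _ => ?_
  rw [← mul_one (coeff s f), ← smul_eq_mul, ← smul_monomial, map_smul, LinearMap.smul_apply,
    fischer_monomial, smul_eq_mul]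
  simp; ring

theorem fischer_self_nonneg (f : MvPolynomial σ ℝ) : 0 ≤ fischer f f := by
  rw [fischer_self]
  exact Finset.sum_nonneg fun s _ => mul_nonneg (multiFactorial_pos s).le (sq_nonneg _)

theorem eq_zero_of_fischer_self {f : MvPolynomial σ ℝ} (h : fischer f f = 0) : f = 0 := by
  rw [fischer_self, Finset.sum_eq_zero_iff_of_nonneg
    fun s _ => mul_nonneg (multiFactorial_pos s).le (sq_nonneg _)] at h
  refine support_eq_empty.mp (Finset.eq_empty_of_forall_notMem fun s hs => ?_)
  rcases mul_eq_zero.mp (h s hs) with h' | h'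
  · exact (multiFactorial_pos s).ne' h'
  · exact mem_support_iff.mp hs (pow_eq_zero_iff two_ne_zero |>.mp h')

/-- A positive definite form is nondegenerate on every subspace, so on a finite-dimensional one the
functional given by `f` is represented by a vector. -/
theorem exists_fischer_projection (W : Submodule ℝ (MvPolynomial σ ℝ)) [FiniteDimensional ℝ W]
    (f : MvPolynomial σ ℝ) : ∃ g ∈ W, ∀ w ∈ W, fischer w (f - g) = 0 := by
  set T : W →ₗ[ℝ] Module.Dual ℝ W := (LinearMap.lcomp ℝ ℝ W.subtype) ∘ₗ fischer ∘ₗ W.subtype with hT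
  have hinj : Function.Injective T := by
    rw [injective_iff_map_eq_zero]
    intro g hg
    exact Subtype.ext (eq_zero_of_fischer_self (LinearMap.congr_fun hg g))
  have hsurj : Function.Surjective T :=
    (LinearMap.injective_iff_surjective_of_finrank_eq_finrank
      Subspace.dual_finrank_eq.symm).mp hinj
  obtain ⟨g, hg⟩ := hsurj ((fischer f) ∘ₗ W.subtype)
  refine ⟨g, g.2, fun w hw => ?_⟩
  have := LinearMap.congr_fun hg ⟨w, hw⟩
  rw [map_sub, fischer_comm, fischer_comm w, sub_eq_zero]
  exact this.symm

theorem eq_C_of_pderiv_eq_zero {f : MvPolynomial σ ℝ} (h : ∀ i, pderiv i f = 0) :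
    f = C (coeff 0 f) := by
  classical
  ext s
  rw [coeff_C]
  split_ifs with hs
  · rw [hs]
  · obtain ⟨i, hi⟩ := Finsupp.ne_iff.mp (Ne.symm hs)
    have h1 := congrArg (coeff (s - Finsupp.single i 1)) (h i)
    have h2 : s - Finsupp.single i 1 + Finsupp.single i 1 = s :=
      Finsupp.sub_add_single_one_cancel hi
    rw [coeff_pderiv, h2, coeff_zero] at h1
    exact (mul_eq_zero.mp h1).resolve_right (by positivity)

theorem totalDegree_pderiv_le (i : σ) (f : MvPolynomial σ ℝ) :
    (pderiv i f).totalDegree ≤ f.totalDegree - 1 := by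
  refine Finset.sup_le fun s hs => ?_
  rw [mem_support_iff, coeff_pderiv] at hs
  have := le_totalDegree (mem_support_iff.mpr (left_ne_zero_of_mul hs))
  rw [Finsupp.sum_add_index' (by simp) (by simp)] at this
  simp at this
  omega

end Fischer

/-! ### The first fundamental theorem for `sp(2n)` -/

section FirstFundamentalTheorem

variable {n k : ℕ}

/-- The sign of `{X b, X b.swap}`. -/
def eps (b : Fin n ⊕ Fin n) : ℝ := Sum.elim (fun _ => 1) (fun _ => -1) b

theorem eps_swap (b : Fin n ⊕ Fin n) : eps b.swap = - eps b := by
  cases b <;> simp [eps]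

theorem eps_mul_self (b : Fin n ⊕ Fin n) : eps b * eps b = 1 := by
  cases b <;> simp [eps]

theorem arrowPoly_eq_sum (v w : Fin k) :
    arrowPoly n (v, w) = ∑ b, eps b • (X (v, b) * X (w, b.swap)) := by
  simp [arrowPoly, Fintype.sum_sum_type, eps, Finset.sum_sub_distrib, ← sub_eq_add_neg]

/-- The derivation `∑ᵥ x_{v,a} ∂/∂x_{v,b}`. -/
def polarization (k : ℕ) (a b : Fin n ⊕ Fin n) :
    Derivation ℝ (MvPolynomial (Fin k × (Fin n ⊕ Fin n)) ℝ)
      (MvPolynomial (Fin k × (Fin n ⊕ Fin n)) ℝ) :=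
  ∑ v : Fin k, (X (v, a) : MvPolynomial (Fin k × (Fin n ⊕ Fin n)) ℝ) • pderiv (v, b)

theorem derivation_sum_apply {ι A : Type*} [CommRing A] [Algebra ℝ A] (s : Finset ι)
    (D : ι → Derivation ℝ A A) (f : A) : (∑ i ∈ s, D i) f = ∑ i ∈ s, D i f := by
  rw [← Derivation.coeFnAddMonoidHom_apply, map_sum, Finset.sum_apply]
  rfl

theorem polarization_apply (a b : Fin n ⊕ Fin n) (f : MvPolynomial (Fin k × (Fin n ⊕ Fin n)) ℝ) :
    polarization k a b f = ∑ v, X (v, a) * pderiv (v, b) f := by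
  simp [polarization, derivation_sum_apply]

/-- The action of the quadratic polynomial `X a * X b` on polynomials in `k` vectors. -/
def spAction (k : ℕ) (a b : Fin n ⊕ Fin n) :
    Derivation ℝ (MvPolynomial (Fin k × (Fin n ⊕ Fin n)) ℝ)
      (MvPolynomial (Fin k × (Fin n ⊕ Fin n)) ℝ) :=
  eps b • polarization k a b.swap + eps a • polarization k b a.swap

theorem spAction_apply (a b : Fin n ⊕ Fin n) (f : MvPolynomial (Fin k × (Fin n ⊕ Fin n)) ℝ) :
    spAction k a b f = eps b • polarization k a b.swap f + eps a • polarization k b a.swap f := rfl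

theorem polarization_X (a b c : Fin n ⊕ Fin n) (v : Fin k) :
    polarization k a b (X (v, c)) = if c = b then X (v, a) else 0 := by
  classical
  rw [polarization_apply]
  simp only [pderiv_X, Pi.single_apply, Prod.mk.injEq, ite_and]
  by_cases h : c = b <;> simp [h]

theorem spAction_X (a b c : Fin n ⊕ Fin n) (v : Fin k) :
    spAction k a b (X (v, c)) = (if c = b.swap then eps b • X (v, a) else 0)
      + if c = a.swap then eps a • X (v, b) else 0 := by
  rw [spAction_apply, polarization_X, polarization_X]
  simp only [smul_ite, smul_zero]

/-- Invariance of the symplectic form: the terms from the tail and from the head cancel, since `eps`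
changes sign under `Sum.swap`. -/
theorem spAction_arrowPoly (a b : Fin n ⊕ Fin n) (e : Fin k × Fin k) :
    spAction k a b (arrowPoly n e) = 0 := by
  obtain ⟨v, w⟩ := e
  have hs : ∀ c d : Fin n ⊕ Fin n, c.swap = d.swap ↔ c = d := fun c d =>
    Sum.swap_leftInverse.injective.eq_iff
  rw [arrowPoly_eq_sum]
  simp only [map_sum, Derivation.map_smul, Derivation.leibniz, spAction_X, smul_eq_mul, hs]
  simp only [mul_add, smul_add, Finset.sum_add_distrib, mul_ite, mul_zero, smul_ite, smul_zero,
    Finset.sum_ite_eq', Finset.mem_univ, if_true, Sum.swap_swap, eps_swap]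
  simp only [mul_smul_comm, smul_smul, neg_mul, eps_mul_self]
  rw [mul_comm (X (w, b)) (X (v, a)), mul_comm (X (w, a)) (X (v, b))]
  module

theorem fischer_polarization (a b : Fin n ⊕ Fin n)
    (f g : MvPolynomial (Fin k × (Fin n ⊕ Fin n)) ℝ) :
    fischer (polarization k a b f) g = fischer f (polarization k b a g) := by
  simp only [polarization_apply, map_sum, LinearMap.sum_apply, fischer_X_mul, fischer_mul_X]

/-- Transposition turns `polarization k a b` into `polarization k b a`, and `sp(2n)` is closed under
transposition. This is the form in which the compatibility of the inner product with the Lie algebra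
is used. -/
theorem fischer_spAction (a b : Fin n ⊕ Fin n)
    (f g : MvPolynomial (Fin k × (Fin n ⊕ Fin n)) ℝ) :
    fischer f (spAction k a b g) = -(eps a * eps b) • fischer (spAction k b.swap a.swap f) g := by
  simp only [spAction_apply, map_add, map_smul, LinearMap.add_apply, LinearMap.smul_apply,
    fischer_polarization, Sum.swap_swap, eps_swap, smul_eq_mul]
  linear_combination (- eps b * fischer f (polarization k a b.swap g)) * eps_mul_self a
    - (eps a * fischer f (polarization k b a.swap g)) * eps_mul_self b

/-- The differential operator adjoint to the multiplication by `arrowPoly n (v, w)`. -/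
def arrowDual (v w : Fin k) (f : MvPolynomial (Fin k × (Fin n ⊕ Fin n)) ℝ) :
    MvPolynomial (Fin k × (Fin n ⊕ Fin n)) ℝ :=
  ∑ b, eps b • pderiv (w, b.swap) (pderiv (v, b) f)

theorem fischer_arrowPoly_mul (v w : Fin k) (f g : MvPolynomial (Fin k × (Fin n ⊕ Fin n)) ℝ) :
    fischer (arrowPoly n (v, w) * f) g = fischer f (arrowDual v w g) := by
  simp only [arrowPoly_eq_sum, arrowDual, Finset.sum_mul, map_sum, LinearMap.sum_apply,
    smul_mul_assoc, map_smul, LinearMap.smul_apply, mul_assoc, fischer_X_mul]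

/-- `arrowDual` is adjoint to multiplication by an invariant, which commutes with `sp(2n)`, and
`sp(2n)` is closed under adjoints; so `arrowDual` preserves invariants. The proof computes the norm
of the left side. -/
theorem spAction_arrowDual (v w : Fin k) (a b : Fin n ⊕ Fin n)
    {f : MvPolynomial (Fin k × (Fin n ⊕ Fin n)) ℝ} (hf : spAction k a b f = 0) :
    spAction k a b (arrowDual v w f) = 0 := by
  apply eq_zero_of_fischer_self
  rw [fischer_spAction, ← fischer_arrowPoly_mul]
  have : ∀ g, arrowPoly n (v, w) * spAction k b.swap a.swap g
      = spAction k b.swap a.swap (arrowPoly n (v, w) * g) := fun g => by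
    rw [Derivation.leibniz, spAction_arrowPoly]; simp
  rw [this, ← fischer_spAction, hf, map_zero]

/-- Normal ordering: the first-order term appears when the outer derivative hits the coefficient of
the inner operator. -/
theorem polarization_polarization (a b c d : Fin n ⊕ Fin n)
    (f : MvPolynomial (Fin k × (Fin n ⊕ Fin n)) ℝ) :
    polarization k a b (polarization k c d f)
      = ∑ v, ∑ w, X (v, a) * X (w, c) * pderiv (w, d) (pderiv (v, b) f)
        + if b = c then ∑ v, X (v, a) * pderiv (v, d) f else 0 := by
  have hcomm : ∀ v w, pderiv (v, b) (pderiv (w, d) f) = pderiv (w, d) (pderiv (v, b) f) := by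
    intro v w
    have h : ⁅(pderiv (v, b) : Derivation ℝ (MvPolynomial (Fin k × (Fin n ⊕ Fin n)) ℝ) _),
        (pderiv (w, d) : Derivation ℝ (MvPolynomial (Fin k × (Fin n ⊕ Fin n)) ℝ) _)⁆ = 0 := by
      apply MvPolynomial.derivation_ext
      intro i
      classical
      simp [Derivation.commutator_apply, pderiv_X, Pi.single_apply, apply_ite]
    have := DFunLike.congr_fun h f
    rw [Derivation.commutator_apply] at this
    exact sub_eq_zero.mp this
  have hite : (if b = c then ∑ v, X (v, a) * pderiv (v, d) f else 0)
      = ∑ v, if b = c then X (v, a) * pderiv (v, d) f else 0 := by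
    split_ifs <;> simp
  rw [polarization_apply, hite, ← Finset.sum_add_distrib]
  refine Finset.sum_congr rfl fun v _ => ?_
  rw [polarization_apply, map_sum]
  simp only [pderiv_mul, hcomm, Finset.sum_add_distrib, mul_add, pderiv_X, Pi.single_apply,
    Prod.mk.injEq, ite_and, eq_comm (a := c)]
  rw [add_comm]
  congr 1
  · simp only [Finset.mul_sum, mul_assoc]
  · by_cases h : b = c <;> simp [h]

/-- A Casimir (Capelli type) identity. Invariance rewrites the inner polarization so that the
second-order part of the sum becomes multiplication by symplectic products after `arrowDual`. That
part vanishes by assumption, and only minus the Euler operator remains. -/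
theorem sum_polarization {f : MvPolynomial (Fin k × (Fin n ⊕ Fin n)) ℝ}
    (hf : ∀ a b, spAction k a b f = 0) (h : ∀ v w, arrowDual v w f = 0) :
    ∑ a, ∑ b, polarization k b a (polarization k a b f)
      = - ∑ b, ∑ v, X (v, b) * pderiv (v, b) f := by
  -- This is invariance under the quadratic polynomial with indices `a` and `b.swap`, multiplied by
  -- `eps b`.
  have h1 : ∀ a b, polarization k a b f = (eps a * eps b) • polarization k b.swap a.swap f := by
    intro a b
    have := congrArg (eps b • ·) (hf a b.swap)
    simp only [spAction_apply, eps_swap, Sum.swap_swap, smul_add, neg_smul, smul_neg, smul_zero] at this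
    rw [smul_smul, eps_mul_self, one_smul, smul_smul] at this
    rw [mul_comm, eq_comm, ← sub_eq_zero, ← this]
    abel
  have h2 : ∀ a b, polarization k b a (polarization k a b f)
      = ∑ v, ∑ w, (eps b • (X (v, b) * X (w, b.swap))) * (eps a • pderiv (w, a.swap) (pderiv (v, a) f))
        + if b.swap = a then - ∑ v, X (v, b) * pderiv (v, b) f else 0 := by
    intro a b
    rw [h1, Derivation.map_smul, polarization_polarization, smul_add]
    congr 1
    · simp only [Finset.smul_sum, smul_mul_smul_comm, mul_comm (eps a)]
    · by_cases hab : a = b.swap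
      · subst hab
        simp [eps_swap, eps_mul_self]
      · simp [hab, Ne.symm hab]
  simp only [h2, Finset.sum_add_distrib]
  have h3 : ∑ a, ∑ b, ∑ v : Fin k, ∑ w : Fin k, (eps b • (X (v, b) * X (w, b.swap)))
      * (eps a • pderiv (w, a.swap) (pderiv (v, a) f)) = 0 := by
    have : ∀ v w, (∑ b, eps b • (X (v, b) * X (w, b.swap))) * arrowDual v w f = 0 := fun v w => by
      rw [h, mul_zero]
    simp only [arrowDual, Finset.sum_mul_sum] at this
    simp_rw [Finset.sum_comm (s := (Finset.univ : Finset (Fin n ⊕ Fin n))) (t := (Finset.univ : Finset (Fin k)))]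
    refine Finset.sum_eq_zero fun v _ => Finset.sum_eq_zero fun w _ => ?_
    rw [Finset.sum_comm]
    exact this v w
  rw [h3, zero_add, Finset.sum_comm]
  simp

/-- Pair the Casimir identity with `f`: the left side is the sum of the squared norms of the
polarizations of `f`, the right side is minus that of its partial derivatives. Hence all partial
derivatives vanish. -/
theorem eq_C_of_spAction_eq_zero {f : MvPolynomial (Fin k × (Fin n ⊕ Fin n)) ℝ}
    (hf : ∀ a b, spAction k a b f = 0) (h : ∀ v w, arrowDual v w f = 0) : f = C (coeff 0 f) := by
  have h1 := congrArg (fischer f) (sum_polarization hf h)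
  simp only [map_sum, map_neg, fischer_mul_X] at h1
  have h2 : ∑ b, ∑ v, fischer (pderiv (v, b) f) (pderiv (v, b) f) ≤ 0 := by
    rw [← neg_nonneg, ← h1]
    exact Finset.sum_nonneg fun a _ => Finset.sum_nonneg fun b _ =>
      (fischer_self_nonneg _).trans_eq (fischer_polarization a b f _)
  refine eq_C_of_pderiv_eq_zero fun ⟨v, b⟩ => eq_zero_of_fischer_self (le_antisymm ?_
    (fischer_self_nonneg _))
  refine le_trans ?_ h2
  refine le_trans ?_ (Finset.single_le_sum (f := fun b => ∑ v, fischer (pderiv (v, b) f) (pderiv (v, b) f))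
    (fun b _ => Finset.sum_nonneg fun v _ => fischer_self_nonneg _) (Finset.mem_univ b))
  exact Finset.single_le_sum (f := fun v => fischer (pderiv (v, b) f) (pderiv (v, b) f))
    (fun v _ => fischer_self_nonneg _) (Finset.mem_univ v)

/-- The span of `1` and of the symplectic products of the `k` vectors. -/
def arrowSpan (n k : ℕ) : Submodule ℝ (MvPolynomial (Fin k × (Fin n ⊕ Fin n)) ℝ) :=
  Submodule.span ℝ (insert 1 (Set.range (arrowPoly n)))

theorem spAction_arrowSpan_pow (a b : Fin n ⊕ Fin n) (m : ℕ)
    {f : MvPolynomial (Fin k × (Fin n ⊕ Fin n)) ℝ} (hf : f ∈ arrowSpan n k ^ m) :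
    spAction k a b f = 0 := by
  induction hf using Submodule.pow_induction_on_left' with
  | algebraMap r => simp
  | add x y i _ _ hx hy => rw [map_add, hx, hy, add_zero]
  | mem_mul x hx i y _ hy =>
    have : spAction k a b x = 0 := by
      have : arrowSpan n k ≤ LinearMap.ker (spAction k a b).toLinearMap := by
        rw [arrowSpan, Submodule.span_le]
        rintro _ (rfl | ⟨e, rfl⟩)
        · simp
        · exact spAction_arrowPoly a b e
      exact this hx
    rw [Derivation.leibniz, this, hy]; simp

theorem totalDegree_arrowSpan_pow (m : ℕ)
    {f : MvPolynomial (Fin k × (Fin n ⊕ Fin n)) ℝ} (hf : f ∈ arrowSpan n k ^ m) :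
    f.totalDegree ≤ 2 * m := by
  have h1 : ∀ x ∈ arrowSpan n k, x.totalDegree ≤ 2 := by
    have : arrowSpan n k ≤ restrictTotalDegree _ ℝ 2 := by
      rw [arrowSpan, Submodule.span_le]
      rintro _ (rfl | ⟨⟨v, w⟩, rfl⟩)
      · simp [mem_restrictTotalDegree]
      · rw [arrowPoly_eq_sum]
        refine Submodule.sum_mem _ fun b _ => Submodule.smul_mem _ _ ?_
        rw [mem_restrictTotalDegree]
        exact (totalDegree_mul _ _).trans (by simp)
    exact fun x hx => (mem_restrictTotalDegree _ _ _).mp (this hx)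
  induction hf using Submodule.pow_induction_on_left' with
  | algebraMap r => simp [algebraMap_eq]
  | add x y i _ _ hx hy => exact (totalDegree_add _ _).trans (max_le hx hy)
  | mem_mul x hx i y _ hy =>
    have := totalDegree_mul x y
    have := h1 x hx
    omega

theorem one_mem_arrowSpan_pow (m : ℕ) : (1 : MvPolynomial _ ℝ) ∈ arrowSpan n k ^ m := by
  have : (1 : MvPolynomial _ ℝ) ∈ arrowSpan n k := Submodule.subset_span (Set.mem_insert _ _)
  simpa using Submodule.pow_mem_pow _ this m

/-- Let `g` be the orthogonal projection of `f`. Then `arrowDual v w (f - g)` is invariant of degree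
lower by two, so by induction it lies in the previous power; its squared norm pairs `f - g` with an
element of `arrowSpan n k ^ (m + 1)` and is zero. This holds for all `v` and `w`, so `f - g` is
constant. -/
theorem mem_arrowSpan_pow_of_spAction_eq_zero (m : ℕ)
    {f : MvPolynomial (Fin k × (Fin n ⊕ Fin n)) ℝ}
    (hf : ∀ a b, spAction k a b f = 0) (hd : f.totalDegree ≤ 2 * m) : f ∈ arrowSpan n k ^ m := by
  induction m generalizing f with
  | zero =>
    rw [totalDegree_eq_zero_iff_eq_C.mp (Nat.le_zero.mp hd)]
    rw [pow_zero, ← algebraMap_eq]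
    exact Submodule.algebraMap_mem _
  | succ m ih =>
    have hfin : FiniteDimensional ℝ (arrowSpan n k ^ (m + 1) : Submodule ℝ _) :=
      Module.Finite.iff_fg.mpr (Submodule.FG.pow
        ⟨(insert 1 (Set.range (arrowPoly n))).toFinite.toFinset, by simp [arrowSpan]⟩ _)
    obtain ⟨g, hg, hperp⟩ := exists_fischer_projection (arrowSpan n k ^ (m + 1)) f
    have hinv : ∀ a b, spAction k a b (f - g) = 0 := fun a b => by
      rw [map_sub, hf, spAction_arrowSpan_pow a b _ hg, sub_zero]
    have hdeg : (f - g).totalDegree ≤ 2 * (m + 1) :=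
      (totalDegree_sub _ _).trans (max_le hd (totalDegree_arrowSpan_pow _ hg))
    have hdual : ∀ v w, arrowDual v w (f - g) = 0 := fun v w => by
      have hmem : arrowDual v w (f - g) ∈ arrowSpan n k ^ m := by
        refine ih (fun a b => spAction_arrowDual v w a b (hinv a b)) ?_
        rw [← mem_restrictTotalDegree]
        refine Submodule.sum_mem _ fun b _ => Submodule.smul_mem _ _ ?_
        rw [mem_restrictTotalDegree]
        have h1 := totalDegree_pderiv_le (w, b.swap) (pderiv (v, b) (f - g))
        have h2 := totalDegree_pderiv_le (v, b) (f - g)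
        omega
      apply eq_zero_of_fischer_self
      rw [← fischer_arrowPoly_mul]
      apply hperp
      rw [pow_succ']
      exact Submodule.mul_mem_mul (Submodule.subset_span (Set.mem_insert_of_mem _ ⟨_, rfl⟩)) hmem
    have h0 : f - g = C (coeff 0 (f - g)) := eq_C_of_spAction_eq_zero hinv hdual
    -- The constant `f - g` is also orthogonal to 1, which is why `arrowSpan` contains 1.
    have h1 := hperp 1 (one_mem_arrowSpan_pow _)
    rw [← C_1, ← monomial_zero', fischer_monomial] at h1
    have h2 := (mul_eq_zero.mp h1).resolve_left (multiFactorial_pos _).ne'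
    rw [h2, map_zero, sub_eq_zero] at h0
    rw [h0]
    exact hg

/-- The first fundamental theorem of invariant theory for `sp(2n)`. -/
theorem mem_span_arrowPoly_of_spAction_eq_zero {f : MvPolynomial (Fin k × (Fin n ⊕ Fin n)) ℝ}
    (hf : ∀ a b, spAction k a b f = 0) :
    f ∈ Submodule.span ℝ (Set.range fun E : Multiset (Fin k × Fin k) =>
      (E.map (arrowPoly n)).prod) := by
  -- Any `m` with `f.totalDegree ≤ 2 * m` would do; the degree itself is a crude choice.
  obtain ⟨m, hm⟩ : ∃ m, m = f.totalDegree := ⟨_, rfl⟩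
  have h := mem_arrowSpan_pow_of_spAction_eq_zero m hf (by omega)
  clear hf hm
  induction h using Submodule.pow_induction_on_left' with
  | algebraMap r =>
    rw [Algebra.algebraMap_eq_smul_one]
    exact Submodule.smul_mem _ _ (Submodule.subset_span ⟨0, by simp⟩)
  | add x y i _ _ hx hy => exact Submodule.add_mem _ hx hy
  | mem_mul x hx i y _ hy =>
    rw [arrowSpan] at hx
    have := Submodule.mul_mem_mul hx hy
    rw [Submodule.span_mul_span] at this
    refine Submodule.span_mono ?_ this
    rintro _ ⟨x, (rfl | ⟨e, rfl⟩), _, ⟨E, rfl⟩, rfl⟩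
    · exact ⟨E, by simp⟩
    · exact ⟨e ::ₘ E, by simp⟩

end FirstFundamentalTheorem

/-! ### Polynomials in several vectors and the exterior algebra -/

section Tensor

variable {n k : ℕ}

theorem monomial_mem_polyLie {s : Fin n ⊕ Fin n →₀ ℕ} (hs : 2 ≤ s.degree) (r : ℝ) :
    monomial s r ∈ polyLie n := by
  classical
  refine ⟨?_, fun b => ?_⟩
  · rw [coeff_monomial, if_neg]
    rintro rfl
    simp at hs
  · rw [coeff_monomial, if_neg]
    rintro rfl
    simp at hs

/-- The monomials of degree at least two. -/
def polyLieMonomial (s : {s : Fin n ⊕ Fin n →₀ ℕ // 2 ≤ s.degree}) : polyLie n :=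
  ⟨monomial s.1 1, monomial_mem_polyLie s.2 1⟩

theorem degree_of_coeff_ne_zero {f : Poly n} (hf : f ∈ polyLie n) {s : Fin n ⊕ Fin n →₀ ℕ}
    (hs : coeff s f ≠ 0) : 2 ≤ s.degree := by
  by_contra! h
  interval_cases hd : s.degree
  · rw [Finsupp.degree_eq_zero_iff] at hd
    exact hs (hd ▸ hf.1)
  · obtain ⟨b, rfl⟩ := Finsupp.range_single_one.ge hd
    exact hs (hf.2 b)

theorem span_polyLieMonomial : Submodule.span ℝ (Set.range (polyLieMonomial (n := n))) = ⊤ := by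
  rw [Submodule.eq_top_iff']
  intro f
  have h : f = ∑ s ∈ (f : Poly n).support.attach, coeff s.1 (f : Poly n) •
      polyLieMonomial ⟨s.1, degree_of_coeff_ne_zero f.2 (mem_support_iff.mp s.2)⟩ := by
    ext1
    rw [AddSubmonoidClass.coe_finsetSum]
    simp only [Submodule.coe_smul, polyLieMonomial, smul_monomial, smul_eq_mul, mul_one]
    conv_lhs => rw [(f : Poly n).as_sum, ← Finset.sum_attach]
  rw [h]
  exact Submodule.sum_mem _ fun s _ => Submodule.smul_mem _ _ (Submodule.subset_span ⟨_, rfl⟩)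

theorem toPolyLie_coe (f : polyLie n) : toPolyLie (f : Poly n) = f := by
  rw [toPolyLie, dif_pos f.2]

variable (n k) in
/-- The product `∏ᵥ fᵥ(x_v)`. -/
def tensorMap : MultilinearMap ℝ (fun _ : Fin k => polyLie n)
    (MvPolynomial (Fin k × (Fin n ⊕ Fin n)) ℝ) :=
  (MultilinearMap.mkPiAlgebra ℝ (Fin k) (MvPolynomial (Fin k × (Fin n ⊕ Fin n)) ℝ)).compLinearMap
    fun v => (rename (R := ℝ) (Prod.mk v)).toLinearMap ∘ₗ (polyLie n).subtype

theorem tensorMap_apply (f : Fin k → polyLie n) :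
    tensorMap n k f = ∏ v, rename (Prod.mk v) (f v : Poly n) := by
  simp [tensorMap]

theorem monomial_eq_prod (M : Fin k × (Fin n ⊕ Fin n) →₀ ℕ) :
    monomial M (1 : ℝ) = ∏ v, rename (Prod.mk v) (monomial (M.curry v) (1 : ℝ)) := by
  simp only [rename_monomial]
  rw [← monomial_sum_one]
  congr 2
  refine Finsupp.ext fun ⟨w, b⟩ => ?_
  rw [Finsupp.finsetSum_apply, Finset.sum_eq_single w]
  · rw [Finsupp.mapDomain_apply (Prod.mk_right_injective w), Finsupp.curry_apply]
  · intro v _ hv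
    rw [Finsupp.mapDomain_of_notMem_range]
    rintro ⟨c, hc⟩
    exact hv (Prod.mk.inj hc).1
  · simp

theorem curry_uncurry_apply (s : Fin k → (Fin n ⊕ Fin n →₀ ℕ)) (v : Fin k) :
    (Finsupp.uncurry (Finsupp.equivFunOnFinite.symm s)).curry v = s v := by
  rw [Finsupp.curry_uncurry]; rfl

theorem tensorMap_polyLieMonomial (s : Fin k → {s : Fin n ⊕ Fin n →₀ ℕ // 2 ≤ s.degree}) :
    tensorMap n k (fun v => polyLieMonomial (s v))
      = monomial (Finsupp.uncurry (Finsupp.equivFunOnFinite.symm fun v => (s v).1)) 1 := by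
  rw [tensorMap_apply, monomial_eq_prod]
  simp only [curry_uncurry_apply]
  rfl

theorem wedgePoly_monomial (M : Fin k × (Fin n ⊕ Fin n) →₀ ℕ) :
    wedgePoly n k (monomial M 1)
      = ExteriorAlgebra.ιMulti ℝ k fun v => toPolyLie (monomial (M.curry v) 1) := by
  have : monomial M (1 : ℝ) = basisMonomials _ ℝ M := by rw [coe_basisMonomials]
  rw [wedgePoly, this, Module.Basis.constr_basis]

theorem tensorMap_hom_ext {N : Type*} [AddCommGroup N] [Module ℝ N]
    {φ φ' : MultilinearMap ℝ (fun _ : Fin k => polyLie n) N}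
    (h : ∀ s : Fin k → {s : Fin n ⊕ Fin n →₀ ℕ // 2 ≤ s.degree},
      φ (fun v => polyLieMonomial (s v)) = φ' (fun v => polyLieMonomial (s v))) : φ = φ' :=
  MultilinearMap.ext_of_span_eq_top (g := fun _ => polyLieMonomial)
    (fun _ => span_polyLieMonomial) h

/-- Both sides are multilinear, so monomials suffice. This frees `wedgePoly` from its definition on
the monomial basis. -/
theorem wedgePoly_tensorMap (f : Fin k → polyLie n) :
    wedgePoly n k (tensorMap n k f) = ExteriorAlgebra.ιMulti ℝ k f := by
  have : (wedgePoly n k).compMultilinearMap (tensorMap n k)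
      = (ExteriorAlgebra.ιMulti ℝ k : (polyLie n) [⋀^Fin k]→ₗ[ℝ] _).toMultilinearMap := by
    refine tensorMap_hom_ext fun s => ?_
    rw [LinearMap.compMultilinearMap_apply, tensorMap_polyLieMonomial, wedgePoly_monomial]
    simp only [curry_uncurry_apply]
    change ExteriorAlgebra.ιMulti ℝ k _ = ExteriorAlgebra.ιMulti ℝ k _
    congr 1
    funext v
    exact toPolyLie_coe (polyLieMonomial (s v))
  exact congrArg (· f) this

variable (n k) in
/-- The polynomials in `k` vectors which have degree at least two in each vector. -/
def highDegree : Submodule ℝ (MvPolynomial (Fin k × (Fin n ⊕ Fin n)) ℝ) :=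
  restrictSupport ℝ {M | ∀ v, 2 ≤ (M.curry v).degree}

/-- Identifies the span of the products `∏ᵥ fᵥ(x_v)` by a degree condition on monomials. Linear
identities on `highDegree` can then be checked on such products, while membership is read off from
degrees. -/
theorem highDegree_eq_span : highDegree n k = Submodule.span ℝ (Set.range (tensorMap n k)) := by
  apply le_antisymm
  · rw [highDegree, restrictSupport_eq_span]
    refine Submodule.span_mono ?_
    rintro _ ⟨M, hM, rfl⟩
    refine ⟨fun v => polyLieMonomial ⟨M.curry v, hM v⟩, ?_⟩
    rw [tensorMap_apply]
    exact (monomial_eq_prod M).symm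
  · rw [Submodule.span_le]
    rintro _ ⟨f, rfl⟩
    have : (highDegree n k).mkQ.compMultilinearMap (tensorMap n k) = 0 := by
      refine tensorMap_hom_ext fun s => ?_
      rw [LinearMap.compMultilinearMap_apply, tensorMap_polyLieMonomial, Submodule.mkQ_apply,
        zero_apply, Submodule.Quotient.mk_eq_zero, highDegree,
        monomial_mem_restrictSupport]
      refine Or.inl fun v => ?_
      rw [curry_uncurry_apply]
      exact (s v).2
    have := congrArg (· f) this
    simpa [Submodule.Quotient.mk_eq_zero] using this

theorem tensorMap_mem_highDegree (f : Fin k → polyLie n) : tensorMap n k f ∈ highDegree n k := by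
  rw [highDegree_eq_span]
  exact Submodule.subset_span ⟨f, rfl⟩

theorem eq_of_mem_highDegree {N : Type*} [AddCommGroup N] [Module ℝ N]
    {S T : MvPolynomial (Fin k × (Fin n ⊕ Fin n)) ℝ →ₗ[ℝ] N}
    (h : ∀ f : Fin k → polyLie n, S (tensorMap n k f) = T (tensorMap n k f))
    {P : MvPolynomial (Fin k × (Fin n ⊕ Fin n)) ℝ} (hP : P ∈ highDegree n k) : S P = T P := by
  rw [highDegree_eq_span] at hP
  refine LinearMap.eqOn_span ?_ hP
  rintro _ ⟨f, rfl⟩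
  exact h f

/-! ### Equivariance -/

theorem derivation_prod {ι A : Type*} [DecidableEq ι] [CommRing A] [Algebra ℝ A]
    (D : Derivation ℝ A A) (s : Finset ι) (f : ι → A) :
    D (∏ i ∈ s, f i) = ∑ i ∈ s, (∏ j ∈ s.erase i, f j) * D (f i) := by
  induction s using Finset.induction_on with
  | empty => simp
  | insert a s ha ih =>
    rw [Finset.prod_insert ha, Derivation.leibniz, ih, Finset.sum_insert ha,
      Finset.erase_insert ha, smul_eq_mul, smul_eq_mul, Finset.mul_sum, add_comm]
    congr 1
    refine Finset.sum_congr rfl fun i hi => ?_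
    have hia : i ≠ a := fun h => ha (h ▸ hi)
    rw [Finset.erase_insert_of_ne hia.symm, Finset.prod_insert (by simp [ha]), mul_assoc]

/-- The action of `u` on polynomials in `k` vectors, by the Poisson bracket in each vector. -/
def vecAction (k : ℕ) (u : Poly n) : Derivation ℝ (MvPolynomial (Fin k × (Fin n ⊕ Fin n)) ℝ)
    (MvPolynomial (Fin k × (Fin n ⊕ Fin n)) ℝ) :=
  mkDerivation ℝ fun x => rename (Prod.mk x.1) (poisson u (X x.2))

theorem vecAction_rename (u g : Poly n) (v : Fin k) :
    vecAction k u (rename (Prod.mk v) g) = rename (Prod.mk v) (poisson u g) := by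
  induction g using MvPolynomial.induction_on with
  | C r => simp [← hamiltonian_apply, derivation_C]
  | add p q hp hq => simp only [map_add, hp, hq, ← hamiltonian_apply]
  | mul_X p b hp =>
    rw [← hamiltonian_apply, Derivation.leibniz, hamiltonian_apply, hamiltonian_apply, map_mul,
      Derivation.leibniz, hp, rename_X, vecAction, mkDerivation_X]
    simp

theorem coe_bracket (u f : polyLie n) : ((⁅u, f⁆ : polyLie n) : Poly n) = poisson u.1 f.1 := rfl

theorem vecAction_tensorMap (u : polyLie n) (f : Fin k → polyLie n) :
    vecAction k (u : Poly n) (tensorMap n k f)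
      = ∑ j, tensorMap n k (Function.update f j ⁅u, f j⁆) := by
  simp only [tensorMap_apply]
  rw [derivation_prod]
  refine Finset.sum_congr rfl fun j _ => ?_
  rw [vecAction_rename, ← Finset.mul_prod_erase _ _ (Finset.mem_univ j), Function.update_self,
    coe_bracket, mul_comm]
  congr 1
  refine Finset.prod_congr rfl fun v hv => ?_
  rw [Function.update_of_ne (Finset.ne_of_mem_erase hv)]

/-- On products of elements of `cₙ` both actions obey the Leibniz rule. The restriction to
`highDegree` matters: elsewhere `wedgePoly` is zero on monomials with a linear factor, which a `u`
of degree above two can raise back into `cₙ`. -/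
theorem adWedge_wedgePoly (u : polyLie n) {P : MvPolynomial (Fin k × (Fin n ⊕ Fin n)) ℝ}
    (hP : P ∈ highDegree n k) :
    adWedge u (wedgePoly n k P) = wedgePoly n k (vecAction k (u : Poly n) P) := by
  refine eq_of_mem_highDegree (S := adWedge u ∘ₗ wedgePoly n k)
    (T := wedgePoly n k ∘ₗ (vecAction k (u : Poly n)).toLinearMap) (fun f => ?_) hP
  simp only [LinearMap.comp_apply, Derivation.coeFn_coe, vecAction_tensorMap, map_sum,
    wedgePoly_tensorMap, adWedge_ιMulti]

/-! ### Antisymmetrization -/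

variable (n k) in
/-- The antisymmetrization `f₀ ∧ ⋯ ∧ f_{k-1} ↦ ∑_σ sgn σ ∏ᵥ f_{σ v}(x_v)`, which is zero in the
other exterior degrees. -/
def antisymmetrize : ExteriorAlgebra ℝ (polyLie n) →ₗ[ℝ] MvPolynomial (Fin k × (Fin n ⊕ Fin n)) ℝ :=
  ExteriorAlgebra.liftAlternating (Pi.single k (tensorMap n k).alternatization)

theorem antisymmetrize_ιMulti (f : Fin k → polyLie n) :
    antisymmetrize n k (ExteriorAlgebra.ιMulti ℝ k f) = (tensorMap n k).alternatization f := by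
  rw [antisymmetrize, ExteriorAlgebra.liftAlternating_apply_ιMulti, Pi.single_eq_same]

theorem antisymmetrize_ιMulti_of_ne {p : ℕ} (h : p ≠ k) (f : Fin p → polyLie n) :
    antisymmetrize n k (ExteriorAlgebra.ιMulti ℝ p f) = 0 := by
  rw [antisymmetrize, ExteriorAlgebra.liftAlternating_apply_ιMulti, Pi.single_eq_of_ne h]
  rfl

theorem alternatization_tensorMap (f : Fin k → polyLie n) :
    (tensorMap n k).alternatization f = ∑ σ : Equiv.Perm (Fin k), sgn σ • tensorMap n k (f ∘ σ) := by
  rw [MultilinearMap.alternatization_apply]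
  refine Finset.sum_congr rfl fun σ _ => ?_
  rw [sgn, Int.cast_smul_eq_zsmul, Units.smul_def]
  rfl

theorem antisymmetrize_adWedge (u : polyLie n) (x : ExteriorAlgebra ℝ (polyLie n)) :
    antisymmetrize n k (adWedge u x) = vecAction k (u : Poly n) (antisymmetrize n k x) := by
  have : antisymmetrize n k ∘ₗ adWedge u
      = (vecAction k (u : Poly n)).toLinearMap ∘ₗ antisymmetrize n k := by
    refine hom_ext_ιMulti fun p w => ?_
    rw [LinearMap.comp_apply, LinearMap.comp_apply, adWedge_ιMulti, Derivation.coeFn_coe, map_sum]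
    by_cases h : p = k
    · subst h
      simp only [antisymmetrize_ιMulti, alternatization_tensorMap, map_sum, Derivation.map_smul,
        vecAction_tensorMap]
      rw [Finset.sum_comm]
      refine Finset.sum_congr rfl fun σ _ => ?_
      rw [Finset.smul_sum, ← Equiv.sum_comp σ]
      refine Finset.sum_congr rfl fun j _ => ?_
      rw [Function.update_comp_eq_of_injective _ σ.injective]
      rfl
    · simp [antisymmetrize_ιMulti_of_ne h]
  exact LinearMap.congr_fun this x

theorem antisymmetrize_mem_highDegree (x : ExteriorAlgebra ℝ (polyLie n)) :
    antisymmetrize n k x ∈ highDegree n k := by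
  have : (highDegree n k).mkQ ∘ₗ antisymmetrize n k = 0 := by
    refine hom_ext_ιMulti fun p w => ?_
    rw [LinearMap.comp_apply, Submodule.mkQ_apply, LinearMap.zero_apply,
      Submodule.Quotient.mk_eq_zero]
    by_cases h : p = k
    · subst h
      rw [antisymmetrize_ιMulti, alternatization_tensorMap]
      exact Submodule.sum_mem _ fun σ _ => Submodule.smul_mem _ _ (tensorMap_mem_highDegree _)
    · rw [antisymmetrize_ιMulti_of_ne h]
      exact Submodule.zero_mem _
  have := LinearMap.congr_fun this x
  rwa [LinearMap.comp_apply, Submodule.mkQ_apply, LinearMap.zero_apply,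
    Submodule.Quotient.mk_eq_zero] at this

/-- Alternatizing the map `ExteriorAlgebra.ιMulti`, which is already alternating, multiplies it by
k!. -/
theorem wedgePoly_antisymmetrize_ιMulti (f : Fin k → polyLie n) :
    wedgePoly n k (antisymmetrize n k (ExteriorAlgebra.ιMulti ℝ k f))
      = (k.factorial : ℝ) • ExteriorAlgebra.ιMulti ℝ k f := by
  have h1 : (wedgePoly n k).compMultilinearMap (tensorMap n k)
      = ((ExteriorAlgebra.ιMulti ℝ k : (polyLie n) [⋀^Fin k]→ₗ[ℝ] _) : MultilinearMap ℝ _ _) :=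
    MultilinearMap.ext wedgePoly_tensorMap
  have h2 := LinearMap.compMultilinearMap_alternatization (wedgePoly n k) (tensorMap n k)
  rw [h1, AlternatingMap.coe_alternatization, Fintype.card_fin] at h2
  rw [antisymmetrize_ιMulti, Nat.cast_smul_eq_nsmul]
  exact (DFunLike.congr_fun h2 f).symm

/-- The composite in the other order is signed symmetrization over renumberings of the vectors, the
polynomial counterpart of the renumbering relation for graphs. -/
theorem antisymmetrize_wedgePoly {P : MvPolynomial (Fin k × (Fin n ⊕ Fin n)) ℝ}
    (hP : P ∈ highDegree n k) :
    antisymmetrize n k (wedgePoly n k P)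
      = ∑ σ : Equiv.Perm (Fin k), sgn σ • rename (Prod.map σ id) P := by
  refine (eq_of_mem_highDegree (S := antisymmetrize n k ∘ₗ wedgePoly n k)
    (T := ∑ σ : Equiv.Perm (Fin k), sgn σ • (rename (R := ℝ) (Prod.map σ id)).toLinearMap)
    (fun f => ?_) hP).trans (by simp [LinearMap.sum_apply])
  -- Permuting the factors by σ renames the vectors by the inverse of σ, so one sum is reindexed by
  -- inversion.
  rw [LinearMap.comp_apply, wedgePoly_tensorMap, antisymmetrize_ιMulti, alternatization_tensorMap,
    LinearMap.sum_apply, ← Equiv.sum_comp (Equiv.inv _)]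
  refine Finset.sum_congr rfl fun σ _ => ?_
  rw [Equiv.inv_apply, LinearMap.smul_apply, AlgHom.toLinearMap_apply, sgn, sgn, Equiv.Perm.sign_inv]
  congr 1
  rw [tensorMap_apply, tensorMap_apply, map_prod, ← Equiv.prod_comp σ]
  refine Finset.prod_congr rfl fun v _ => ?_
  rw [rename_rename]
  simp [Function.comp_def]

/-- Decomposition into exterior degrees: the k-th summand is the component of degree k. Allowing
every large `M` lets the bounds for two elements be combined. -/
theorem exists_sum_antisymmetrize (x : ExteriorAlgebra ℝ (polyLie n)) : ∃ N : ℕ, ∀ M ≥ N,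
    x = ∑ k ∈ Finset.range M, (k.factorial : ℝ)⁻¹ • wedgePoly n k (antisymmetrize n k x) := by
  have hx : x ∈ Submodule.span ℝ (Set.range fun y : Σ p, (Fin p → polyLie n) =>
      ExteriorAlgebra.ιMulti ℝ y.1 y.2) := by rw [ExteriorAlgebra.ιMulti_span]; trivial
  induction hx using Submodule.span_induction with
  | zero => exact ⟨0, fun M _ => by simp⟩
  | add x y _ _ hx hy =>
    obtain ⟨N, hN⟩ := hx
    obtain ⟨N', hN'⟩ := hy
    refine ⟨max N N', fun M hM => ?_⟩
    simp only [map_add, smul_add, Finset.sum_add_distrib]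
    rw [← hN M (le_of_max_le_left hM), ← hN' M (le_of_max_le_right hM)]
  | smul r x _ hx =>
    obtain ⟨N, hN⟩ := hx
    refine ⟨N, fun M hM => ?_⟩
    simp only [map_smul, smul_comm _ r, ← Finset.smul_sum]
    rw [← hN M hM]
  | mem x hx =>
    obtain ⟨⟨p, f⟩, rfl⟩ := hx
    refine ⟨p + 1, fun M hM => ?_⟩
    rw [Finset.sum_eq_single p]
    · rw [wedgePoly_antisymmetrize_ιMulti, smul_smul, inv_mul_cancel₀ (by positivity), one_smul]
    · intro k _ hk
      rw [antisymmetrize_ιMulti_of_ne (Ne.symm hk), map_zero, smul_zero]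
    · intro h
      exact absurd (Finset.mem_range.mpr (by omega)) h

theorem eq_of_mem_exteriorPower {x : ExteriorAlgebra ℝ (polyLie n)} (hx : x ∈ ⋀[ℝ]^k (polyLie n)) :
    x = (k.factorial : ℝ)⁻¹ • wedgePoly n k (antisymmetrize n k x) := by
  rw [← ExteriorAlgebra.ιMulti_span_fixedDegree] at hx
  refine LinearMap.eqOn_span (f := LinearMap.id)
    (g := (k.factorial : ℝ)⁻¹ • (wedgePoly n k ∘ₗ antisymmetrize n k)) ?_ hx
  rintro _ ⟨f, rfl⟩
  rw [LinearMap.smul_apply, LinearMap.comp_apply, wedgePoly_antisymmetrize_ιMulti, smul_smul,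
    inv_mul_cancel₀ (by positivity), one_smul, LinearMap.id_apply]

theorem antisymmetrize_eq_zero_of_mem_exteriorPower {p : ℕ} (h : p ≠ k)
    {x : ExteriorAlgebra ℝ (polyLie n)} (hx : x ∈ ⋀[ℝ]^p (polyLie n)) :
    antisymmetrize n k x = 0 := by
  rw [← ExteriorAlgebra.ιMulti_span_fixedDegree] at hx
  refine LinearMap.eqOn_span (f := antisymmetrize n k) (g := 0) ?_ hx
  rintro _ ⟨f, rfl⟩
  exact antisymmetrize_ιMulti_of_ne h f

theorem wedgePoly_mem_exteriorPower (P : MvPolynomial (Fin k × (Fin n ⊕ Fin n)) ℝ) :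
    wedgePoly n k P ∈ ⋀[ℝ]^k (polyLie n) := by
  have : (⋀[ℝ]^k (polyLie n)).mkQ ∘ₗ wedgePoly n k = 0 := by
    refine (basisMonomials _ ℝ).ext fun M => ?_
    rw [coe_basisMonomials, LinearMap.comp_apply, wedgePoly_monomial, Submodule.mkQ_apply,
      LinearMap.zero_apply, Submodule.Quotient.mk_eq_zero]
    exact ExteriorAlgebra.ιMulti_range ℝ k ⟨_, rfl⟩
  have := LinearMap.congr_fun this P
  rwa [LinearMap.comp_apply, Submodule.mkQ_apply, LinearMap.zero_apply,
    Submodule.Quotient.mk_eq_zero] at this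

end Tensor

/-! ### The image of the sum over states -/

section Image

variable {n k : ℕ}

/-- The weight for which a polynomial is homogeneous if it is homogeneous in each vector. -/
def vecWeight (n k : ℕ) : Fin k × (Fin n ⊕ Fin n) → Fin k → ℕ := fun x => Pi.single x.1 1

theorem weight_vecWeight (M : Fin k × (Fin n ⊕ Fin n) →₀ ℕ) (v : Fin k) :
    Finsupp.weight (vecWeight n k) M v = (M.curry v).degree := by
  rw [Finsupp.weight_eq_sum, Finset.sum_apply, Fintype.sum_prod_type, Finset.sum_eq_single v,
    Finsupp.degree_eq_sum]
  · simp [vecWeight]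
  · intro w _ hw
    simp [vecWeight, Pi.single_eq_of_ne hw.symm]
  · simp

theorem isWeightedHomogeneous_arrowPoly (a : Fin k × Fin k) :
    IsWeightedHomogeneous (vecWeight n k) (arrowPoly n a) (Pi.single a.1 1 + Pi.single a.2 1) := by
  rw [show a = (a.1, a.2) from rfl, arrowPoly_eq_sum]
  refine IsWeightedHomogeneous.sum _ _ _ fun b _ => ?_
  rw [smul_eq_C_mul]
  exact ((isWeightedHomogeneous_X ℝ _ _).mul (isWeightedHomogeneous_X ℝ _ _)).C_mul _

/-- The product of the symplectic products of the arrows. -/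
def arrowProd (n : ℕ) {k : ℕ} (E : Multiset (Fin k × Fin k)) :
    MvPolynomial (Fin k × (Fin n ⊕ Fin n)) ℝ := (E.map (arrowPoly n)).prod

/-- Each arrow contributes one variable at its tail and one at its head, a loop two at its vertex,
so the multidegree is the valence. Valence conditions thereby become conditions on monomials. -/
theorem isWeightedHomogeneous_arrowProd (E : Multiset (Fin k × Fin k)) :
    IsWeightedHomogeneous (vecWeight n k) (arrowProd n E) (LGraph.valence ⟨k, E⟩) := by
  induction E using Multiset.induction_on with
  | empty =>
    rw [arrowProd, Multiset.map_zero, Multiset.prod_zero]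
    convert isWeightedHomogeneous_one ℝ (vecWeight n k) using 1
    funext v
    simp [LGraph.valence]
  | cons a E ih =>
    rw [arrowProd] at ih ⊢
    rw [Multiset.map_cons, Multiset.prod_cons]
    convert (isWeightedHomogeneous_arrowPoly a).mul ih using 1
    funext v
    simp only [LGraph.valence, Multiset.countP_cons, Pi.add_apply, Pi.single_apply,
      eq_comm (a := v)]
    omega

theorem arrowProd_mem_highDegree {E : Multiset (Fin k × Fin k)}
    (hE : ∀ v, 2 ≤ LGraph.valence ⟨k, E⟩ v) : arrowProd n E ∈ highDegree n k := by
  intro M hM v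
  rw [← weight_vecWeight, isWeightedHomogeneous_arrowProd E (mem_support_iff.mp hM)]
  exact hE v

open Classical in
/-- The projection to `highDegree` which kills the other monomials. -/
def highPart (n k : ℕ) : MvPolynomial (Fin k × (Fin n ⊕ Fin n)) ℝ →ₗ[ℝ]
    MvPolynomial (Fin k × (Fin n ⊕ Fin n)) ℝ :=
  (basisMonomials _ ℝ).constr ℝ fun M =>
    if ∀ v, 2 ≤ (M.curry v).degree then monomial M 1 else 0

open Classical in
theorem highPart_eq_sum (P : MvPolynomial (Fin k × (Fin n ⊕ Fin n)) ℝ) : highPart n k P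
    = ∑ M ∈ P.support, if ∀ v, 2 ≤ (M.curry v).degree then monomial M (coeff M P) else 0 := by
  conv_lhs => rw [P.as_sum]
  rw [map_sum]
  refine Finset.sum_congr rfl fun M _ => ?_
  have : monomial M (coeff M P) = coeff M P • basisMonomials _ ℝ M := by
    rw [coe_basisMonomials, smul_monomial, smul_eq_mul, mul_one]
  conv_lhs => rw [this]
  rw [map_smul, highPart, Module.Basis.constr_basis]
  split_ifs
  · rw [smul_monomial, smul_eq_mul, mul_one]
  · rw [smul_zero]

theorem highPart_of_mem {P : MvPolynomial (Fin k × (Fin n ⊕ Fin n)) ℝ} (hP : P ∈ highDegree n k) :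
    highPart n k P = P := by
  rw [highPart_eq_sum]
  conv_rhs => rw [P.as_sum]
  exact Finset.sum_congr rfl fun M hM => if_pos (hP hM)

theorem highPart_arrowProd {E : Multiset (Fin k × Fin k)}
    (hE : ¬ ∀ v, 2 ≤ LGraph.valence ⟨k, E⟩ v) : highPart n k (arrowProd n E) = 0 := by
  rw [highPart_eq_sum]
  refine Finset.sum_eq_zero fun M hM => if_neg fun h => hE fun v => ?_
  rw [← isWeightedHomogeneous_arrowProd E (mem_support_iff.mp hM), weight_vecWeight]
  exact h v

theorem stateMap_cls (X : AGraph 2) :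
    stateMap n (cls 2 X.1) = wedgePoly n X.1.k (arrowProd n X.1.arrows) := by
  rw [stateMap, liftGraph_cls]
  rfl

theorem poisson_X_X (b c : Fin n ⊕ Fin n) :
    poisson (X b : Poly n) (X c) = if c = b.swap then C (eps b) else 0 := by
  classical
  rcases c with i | i
  · rw [poisson_X_inl, pderiv_X, Pi.single_apply]
    rcases b with j | j
    · simp
    · by_cases h : i = j
      · subst h; simp [eps]
      · simp [h, Ne.symm h]
  · rw [poisson_X_inr, pderiv_X, Pi.single_apply]
    rcases b with j | j
    · by_cases h : i = j
      · subst h; simp [eps]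
      · simp [h, Ne.symm h]
    · simp

theorem vecAction_X_mul_X (a b : Fin n ⊕ Fin n) :
    vecAction k (X a * X b : Poly n) = spAction k a b := by
  apply derivation_ext
  rintro ⟨v, c⟩
  rw [spAction_X, vecAction, mkDerivation_X]
  rw [poisson_swap, ← hamiltonian_apply, Derivation.leibniz, hamiltonian_apply, hamiltonian_apply,
    poisson_swap, poisson_swap (X c), poisson_X_X, poisson_X_X]
  simp only [smul_eq_mul, map_neg, map_add, map_mul, rename_X, mul_neg]
  split_ifs <;> simp [smul_eq_C_mul, mul_comm, add_comm]

theorem X_mul_X_mem (a b : Fin n ⊕ Fin n) : (X a * X b : Poly n) ∈ polyLie n := by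
  have : (X a * X b : Poly n) = monomial (Finsupp.single a 1 + Finsupp.single b 1) 1 := by
    rw [X, X, monomial_mul, one_mul]
  rw [this]
  exact monomial_mem_polyLie (by simp) 1

theorem exists_eq_X_mul_X {s : Fin n ⊕ Fin n →₀ ℕ} (hs : s.degree = 2) :
    ∃ a b, monomial s (1 : ℝ) = X a * X b := by
  have h : (Finsupp.toMultiset s).card = 2 := by
    rw [Finsupp.card_toMultiset]; exact hs
  obtain ⟨a, b, hab⟩ := Multiset.card_eq_two.mp h
  refine ⟨a, b, ?_⟩
  rw [← Finsupp.toMultiset_toFinsupp s, hab, X, X, monomial_mul, one_mul]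
  congr 2
  rw [Multiset.insert_eq_cons, ← Multiset.singleton_add, map_add, Multiset.toFinsupp_singleton,
    Multiset.toFinsupp_singleton]

theorem vecAction_arrowPoly {u : Poly n} (hu : u.IsHomogeneous 2) (e : Fin k × Fin k) :
    vecAction k u (arrowPoly n e) = 0 := by
  -- Linearity of `vecAction` in `u` reduces to the monomials of `u`; they are products of two
  -- variables, for which the action is `spAction`.
  have hlin : vecAction k u = ∑ s ∈ u.support, coeff s u • vecAction k (monomial s 1) := by
    apply derivation_ext
    intro x
    rw [derivation_sum_apply]
    simp only [Derivation.smul_apply, vecAction, mkDerivation_X]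
    have h1 : ∀ g : Poly n, poisson g (X x.2) = - hamiltonian (X x.2) g := fun g => by
      rw [poisson_swap, hamiltonian_apply]
    simp only [h1]
    conv_lhs => rw [u.as_sum]
    simp only [map_sum, map_neg, ← Finset.sum_neg_distrib]
    refine Finset.sum_congr rfl fun s _ => ?_
    rw [← mul_one (coeff s u), ← smul_eq_mul, ← smul_monomial, Derivation.map_smul, map_smul,
      smul_neg, smul_eq_mul, mul_one]
  rw [hlin, derivation_sum_apply]
  refine Finset.sum_eq_zero fun s hs => ?_
  obtain ⟨a, b, hab⟩ := exists_eq_X_mul_X (s := s) (by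
    have := hu (mem_support_iff.mp hs)
    rwa [Finsupp.degree_eq_weight_one])
  rw [Derivation.smul_apply, hab, vecAction_X_mul_X, spAction_arrowPoly, smul_zero]

theorem vecAction_arrowProd {u : Poly n} (hu : u.IsHomogeneous 2) (E : Multiset (Fin k × Fin k)) :
    vecAction k u (arrowProd n E) = 0 := by
  induction E using Multiset.induction_on with
  | empty => simp [arrowProd]
  | cons a E ih =>
    rw [arrowProd] at ih ⊢
    rw [Multiset.map_cons, Multiset.prod_cons, Derivation.leibniz, ih, vecAction_arrowPoly hu]
    simp

theorem stateMap_mem_spInvariants (x : GraphSpace 2) : stateMap n x ∈ spInvariants n := by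
  rw [spInvariants, Submodule.mem_iInf]
  intro u
  rw [LinearMap.mem_ker]
  have : adWedge u.1 ∘ₗ stateMap n = 0 := graphSpace_hom_ext fun X => by
    rw [LinearMap.comp_apply, stateMap_cls, adWedge_wedgePoly _ (arrowProd_mem_highDegree X.2),
      vecAction_arrowProd u.2, map_zero, LinearMap.zero_apply]
  exact LinearMap.congr_fun this x

theorem stateMap_mem_exteriorPower {x : GraphSpace 2} (hx : x ∈ chains 2 k) :
    stateMap n x ∈ ⋀[ℝ]^k (polyLie n) := by
  have : chains 2 k ≤ (⋀[ℝ]^k (polyLie n)).comap (stateMap n) := by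
    rw [chains, Submodule.span_le]
    rintro _ ⟨X, rfl, rfl⟩
    rw [SetLike.mem_coe, Submodule.mem_comap, stateMap_cls]
    exact wedgePoly_mem_exteriorPower _
  exact this hx

/-- Antisymmetrizing an invariant gives an invariant polynomial, to which the first fundamental
theorem applies. The graphs it yields may have vertices of valence below two; `highPart` deletes
exactly these and fixes the polynomial, which lies in `highDegree`. -/
theorem wedgePoly_antisymmetrize_mem {x : ExteriorAlgebra ℝ (polyLie n)} (hx : x ∈ spInvariants n)
    (k : ℕ) : wedgePoly n k (antisymmetrize n k x) ∈ (chains 2 k).map (stateMap n) := by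
  have h1 : ∀ a b, spAction k a b (antisymmetrize n k x) = 0 := fun a b => by
    rw [spInvariants, Submodule.mem_iInf] at hx
    obtain ⟨u, hu⟩ : ∃ u : polyLie n, (u : Poly n) = X a * X b := ⟨⟨_, X_mul_X_mem a b⟩, rfl⟩
    have hu2 : (u : Poly n).IsHomogeneous 2 := by
      rw [hu]
      exact (isHomogeneous_X ℝ a).mul (isHomogeneous_X ℝ b)
    have h2 := LinearMap.mem_ker.mp (hx ⟨u, hu2⟩)
    rw [← vecAction_X_mul_X, ← hu, ← antisymmetrize_adWedge, h2, map_zero]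
  have h2 := mem_span_arrowPoly_of_spAction_eq_zero h1
  rw [← highPart_of_mem (antisymmetrize_mem_highDegree x)]
  have h3 : Submodule.span ℝ (Set.range fun E : Multiset (Fin k × Fin k) => arrowProd n E)
      ≤ ((chains 2 k).map (stateMap n)).comap (wedgePoly n k ∘ₗ highPart n k) := by
    rw [Submodule.span_le]
    rintro _ ⟨E, rfl⟩
    rw [SetLike.mem_coe, Submodule.mem_comap, LinearMap.comp_apply]
    by_cases hE : ∀ v, 2 ≤ LGraph.valence ⟨k, E⟩ v
    · rw [highPart_of_mem (arrowProd_mem_highDegree hE)]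
      exact ⟨cls 2 ⟨k, E⟩, Submodule.subset_span ⟨⟨⟨k, E⟩, hE⟩, rfl, rfl⟩, stateMap_cls ⟨⟨k, E⟩, hE⟩⟩
    · rw [highPart_arrowProd hE, map_zero]
      exact Submodule.zero_mem _
  exact h3 h2

theorem range_stateMap : LinearMap.range (stateMap n) = spInvariants n := by
  apply le_antisymm
  · rintro _ ⟨x, rfl⟩
    exact stateMap_mem_spInvariants x
  · intro x hx
    obtain ⟨N, hN⟩ := exists_sum_antisymmetrize x
    rw [hN N le_rfl]
    exact Submodule.sum_mem _ fun k _ => Submodule.smul_mem _ _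
      (LinearMap.map_le_range (wedgePoly_antisymmetrize_mem hx k))

theorem mem_map_chains {x : ExteriorAlgebra ℝ (polyLie n)} (hx : x ∈ spInvariants n)
    (hk : x ∈ ⋀[ℝ]^k (polyLie n)) : x ∈ (chains 2 k).map (stateMap n) := by
  rw [eq_of_mem_exteriorPower hk]
  exact Submodule.smul_mem _ _ (wedgePoly_antisymmetrize_mem hx k)

end Image

/-! ### Injectivity in low degrees -/

section Injectivity

variable {n k : ℕ}

/-- A skew-symmetric matrix with at most `2n + 1` nonzero rows has rank at most `2n`. -/
theorem exists_symplectic_vectors {ι : Type*} [DecidableEq ι] (n : ℕ) (A : ι → ι → ℝ)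
    (hA : ∀ i j, A i j = - A j i) (s : Finset ι) (hs : s.card ≤ 2 * n + 1)
    (hsupp : ∀ i j, A i j ≠ 0 → i ∈ s) :
    ∃ p q : Fin n → ι → ℝ, ∀ i j, A i j = ∑ l, (p l i * q l j - q l i * p l j) := by
  induction n generalizing A s with
  | zero =>
    -- At most one index is left, and a skew-symmetric matrix of size one is zero; this is where the
    -- bound gains its `+ 1`.
    refine ⟨fun _ => 0, fun _ => 0, fun i j => ?_⟩
    rw [Finset.univ_eq_empty, Finset.sum_empty]
    by_contra h
    have hi := hsupp i j h
    have hj := hsupp j i fun h' => h (by rw [hA, h', neg_zero])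
    obtain rfl := Finset.card_le_one.mp hs i hi j hj
    exact h (by linarith [hA i i])
  | succ n ih =>
    by_cases h0 : ∀ i j, A i j = 0
    · exact ⟨0, 0, fun i j => by simp [h0]⟩
    push Not at h0
    obtain ⟨a, b, hab⟩ := h0
    have haa : A a a = 0 := by linarith [hA a a]
    have hbb : A b b = 0 := by linarith [hA b b]
    have hne : a ≠ b := fun h => hab (by rw [← h, haa])
    have has : a ∈ s := hsupp a b hab
    have hbs : b ∈ s := hsupp b a fun h' => hab (by rw [hA, h', neg_zero])
    -- Symplectic Gram–Schmidt: the subtracted form has rank two and agrees with `A` in the rows `a`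
    -- and `b`, so the support shrinks by two indices at the cost of one pair of vectors.
    set B : ι → ι → ℝ := fun i j => A i j - (A i b / A a b * A a j - A a i * (A j b / A a b)) with hB
    have hrow : ∀ j, B a j = 0 ∧ B b j = 0 := fun j => by
      simp only [hB, haa, hbb, hA b j]
      constructor <;> field_simp <;> ring
    obtain ⟨p, q, hpq⟩ := ih B (fun i j => by simp only [hB]; rw [hA i j]; ring)
      ((s.erase a).erase b)
      (by
        rw [Finset.card_erase_of_mem (Finset.mem_erase.mpr ⟨hne.symm, hbs⟩),
          Finset.card_erase_of_mem has]
        omega)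
      (fun i j h => by
        refine Finset.mem_erase.mpr ⟨?_, Finset.mem_erase.mpr ⟨?_, ?_⟩⟩
        · rintro rfl; exact h (hrow j).2
        · rintro rfl; exact h (hrow j).1
        · by_contra hi
          have : ∀ l, A i l = 0 := fun l => by_contra fun h' => hi (hsupp i l h')
          exact h (by simp [hB, this, hA a i]))
    refine ⟨Fin.cons (fun i => A i b / A a b) p, Fin.cons (fun j => A a j) q, fun i j => ?_⟩
    rw [Fin.sum_univ_succ]
    simp only [Fin.cons_zero, Fin.cons_succ]
    rw [← hpq]
    simp only [hB]
    ring

/-! ### Graphs as monomials in the entries of a matrix -/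

/-- The monomial in the variables `z_{vw}` which corresponds to a multiset of arrows. -/
def arrowMonomial {k : ℕ} (E : Multiset (Fin k × Fin k)) : MvPolynomial (Fin k × Fin k) ℝ :=
  (E.map X).prod

theorem arrowMonomial_cons (a : Fin k × Fin k) (E : Multiset (Fin k × Fin k)) :
    arrowMonomial (a ::ₘ E) = X a * arrowMonomial E := by
  simp [arrowMonomial]

theorem arrowMonomial_eq (E : Multiset (Fin k × Fin k)) :
    arrowMonomial E = monomial (Multiset.toFinsupp E) 1 := by
  induction E using Multiset.induction_on with
  | empty => simp [arrowMonomial]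
  | cons a E ih =>
    rw [arrowMonomial_cons, ih, X, monomial_mul, one_mul, ← Multiset.singleton_add, map_add,
      Multiset.toFinsupp_singleton]

theorem arrowMonomial_hom_ext {N : Type*} [AddCommGroup N] [Module ℝ N]
    {S T : MvPolynomial (Fin k × Fin k) ℝ →ₗ[ℝ] N}
    (h : ∀ E, S (arrowMonomial E) = T (arrowMonomial E)) : S = T := by
  refine (basisMonomials _ ℝ).ext fun M => ?_
  have := h (Finsupp.toMultiset M)
  rwa [arrowMonomial_eq, Finsupp.toMultiset_toFinsupp] at this

/-- The linear map which sends a monomial in the variables `z_{vw}` to its graph. -/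
def graphOfPoly (k : ℕ) : MvPolynomial (Fin k × Fin k) ℝ →ₗ[ℝ] GraphSpace 2 :=
  (basisMonomials _ ℝ).constr ℝ fun M => cls 2 ⟨k, Finsupp.toMultiset M⟩

theorem graphOfPoly_arrowMonomial (E : Multiset (Fin k × Fin k)) :
    graphOfPoly k (arrowMonomial E) = cls 2 ⟨k, E⟩ := by
  have : arrowMonomial E = basisMonomials _ ℝ (Multiset.toFinsupp E) := by
    rw [coe_basisMonomials, arrowMonomial_eq]
  rw [this, graphOfPoly, Module.Basis.constr_basis, Multiset.toFinsupp_toMultiset]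

/-- The substitution `z_{vw} ↦ (z_{vw} - z_{wv}) / 2`. -/
def skewPart (k : ℕ) : MvPolynomial (Fin k × Fin k) ℝ →ₐ[ℝ] MvPolynomial (Fin k × Fin k) ℝ :=
  aeval fun e => (1 / 2 : ℝ) • (X e - X (e.2, e.1))

/-- Reversing an arrow changes the sign of the graph, so `z_{vw}` and `-z_{wv}` stand for the same
graph and so does their mean. -/
theorem graphOfPoly_skewPart (f : MvPolynomial (Fin k × Fin k) ℝ) :
    graphOfPoly k (skewPart k f) = graphOfPoly k f := by
  -- The factor `F` collects the arrows already treated, so that the induction on `E` goes through.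
  have key : ∀ E F, graphOfPoly k (skewPart k (arrowMonomial E) * arrowMonomial F)
      = cls 2 ⟨k, E + F⟩ := by
    intro E
    induction E using Multiset.induction_on with
    | empty => intro F; simp [arrowMonomial, ← graphOfPoly_arrowMonomial]
    | cons a E ih =>
      intro F
      have h1 : skewPart k (arrowMonomial (a ::ₘ E)) * arrowMonomial F
          = (1 / 2 : ℝ) • (skewPart k (arrowMonomial E) * arrowMonomial (a ::ₘ F)
            - skewPart k (arrowMonomial E) * arrowMonomial ((a.2, a.1) ::ₘ F)) := by
        simp only [arrowMonomial_cons, map_mul]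
        rw [skewPart, aeval_X, smul_mul_assoc, smul_mul_assoc]
        congr 1
        ring
      rw [h1, map_smul, map_sub, ih, ih, Multiset.add_cons, Multiset.add_cons,
        cls_reversal 2 a.1 a.2, Multiset.cons_add]
      module
  have : graphOfPoly k ∘ₗ (skewPart k).toLinearMap = graphOfPoly k :=
    arrowMonomial_hom_ext fun E => by
      have := key E 0
      rw [show arrowMonomial (0 : Multiset (Fin k × Fin k)) = 1 by simp [arrowMonomial], mul_one,
        add_zero] at this
      rw [graphOfPoly_arrowMonomial]
      exact this
  exact LinearMap.congr_fun this f

variable (n k) in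
/-- The substitution of the symplectic products for the variables `z_{vw}`. -/
def substArrows : MvPolynomial (Fin k × Fin k) ℝ →ₐ[ℝ] MvPolynomial (Fin k × (Fin n ⊕ Fin n)) ℝ :=
  aeval (arrowPoly n)

theorem substArrows_arrowMonomial (E : Multiset (Fin k × Fin k)) :
    substArrows n k (arrowMonomial E) = arrowProd n E := by
  rw [arrowMonomial, map_multiset_prod, Multiset.map_map, arrowProd]
  congr 2
  funext e
  simp [substArrows]

/-- The second fundamental theorem of invariant theory for `sp(2n)`, for at most `2n + 1`
vectors. -/
theorem graphOfPoly_eq_zero (hk : k ≤ 2 * n + 1) {f : MvPolynomial (Fin k × Fin k) ℝ}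
    (hf : substArrows n k f = 0) : graphOfPoly k f = 0 := by
  have : skewPart k f = 0 := by
    refine MvPolynomial.funext fun y => ?_
    rw [map_zero]
    -- At every point the skew part is a matrix of symplectic products of `k` vectors in ℝ²ⁿ, where
    -- `f` vanishes by assumption.
    obtain ⟨p, q, hpq⟩ := exists_symplectic_vectors n
      (fun v w : Fin k => (1 / 2 : ℝ) * (y (v, w) - y (w, v))) (fun v w => by ring)
      Finset.univ (by simpa using hk) (fun _ _ _ => Finset.mem_univ _)
    have h1 := congrArg (eval fun x : Fin k × (Fin n ⊕ Fin n) =>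
      Sum.elim (fun l => p l x.1) (fun l => q l x.1) x.2) hf
    rw [map_zero] at h1
    rw [← h1, skewPart, substArrows, aeval_def, aeval_def, eval_eval₂, eval_eval₂]
    congr 1
    · ext r; simp
    · funext ⟨v, w⟩
      have := hpq v w
      simp only [arrowPoly, map_sum, map_sub, map_mul, eval_X, Sum.elim_inl, Sum.elim_inr,
        smul_eval]
      exact this
  rw [← graphOfPoly_skewPart, this, map_zero]

/-- The lift uses only monomials of graphs with all valences at least two, so that its substitution
is in `highDegree` and `antisymmetrize_wedgePoly` applies. -/
theorem exists_graphOfPoly {x : GraphSpace 2} (hx : x ∈ chains 2 k) :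
    ∃ f, graphOfPoly k f = x ∧ substArrows n k f ∈ highDegree n k ∧
      wedgePoly n k (substArrows n k f) = stateMap n x := by
  rw [chains] at hx
  induction hx using Submodule.span_induction with
  | zero => exact ⟨0, by simp⟩
  | add x y _ _ hx hy =>
    obtain ⟨f, hf, hf', hf''⟩ := hx
    obtain ⟨g, hg, hg', hg''⟩ := hy
    refine ⟨f + g, by rw [map_add, hf, hg], ?_, by rw [map_add, map_add, map_add, hf'', hg'']⟩
    rw [map_add]
    exact Submodule.add_mem _ hf' hg'
  | smul r x _ hx =>
    obtain ⟨f, hf, hf', hf''⟩ := hx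
    refine ⟨r • f, by rw [map_smul, hf], ?_, by rw [map_smul, map_smul, map_smul, hf'']⟩
    rw [map_smul]
    exact Submodule.smul_mem _ _ hf'
  | mem x hx =>
    obtain ⟨X, rfl, rfl⟩ := hx
    refine ⟨arrowMonomial X.1.arrows, graphOfPoly_arrowMonomial _, ?_, ?_⟩
    · rw [substArrows_arrowMonomial]
      exact arrowProd_mem_highDegree X.2
    · rw [substArrows_arrowMonomial, stateMap_cls]

/-- The hypothesis says that the signed sum of all renumberings of a lift of `x` is a relation among
symplectic products. By the second fundamental theorem its graph is zero; but each term represents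
`x`, since the sign occurs twice, so k!·x = 0. -/
theorem eq_zero_of_antisymmetrize_stateMap (hk : k ≤ 2 * n + 1) {x : GraphSpace 2}
    (hx : x ∈ chains 2 k) (h : antisymmetrize n k (stateMap n x) = 0) : x = 0 := by
  obtain ⟨f, rfl, hf, hf'⟩ := exists_graphOfPoly (n := n) hx
  rw [← hf', antisymmetrize_wedgePoly hf] at h
  have h1 : ∀ σ : Equiv.Perm (Fin k), rename (Prod.map σ id) (substArrows n k f)
      = substArrows n k (rename (Prod.map σ σ) f) := fun σ => by
    have : (rename (Prod.map σ id)).comp (substArrows n k)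
        = (substArrows n k).comp (rename (Prod.map σ σ)) := by
      apply algHom_ext
      rintro ⟨v, w⟩
      simp [substArrows, arrowPoly]
    exact DFunLike.congr_fun this f
  have h2 : ∀ σ : Equiv.Perm (Fin k), graphOfPoly k (rename (Prod.map σ σ) f)
      = sgn σ • graphOfPoly k f := fun σ => by
    have : graphOfPoly k ∘ₗ (rename (R := ℝ) (Prod.map σ σ)).toLinearMap = sgn σ • graphOfPoly k :=
      arrowMonomial_hom_ext fun E => by
        have : rename (R := ℝ) (Prod.map σ σ) (arrowMonomial E) = arrowMonomial (mapArrows σ E) := by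
          rw [arrowMonomial, map_multiset_prod, Multiset.map_map, arrowMonomial, mapArrows,
            Multiset.map_map]
          simp
        rw [LinearMap.comp_apply, AlgHom.toLinearMap_apply, this, graphOfPoly_arrowMonomial,
          LinearMap.smul_apply, graphOfPoly_arrowMonomial, cls_relabel]
    exact LinearMap.congr_fun this f
  have h3 := graphOfPoly_eq_zero (f := ∑ σ : Equiv.Perm (Fin k), sgn σ • rename (Prod.map σ σ) f) hk
    (by rw [← h, map_sum]; exact Finset.sum_congr rfl fun σ _ => by rw [map_smul, h1])
  simp only [map_sum, map_smul, h2, smul_smul, sgn_mul_self, one_smul, Finset.sum_const,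
    Finset.card_univ] at h3
  rw [← Nat.cast_smul_eq_nsmul ℝ] at h3
  exact (smul_eq_zero.mp h3).resolve_left (Nat.cast_ne_zero.mpr Fintype.card_ne_zero)

/-! ### The grading by the number of vertices, and the map φₙ -/

open Classical in
/-- The part of a chain which consists of the graphs with `j` vertices. -/
def vertexPart (j : ℕ) : GraphSpace 2 →ₗ[ℝ] GraphSpace 2 :=
  liftGraph 2 (fun k E => if k = j then cls 2 ⟨k, E⟩ else 0)
    (fun k a b E => by
      split_ifs
      · exact cls_reversal 2 a b E
      · rw [neg_zero])
    (fun k E σ => by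
      split_ifs
      · exact cls_relabel 2 E σ
      · rw [smul_zero])

open Classical in
theorem vertexPart_cls (j : ℕ) (X : AGraph 2) :
    vertexPart j (cls 2 X.1) = if X.1.k = j then cls 2 X.1 else 0 := by
  rw [vertexPart, liftGraph_cls]

theorem cls_mem_chains (m : ℕ) (X : LGraph) : cls m X ∈ chains m X.k := by
  by_cases h : ∀ v, m ≤ X.valence v
  · exact Submodule.subset_span ⟨⟨X, h⟩, rfl, rfl⟩
  · rw [cls, dif_neg h]
    exact Submodule.zero_mem _

theorem vertexPart_mem (j : ℕ) (x : GraphSpace 2) : vertexPart j x ∈ chains 2 j := by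
  have : (chains 2 j).mkQ ∘ₗ vertexPart j = 0 := graphSpace_hom_ext fun X => by
    rw [LinearMap.comp_apply, vertexPart_cls, Submodule.mkQ_apply, LinearMap.zero_apply,
      Submodule.Quotient.mk_eq_zero]
    split_ifs with h
    · exact h ▸ cls_mem_chains 2 X.1
    · exact Submodule.zero_mem _
  have := LinearMap.congr_fun this x
  rwa [LinearMap.comp_apply, Submodule.mkQ_apply, LinearMap.zero_apply,
    Submodule.Quotient.mk_eq_zero] at this

theorem antisymmetrize_stateMap_vertexPart (x : GraphSpace 2) :
    antisymmetrize n k (stateMap n (vertexPart k x)) = antisymmetrize n k (stateMap n x) := by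
  have : antisymmetrize n k ∘ₗ stateMap n ∘ₗ vertexPart k = antisymmetrize n k ∘ₗ stateMap n :=
    graphSpace_hom_ext fun X => by
      rw [LinearMap.comp_apply, LinearMap.comp_apply, vertexPart_cls, LinearMap.comp_apply]
      split_ifs with h
      · rfl
      · rw [map_zero, map_zero, antisymmetrize_eq_zero_of_mem_exteriorPower h
          (stateMap_mem_exteriorPower (cls_mem_chains 2 X.1))]
  exact LinearMap.congr_fun this x

theorem sum_vertexPart {x : GraphSpace 2} (hx : x ∈ stableChains n) :
    ∑ j ∈ Finset.range (2 * n + 2), vertexPart j x = x := by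
  have : stableChains n ≤ LinearMap.ker
      (∑ j ∈ Finset.range (2 * n + 2), vertexPart j - LinearMap.id) := by
    refine iSup₂_le fun k hk => ?_
    rw [chains, Submodule.span_le]
    rintro _ ⟨X, rfl, rfl⟩
    have hk' : X.1.k ∈ Finset.range (2 * n + 2) :=
      Finset.mem_range.mpr (Nat.lt_succ_of_le (Set.mem_Iic.mp hk))
    rw [SetLike.mem_coe, LinearMap.mem_ker, LinearMap.sub_apply, LinearMap.sum_apply, sub_eq_zero]
    simp only [vertexPart_cls]
    rw [Finset.sum_ite_eq, if_pos hk', LinearMap.id_apply]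
  have h := this hx
  rwa [LinearMap.mem_ker, LinearMap.sub_apply, LinearMap.sum_apply, sub_eq_zero] at h

/-- `antisymmetrize n k` sees only the part with `k` vertices, so a vanishing image forces each part
to vanish separately. -/
theorem stateMap_injective_stableChains :
    Function.Injective (stateMap n ∘ₗ (stableChains n).subtype) := by
  rw [injective_iff_map_eq_zero]
  rintro ⟨x, hx⟩ h
  refine Subtype.ext ?_
  change x = 0
  rw [← sum_vertexPart hx]
  refine Finset.sum_eq_zero fun j hj => eq_zero_of_antisymmetrize_stateMap
    (Nat.lt_succ_iff.mp (Finset.mem_range.mp hj)) (vertexPart_mem j x) ?_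
  rw [antisymmetrize_stateMap_vertexPart]
  exact (congrArg _ h).trans (map_zero _)

theorem chains_le_stableChains (hk : k ≤ 2 * n + 1) : chains 2 k ≤ stableChains n :=
  le_iSup₂ (f := fun k (_ : k ∈ Set.Iic (2 * n + 1)) => chains 2 k) k hk

theorem stateMap_mem_stableInvariants {x : GraphSpace 2} (hx : x ∈ stableChains n) :
    stateMap n x ∈ stableInvariants n := by
  refine ⟨stateMap_mem_spInvariants x, ?_⟩
  have : stableChains n ≤ (⨆ k ∈ Set.Iic (2 * n + 1), ⋀[ℝ]^k (polyLie n)).comap (stateMap n) :=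
    iSup₂_le fun k hk x hx =>
      le_iSup₂ (f := fun k (_ : k ∈ Set.Iic (2 * n + 1)) => ⋀[ℝ]^k (polyLie n)) k hk
        (stateMap_mem_exteriorPower hx)
  exact this hx

theorem phi_stateMap {x : GraphSpace 2} (hx : x ∈ stableChains n)
    (h : stateMap n x ∈ stableInvariants n) : phi n ⟨stateMap n x, h⟩ = reduce x := by
  have := LinearMap.leftInverse_apply_of_inj
    (LinearMap.ker_eq_bot.mpr (stateMap_injective_stableChains (n := n))) ⟨x, hx⟩
  change reduce ((stateMap n ∘ₗ (stableChains n).subtype).leftInverse (stateMap n x)).1 = reduce x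
  exact congrArg (fun y : stableChains n => reduce y.1) this

theorem bijOn_stateMap (hk : k ≤ 2 * n + 1) : Set.BijOn (stateMap n) (chains 2 k)
    (spInvariants n ⊓ ⋀[ℝ]^k (polyLie n) : Submodule ℝ (ExteriorAlgebra ℝ (polyLie n))) := by
  refine ⟨fun x hx => ⟨stateMap_mem_spInvariants x, stateMap_mem_exteriorPower hx⟩,
    fun x hx y hy h => ?_, fun x hx => mem_map_chains hx.1 hx.2⟩
  have hx' := chains_le_stableChains hk hx
  have hy' := chains_le_stableChains hk hy
  exact congrArg Subtype.val (stateMap_injective_stableChains (n := n) (a₁ := ⟨x, hx'⟩)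
    (a₂ := ⟨y, hy'⟩) h)

/-- Different exterior powers meet only in zero, as `antisymmetrize n k` detects. This covers a
factor whose stated degree is beyond the stable range. -/
theorem eq_zero_of_mem_stableInvariants (hk : 2 * n + 1 < k) {x : ExteriorAlgebra ℝ (polyLie n)}
    (hx : x ∈ stableInvariants n) (hk' : x ∈ ⋀[ℝ]^k (polyLie n)) : x = 0 := by
  have : ⨆ j ∈ Set.Iic (2 * n + 1), ⋀[ℝ]^j (polyLie n) ≤ LinearMap.ker (antisymmetrize n k) :=
    iSup₂_le fun j hj x hx => antisymmetrize_eq_zero_of_mem_exteriorPower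
      (by have := Set.mem_Iic.mp hj; omega) hx
  rw [eq_of_mem_exteriorPower hk', LinearMap.mem_ker.mp (this hx.2), map_zero, smul_zero]

end Injectivity

/-! ### Compatibility with the Schouten bracket -/

section SchoutenBracket

variable {n : ℕ}

/-- `toPolyLie` sends a monomial of degree below two to zero, which puts a zero factor in the wedge
product. -/
theorem wedgePoly_highPart {k : ℕ} (P : MvPolynomial (Fin k × (Fin n ⊕ Fin n)) ℝ) :
    wedgePoly n k (highPart n k P) = wedgePoly n k P := by
  have : wedgePoly n k ∘ₗ highPart n k = wedgePoly n k := by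
    refine (basisMonomials _ ℝ).ext fun M => ?_
    rw [LinearMap.comp_apply, highPart, Module.Basis.constr_basis, coe_basisMonomials]
    split_ifs with h
    · rfl
    · push Not at h
      obtain ⟨v, hv⟩ := h
      rw [map_zero, wedgePoly_monomial, eq_comm]
      refine AlternatingMap.map_coord_zero _ v ?_
      rw [toPolyLie, dif_neg]
      intro h'
      have := degree_of_coeff_ne_zero h' (s := M.curry v) (by simp)
      omega
  exact LinearMap.congr_fun this P

/-- For a graph with a vertex of valence below two both sides vanish. Collapsed graphs can thus be
handled without checking valences. -/
theorem stateMap_cls_eq (X : LGraph) :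
    stateMap n (cls 2 X) = wedgePoly n X.k (arrowProd n X.arrows) := by
  by_cases h : ∀ v, 2 ≤ X.valence v
  · exact stateMap_cls ⟨X, h⟩
  · rw [cls, dif_neg h, map_zero, ← wedgePoly_highPart, highPart_arrowProd h, map_zero]

theorem castAdd_ne_natAdd {x y : ℕ} (i : Fin x) (j : Fin y) : Fin.castAdd y i ≠ Fin.natAdd x j := by
  intro h
  have := congrArg Fin.val h
  simp at this
  omega

/-- The merging of the vertices `i` and `j` of a disjoint union, followed by `wedgePoly`. -/
def mergeWedge (n : ℕ) {x y : ℕ} (i : Fin x) (j : Fin y) :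
    MvPolynomial (Fin (x + y) × (Fin n ⊕ Fin n)) ℝ →ₗ[ℝ] ExteriorAlgebra ℝ (polyLie n) :=
  sgn (frontPerm (Fin.castAdd y i) (Fin.natAdd x j)) • wedgePoly n (x + y - 1) ∘ₗ
    (rename (R := ℝ) (Prod.map (mergeMap _ _ (castAdd_ne_natAdd i j)) id)).toLinearMap

theorem rename_arrowProd {k l : ℕ} (f : Fin k → Fin l) (E : Multiset (Fin k × Fin k)) :
    rename (Prod.map f id) (arrowProd n E) = arrowProd n (mapArrows f E) := by
  rw [arrowProd, map_multiset_prod, Multiset.map_map, arrowProd, mapArrows, Multiset.map_map]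
  congr 2
  funext a
  simp [arrowPoly]

theorem mergeWedge_arrowProd {x y : ℕ} (i : Fin x) (j : Fin y)
    (R : Multiset (Fin (x + y) × Fin (x + y))) : mergeWedge n i j (arrowProd n R)
      = stateMap n (collapse 2 (Fin.castAdd y i) (Fin.natAdd x j) R) := by
  rw [collapse, dif_neg (castAdd_ne_natAdd i j), map_smul, stateMap_cls_eq, ← rename_arrowProd]
  rfl

/-- The Poisson bracket of the `i`-th factor of `A` with the `j`-th factor of `B`, where the
variables of the two factors are kept apart. -/
def pairPoisson (n : ℕ) {x y : ℕ} (i : Fin x) (j : Fin y) :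
    MvPolynomial (Fin x × (Fin n ⊕ Fin n)) ℝ →ₗ[ℝ] MvPolynomial (Fin y × (Fin n ⊕ Fin n)) ℝ →ₗ[ℝ]
      MvPolynomial (Fin (x + y) × (Fin n ⊕ Fin n)) ℝ :=
  ∑ c : Fin n ⊕ Fin n, eps c • (LinearMap.mul ℝ _).compl₁₂
    ((rename (R := ℝ) (Prod.map (Fin.castAdd y) id)).toLinearMap ∘ₗ (pderiv (i, c)).toLinearMap)
    ((rename (R := ℝ) (Prod.map (Fin.natAdd x) id)).toLinearMap ∘ₗ
      (pderiv (j, c.swap)).toLinearMap)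

theorem pairPoisson_apply {x y : ℕ} (i : Fin x) (j : Fin y)
    (A : MvPolynomial (Fin x × (Fin n ⊕ Fin n)) ℝ) (B : MvPolynomial (Fin y × (Fin n ⊕ Fin n)) ℝ) :
    pairPoisson n i j A B = ∑ c, eps c • (rename (Prod.map (Fin.castAdd y) id) (pderiv (i, c) A)
      * rename (Prod.map (Fin.natAdd x) id) (pderiv (j, c.swap) B)) := by
  simp [pairPoisson, LinearMap.sum_apply]

theorem poisson_eq_sum (f g : Poly n) :
    poisson f g = ∑ c, eps c • (pderiv c f * pderiv c.swap g) := by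
  simp [poisson, Fintype.sum_sum_type, eps, Finset.sum_sub_distrib, ← sub_eq_add_neg]

theorem pderiv_rename_mk {k : ℕ} (i v : Fin k) (c : Fin n ⊕ Fin n) (f : Poly n) :
    pderiv (i, c) (rename (Prod.mk v) f) = if v = i then rename (Prod.mk v) (pderiv c f) else 0 := by
  classical
  split_ifs with h
  · subst h
    exact pderiv_rename (Prod.mk_right_injective v) c f
  · refine pderiv_eq_zero_of_notMem_vars fun h' => ?_
    have := vars_rename (Prod.mk v) f h'
    simp [h] at this

theorem pderiv_tensorMap {p : ℕ} (i : Fin (p + 1)) (c : Fin n ⊕ Fin n)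
    (f : Fin (p + 1) → polyLie n) :
    pderiv (i, c) (tensorMap n (p + 1) f) = rename (Prod.mk i) (pderiv c (f i : Poly n))
      * ∏ v, rename (Prod.mk (i.succAbove v)) (f (i.succAbove v) : Poly n) := by
  rw [tensorMap_apply, Fin.prod_univ_succAbove _ i, pderiv_mul, pderiv_rename_mk, if_pos rfl,
    derivation_prod, Finset.sum_eq_zero, mul_zero, add_zero]
  intro v _
  rw [pderiv_rename_mk, if_neg (Fin.succAbove_ne i v), mul_zero]

/-! ### Numbering and sign of the merged vertices -/

theorem val_frontPerm {k : ℕ} {i j v : Fin k} (h : i < j) (hi : v ≠ i) (hj : v ≠ j) :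
    (frontPerm i j v : ℕ) = if v < i then (v : ℕ) + 2 else if v < j then (v : ℕ) + 1 else v := by
  have hvi : (v : ℕ) ≠ i := fun e => hi (Fin.ext e)
  have hvj : (v : ℕ) ≠ j := fun e => hj (Fin.ext e)
  have h0 := Fin.coe_cycleRange_of_lt h
  rw [frontPerm, Equiv.trans_apply]
  simp only [Fin.lt_def]
  rcases lt_or_gt_of_ne hvj with hlt | hgt
  · have h1 := Fin.coe_cycleRange_of_lt (Fin.lt_def.mpr hlt)
    rw [if_pos hlt]
    rcases lt_or_gt_of_ne hvi with hlt' | hgt'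
    · rw [if_pos hlt', Fin.coe_cycleRange_of_lt (Fin.lt_def.mpr (by omega)), h1]
    · rw [if_neg (by omega), Fin.cycleRange_of_gt (Fin.lt_def.mpr (by omega)), h1]
  · rw [Fin.lt_def] at h
    rw [if_neg (by omega), if_neg (by omega), Fin.cycleRange_of_gt (Fin.lt_def.mpr hgt),
      Fin.cycleRange_of_gt (Fin.lt_def.mpr (by omega))]

/-- The first cycle has sign (-1)^j and moves `i < j` to position `i + 1`, so the second one has
sign (-1)^(i+1). -/
theorem sgn_frontPerm {k : ℕ} {i j : Fin k} (h : i < j) :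
    sgn (frontPerm i j) = (-1 : ℝ) ^ ((i : ℕ) + j + 1) := by
  rw [frontPerm, sgn, Equiv.Perm.sign_trans, Fin.sign_cycleRange, Fin.sign_cycleRange,
    Fin.coe_cycleRange_of_lt h, ← pow_add]
  push_cast
  congr 1
  ring

theorem castAdd_lt_natAdd {x y : ℕ} (i : Fin x) (j : Fin y) :
    Fin.castAdd y i < Fin.natAdd x j := by
  rw [Fin.lt_def, Fin.val_castAdd, Fin.val_natAdd]
  omega

/-- The vertices of the second graph are shifted by `p + 1`; the result is precisely the sign in
`schouten_ιMulti`. -/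
theorem sgn_frontPerm_castAdd_natAdd {p q : ℕ} (i : Fin (p + 1)) (j : Fin (q + 1)) :
    sgn (frontPerm (Fin.castAdd (q + 1) i) (Fin.natAdd (p + 1) j))
      = (-1 : ℝ) ^ ((i : ℕ) + (j : ℕ) + p) := by
  rw [sgn_frontPerm (castAdd_lt_natAdd i j), Fin.val_castAdd, Fin.val_natAdd,
    show (i : ℕ) + (p + 1 + j) + 1 = i + j + p + 2 by ring, pow_add, neg_one_sq, mul_one]

theorem mergeMap_castAdd {p q : ℕ} (i : Fin (p + 1)) (j : Fin (q + 1)) (v : Fin p) :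
    mergeMap _ _ (castAdd_ne_natAdd i j) (Fin.castAdd (q + 1) (i.succAbove v))
      = (Fin.castAdd q v.succ : Fin (p + 1 + q)) := by
  apply Fin.ext
  have h := Fin.succAbove_ne i v
  change (frontPerm _ _ _ : ℕ) - 1 = v + 1
  rw [val_frontPerm (castAdd_lt_natAdd i j) (fun e => h (Fin.castAdd_injective _ _ e))
    (castAdd_ne_natAdd _ _)]
  simp only [Fin.lt_def, Fin.val_castAdd, Fin.val_natAdd, Fin.succAbove, Fin.val_castSucc]
  split_ifs <;> simp at * <;> omega

theorem mergeMap_natAdd {p q : ℕ} (i : Fin (p + 1)) (j : Fin (q + 1)) (w : Fin q) :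
    mergeMap _ _ (castAdd_ne_natAdd i j) (Fin.natAdd (p + 1) (j.succAbove w))
      = (Fin.natAdd (p + 1) w : Fin (p + 1 + q)) := by
  apply Fin.ext
  have h := Fin.succAbove_ne j w
  change (frontPerm _ _ _ : ℕ) - 1 = p + 1 + w
  rw [val_frontPerm (castAdd_lt_natAdd i j) (castAdd_ne_natAdd _ _).symm
    (fun e => h (Fin.natAdd_injective _ _ e))]
  simp only [Fin.lt_def, Fin.val_castAdd, Fin.val_natAdd, Fin.succAbove, Fin.val_castSucc]
  split_ifs <;> simp at * <;> omega

theorem mergeMap_left {k : ℕ} {i j : Fin k} (h : i ≠ j) : (mergeMap i j h i : ℕ) = 0 := by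
  change (frontPerm _ _ _ : ℕ) - 1 = 0
  rw [frontPerm_left]

theorem mergeMap_right {k : ℕ} {i j : Fin k} (h : i ≠ j) : (mergeMap i j h j : ℕ) = 0 := by
  change (frontPerm _ _ _ : ℕ) - 1 = 0
  rw [frontPerm_right h]

/-- Identifying the variables of the two chosen factors turns `pairPoisson` into the Poisson
bracket, placed first, with the other factors in order. The abstract `μ` keeps natural subtraction
out of the index type. -/
theorem rename_pairPoisson_tensorMap {p q : ℕ} (i : Fin (p + 1)) (j : Fin (q + 1))
    (f : Fin (p + 1) → polyLie n) (g : Fin (q + 1) → polyLie n)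
    (μ : Fin (p + 1 + (q + 1)) → Fin (p + 1 + q)) (hi : μ (Fin.castAdd _ i) = Fin.castAdd q 0)
    (hj : μ (Fin.natAdd _ j) = Fin.castAdd q 0)
    (hl : ∀ v, μ (Fin.castAdd _ (i.succAbove v)) = Fin.castAdd q v.succ)
    (hr : ∀ w, μ (Fin.natAdd _ (j.succAbove w)) = Fin.natAdd (p + 1) w) :
    rename (Prod.map μ id) (pairPoisson n i j (tensorMap n _ f) (tensorMap n _ g))
      = tensorMap n (p + 1 + q) (Fin.append (Fin.cons ⁅f i, g j⁆ (i.removeNth f) : Fin (p + 1) → _)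
          (j.removeNth g)) := by
  rw [pairPoisson_apply, map_sum]
  conv_rhs => rw [tensorMap_apply, Fin.prod_univ_add, Fin.prod_univ_succ]
  simp only [Fin.append_left, Fin.append_right, Fin.cons_zero, Fin.cons_succ, coe_bracket,
    poisson_eq_sum, map_sum, map_smul, map_mul, pderiv_tensorMap, map_prod, rename_rename,
    Finset.sum_mul]
  refine Finset.sum_congr rfl fun c _ => ?_
  simp only [smul_mul_assoc]
  congr 1
  have h2 : ∀ v, Prod.map μ id ∘ Prod.map (Fin.castAdd (q + 1)) (id : Fin n ⊕ Fin n → _) ∘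
      Prod.mk v = Prod.mk (μ (Fin.castAdd (q + 1) v)) := fun v => rfl
  have h3 : ∀ w, Prod.map μ id ∘ Prod.map (Fin.natAdd (p + 1)) (id : Fin n ⊕ Fin n → _) ∘
      Prod.mk w = Prod.mk (μ (Fin.natAdd (p + 1) w)) := fun w => rfl
  simp only [h2, h3, hi, hj, hl, hr, Fin.removeNth_apply]
  ring

theorem schouten_wedgePoly_tensorMap {x y : ℕ} (f : Fin x → polyLie n) (g : Fin y → polyLie n) :
    schouten (wedgePoly n x (tensorMap n x f)) (wedgePoly n y (tensorMap n y g))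
      = ∑ i, ∑ j, mergeWedge n i j (pairPoisson n i j (tensorMap n x f) (tensorMap n y g)) := by
  rw [wedgePoly_tensorMap, wedgePoly_tensorMap]
  rcases x with _ | p
  · simp [schouten_one_left]
  rcases y with _ | q
  · simp [schouten_one_right]
  rw [schouten_ιMulti]
  refine Finset.sum_congr rfl fun i _ => Finset.sum_congr rfl fun j _ => ?_
  rw [mergeWedge, LinearMap.smul_apply, LinearMap.comp_apply, AlgHom.toLinearMap_apply,
    sgn_frontPerm_castAdd_natAdd]
  congr 1
  refine Eq.trans ?_ (congrArg (wedgePoly n (p + 1 + q)) (rename_pairPoisson_tensorMap i j f g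
    (mergeMap _ _ (castAdd_ne_natAdd i j)) (Fin.ext (mergeMap_left _)) (Fin.ext (mergeMap_right _))
    (mergeMap_castAdd i j) (mergeMap_natAdd i j))).symm
  rw [wedgePoly_tensorMap, ← ExteriorAlgebra.ιMulti_mul_ιMulti, ExteriorAlgebra.ιMulti_succ_apply]
  simp [Matrix.vecTail, Function.comp_def]

theorem schouten_wedgePoly {x y : ℕ} {A : MvPolynomial (Fin x × (Fin n ⊕ Fin n)) ℝ}
    {B : MvPolynomial (Fin y × (Fin n ⊕ Fin n)) ℝ} (hA : A ∈ highDegree n x)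
    (hB : B ∈ highDegree n y) : schouten (wedgePoly n x A) (wedgePoly n y B)
      = ∑ i, ∑ j, mergeWedge n i j (pairPoisson n i j A B) := by
  have h1 : ∀ f : Fin x → polyLie n,
      schouten (wedgePoly n x (tensorMap n x f)) (wedgePoly n y B)
        = ∑ i, ∑ j, mergeWedge n i j (pairPoisson n i j (tensorMap n x f) B) := fun f => by
    refine (eq_of_mem_highDegree
      (S := schouten (wedgePoly n x (tensorMap n x f)) ∘ₗ wedgePoly n y)
      (T := ∑ i, ∑ j, mergeWedge n i j ∘ₗ pairPoisson n i j (tensorMap n x f))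
      (fun g => ?_) hB).trans (by simp [LinearMap.sum_apply])
    rw [LinearMap.comp_apply, schouten_wedgePoly_tensorMap]
    simp [LinearMap.sum_apply]
  refine (eq_of_mem_highDegree (S := schouten.flip (wedgePoly n y B) ∘ₗ wedgePoly n x)
      (T := ∑ i, ∑ j, mergeWedge n i j ∘ₗ (pairPoisson n i j).flip B)
      (fun f => ?_) hA).trans (by simp [LinearMap.sum_apply])
  rw [LinearMap.comp_apply, LinearMap.flip_apply, h1]
  simp [LinearMap.sum_apply]

theorem pderiv_arrowPoly {k : ℕ} (i : Fin k) (c : Fin n ⊕ Fin n) (a : Fin k × Fin k) :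
    pderiv (i, c) (arrowPoly n a)
      = ∑ s, if i = vtx a s then (eps c * halfSign s) • X (vtx a (!s), c.swap) else 0 := by
  classical
  rw [show a = (a.1, a.2) from rfl, arrowPoly_eq_sum]
  have hs : ∀ b : Fin n ⊕ Fin n, b.swap = c ↔ b = c.swap := fun b =>
    ⟨fun h => by rw [← h, Sum.swap_swap], fun h => by rw [h, Sum.swap_swap]⟩
  simp only [map_sum, Derivation.map_smul, pderiv_mul, pderiv_X, Pi.single_apply, Prod.mk.injEq,
    hs, ite_and, smul_add, Finset.sum_add_distrib, Fintype.sum_bool, vtx, halfSign,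
    eq_comm (a := i)]
  rw [add_comm]
  congr 1
  · by_cases h : a.2 = i <;> simp [h, eps_swap]
  · by_cases h : a.1 = i <;> simp [h]

theorem pderiv_arrowProd {k : ℕ} (x : Fin k × (Fin n ⊕ Fin n)) (E : Multiset (Fin k × Fin k)) :
    pderiv x (arrowProd n E)
      = (E.map fun a => pderiv x (arrowPoly n a) * arrowProd n (E.erase a)).sum := by
  induction E using Multiset.induction_on with
  | empty => simp [arrowProd]
  | cons a E ih =>
    have hcons : ∀ F : Multiset (Fin k × Fin k),
        arrowProd n (a ::ₘ F) = arrowPoly n a * arrowProd n F := fun F => by simp [arrowProd]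
    rw [hcons, pderiv_mul, ih, Multiset.map_cons, Multiset.sum_cons, Multiset.erase_cons_head,
      ← Multiset.sum_map_mul_left]
    congr 2
    refine Multiset.map_congr rfl fun b hb => ?_
    rw [Multiset.erase_cons_tail_of_mem hb, hcons]
    ring

theorem sum_multiset_sum {ι α N : Type*} [AddCommMonoid N] (s : Finset ι) (E : Multiset α)
    (f : ι → α → N) : ∑ i ∈ s, (E.map (f i)).sum = (E.map fun a => ∑ i ∈ s, f i a).sum := by
  induction E using Multiset.induction_on with
  | empty => simp
  | cons a E ih => simp [Finset.sum_add_distrib, ih]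

/-- Differentiating an arrow removes one half-edge at the vertex and leaves the variable at the
other end. Summing over the contracted index joins the two remaining ends by the symplectic form,
which is the new arrow from k̄ to h̄. The two half-edges of a loop are counted separately. -/
theorem pairPoisson_arrowPoly {x y : ℕ} (i : Fin x) (j : Fin y) (a : Fin x × Fin x)
    (b : Fin y × Fin y) (A : MvPolynomial (Fin x × (Fin n ⊕ Fin n)) ℝ)
    (B : MvPolynomial (Fin y × (Fin n ⊕ Fin n)) ℝ) :
    ∑ c, eps c • (rename (Prod.map (Fin.castAdd y) id) (pderiv (i, c) (arrowPoly n a) * A)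
      * rename (Prod.map (Fin.natAdd x) id) (pderiv (j, c.swap) (arrowPoly n b) * B))
    = ∑ s, ∑ t, if i = vtx a s then if j = vtx b t then (halfSign s * halfSign (!t)) •
        (arrowPoly n (Fin.natAdd x (vtx b (!t)), Fin.castAdd y (vtx a (!s)))
          * (rename (Prod.map (Fin.castAdd y) id) A * rename (Prod.map (Fin.natAdd x) id) B))
        else 0 else 0 := by
  have hs : ∀ t, halfSign (!t) = - halfSign t := fun t => by cases t <;> simp [halfSign]
  simp only [pderiv_arrowPoly, map_mul, map_sum, Finset.sum_mul, Finset.mul_sum, Finset.smul_sum]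
  rw [Finset.sum_comm]
  conv_rhs => rw [Finset.sum_comm]
  refine Finset.sum_congr rfl fun t _ => ?_
  rw [Finset.sum_comm]
  refine Finset.sum_congr rfl fun s _ => ?_
  by_cases h1 : i = vtx a s
  · by_cases h2 : j = vtx b t
    · rw [if_pos h1, if_pos h2, arrowPoly_eq_sum, Finset.sum_mul, Finset.smul_sum]
      refine Finset.sum_congr rfl fun c _ => ?_
      rw [if_pos h1, if_pos h2, hs, eps_swap]
      simp only [map_smul, rename_X, Prod.map_apply, id_eq, Sum.swap_swap, smul_mul_assoc,
        mul_smul_comm, smul_smul]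
      congr 1
      · linear_combination (- eps c * halfSign s * halfSign t) * eps_mul_self c
      · ring
    · simp [h2]
  · simp [h1]

theorem pairPoisson_arrowProd {x y : ℕ} (i : Fin x) (j : Fin y) (E : Multiset (Fin x × Fin x))
    (F : Multiset (Fin y × Fin y)) : pairPoisson n i j (arrowProd n E) (arrowProd n F)
      = (E.map fun a => (F.map fun b => ∑ s, ∑ t, if i = vtx a s then if j = vtx b t then
          (halfSign s * halfSign (!t)) • arrowProd n
            ((Fin.natAdd x (vtx b (!t)), Fin.castAdd y (vtx a (!s))) ::ₘ
              (mapArrows (Fin.castAdd y) (E.erase a) + mapArrows (Fin.natAdd x) (F.erase b)))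
          else 0 else 0).sum).sum := by
  have h1 : ∀ (e : Fin (x + y) × Fin (x + y)) (E' : Multiset (Fin x × Fin x))
      (F' : Multiset (Fin y × Fin y)),
      arrowProd n (e ::ₘ (mapArrows (Fin.castAdd y) E' + mapArrows (Fin.natAdd x) F'))
        = arrowPoly n e * (rename (Prod.map (Fin.castAdd y) id) (arrowProd n E')
          * rename (Prod.map (Fin.natAdd x) id) (arrowProd n F')) := fun e E' F' => by
    rw [rename_arrowProd, rename_arrowProd]
    simp [arrowProd]
  simp only [h1, ← pairPoisson_arrowPoly]
  rw [pairPoisson_apply]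
  simp only [pderiv_arrowProd, map_multiset_sum, Multiset.map_map, Function.comp_def,
    ← Multiset.sum_map_mul_left, ← Multiset.sum_map_mul_right, Multiset.smul_sum, sum_multiset_sum]
  rw [Multiset.sum_map_sum_map]

/-- Both sides are sums over pairs of arrows and pairs of their half-edges, and the terms agree one
by one. -/
theorem schouten_stateMap (x y : GraphSpace 2) :
    schouten (stateMap n x) (stateMap n y) = stateMap n (graphBracket 2 x y) := by
  have h : (schouten.compl₁₂ (stateMap n) (stateMap n)) = (graphBracket 2).compr₂ (stateMap n) :=
    graphSpace_hom_ext fun X => graphSpace_hom_ext fun Y => by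
      rw [LinearMap.compl₁₂_apply, LinearMap.compr₂_apply, graphBracket_cls, stateMap_cls,
        stateMap_cls, schouten_wedgePoly (arrowProd_mem_highDegree X.2)
          (arrowProd_mem_highDegree Y.2)]
      simp only [pairPoisson_arrowProd, map_multiset_sum, Multiset.map_map, Function.comp_def,
        sum_multiset_sum, bracketArrows]
      refine congrArg Multiset.sum (Multiset.map_congr rfl fun a _ =>
        congrArg Multiset.sum (Multiset.map_congr rfl fun b _ => ?_))
      simp only [map_sum]
      rw [Finset.sum_congr rfl fun i _ => Finset.sum_comm, Finset.sum_comm]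
      refine Finset.sum_congr rfl fun s _ => ?_
      rw [Finset.sum_congr rfl fun i _ => Finset.sum_comm, Finset.sum_comm]
      refine Finset.sum_congr rfl fun t _ => ?_
      -- A half-edge determines its vertex, so only one pair of vertices survives.
      rw [Finset.sum_eq_single (vtx a s) (fun i _ hi => by simp [hi]) (by simp),
        Finset.sum_eq_single (vtx b t) (fun j _ hj => by simp [hj]) (by simp),
        if_pos rfl, if_pos rfl, map_smul, mergeWedge_arrowProd, contractPair, map_smul]
      simp only [vtx_map]
  exact LinearMap.congr_fun (LinearMap.congr_fun h x) y

end SchoutenBracket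

/-! ### Compatibility of the graph bracket with the projection -/

section Reduce

theorem reduce_cls (X : LGraph) : reduce (cls 2 X) = cls 3 X := by
  by_cases h : ∀ v, 2 ≤ X.valence v
  · exact liftGraph_cls _ _ _ _ ⟨X, h⟩
  · rw [cls, dif_neg h, map_zero, cls, dif_neg]
    exact fun h' => h fun v => (Nat.le_succ 2).trans (h' v)

theorem reduce_collapse {k : ℕ} (i j : Fin k) (E : Multiset (Fin k × Fin k)) :
    reduce (collapse 2 i j E) = collapse 3 i j E := by
  rw [collapse, collapse]
  split_ifs
  · exact map_zero _
  · rw [map_smul, reduce_cls]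

/-- The valence bound enters the bracket formula only through `cls`. What remains for
`reduce_graphBracket` is that the formula gives zero on graphs with a bivalent vertex. -/
theorem reduce_bracketArrows {x y : ℕ} (E : Multiset (Fin x × Fin x))
    (F : Multiset (Fin y × Fin y)) :
    reduce (bracketArrows 2 E F) = bracketArrows 3 E F := by
  simp only [bracketArrows, map_multiset_sum, Multiset.map_map, Function.comp_def, map_sum,
    contractPair, map_smul, reduce_collapse]

/-! ### How a collapse depends on the collapsed arrow -/

theorem sgn_swap_mul {k : ℕ} {i j : Fin k} (h : i ≠ j) (π : Equiv.Perm (Fin k)) :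
    sgn (Equiv.swap i j * π) = - sgn π := by
  rw [sgn_mul, sgn, Equiv.Perm.sign_swap h]
  simp

theorem mapArrows_congr {k l : ℕ} {f g : Fin k → Fin l} {E : Multiset (Fin k × Fin k)}
    (h : ∀ e ∈ E, f e.1 = g e.1 ∧ f e.2 = g e.2) : mapArrows f E = mapArrows g E :=
  Multiset.map_congr rfl fun e he => Prod.ext (h e he).1 (h e he).2

theorem mergeMap_eq_iff {k : ℕ} {i j : Fin k} (h : i ≠ j) {z : Fin k} (hi : z ≠ i) (u : Fin k) :
    mergeMap i j h u = mergeMap i j h z ↔ u = z ∨ (u = i ∧ z = j) := by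
  have h0 : ∀ w, (frontPerm i j w : ℕ) = 0 ↔ w = i := fun w =>
    ⟨fun e => (frontPerm i j).injective (Fin.ext (e.trans frontPerm_left.symm)),
      fun e => e ▸ frontPerm_left⟩
  have h1 : ∀ w, (frontPerm i j w : ℕ) = 1 ↔ w = j := fun w =>
    ⟨fun e => (frontPerm i j).injective (Fin.ext (e.trans (frontPerm_right h).symm)),
      fun e => by rw [e]; exact frontPerm_right h⟩
  have h2 : u = z ↔ (frontPerm i j u : ℕ) = frontPerm i j z :=
    ⟨fun e => by rw [e], fun e => (frontPerm i j).injective (Fin.ext e)⟩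
  have h3 : mergeMap i j h u = mergeMap i j h z
      ↔ (frontPerm i j u : ℕ) - 1 = (frontPerm i j z : ℕ) - 1 := Fin.ext_iff
  have h4 : (frontPerm i j z : ℕ) ≠ 0 := fun e => hi ((h0 z).mp e)
  rw [h3, h2, ← h0, ← h1]
  omega

theorem collapse_mapArrows_update (m : ℕ) {k : ℕ} {v w : Fin k} (h : v ≠ w)
    (E : Multiset (Fin k × Fin k)) :
    collapse m v w (mapArrows (Function.update id v w) E) = collapse m v w E := by
  have hcomp : mergeMap v w h ∘ Function.update id v w = mergeMap v w h := by
    funext u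
    rw [Function.comp_apply]
    by_cases hu : u = v
    · rw [hu, Function.update_self]
      exact Fin.ext ((mergeMap_right h).trans (mergeMap_left h).symm)
    · rw [Function.update_of_ne hu, id_eq]
  rw [collapse, collapse, dif_neg h, dif_neg h, mapArrows_mapArrows, hcomp]

/-- If `v` is an end of no other arrow, collapsing the arrow from `v` to `w` only removes `v`, so
that the result does not depend on `w`. -/
theorem collapse_eq_collapse (m : ℕ) {k : ℕ} {v w w' : Fin k} (h : v ≠ w) (h' : v ≠ w')
    {E : Multiset (Fin k × Fin k)} (hE : ∀ e ∈ E, e.1 ≠ v ∧ e.2 ≠ v) :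
    collapse m v w E = collapse m v w' E := by
  by_cases hw : w = w'
  · rw [hw]
  set π := frontPerm v w with hπ
  set f := mergeMap v w h with hf
  have hπw : π w ≠ π w' := fun e => hw (π.injective e)
  have hfw : f w ≠ f w' := fun e => by
    rcases (mergeMap_eq_iff h h'.symm w).mp e with e | e
    · exact hw e
    · exact h e.1.symm
  have hv : (Equiv.swap (π w) (π w') * π) v = π v := by
    rw [Equiv.Perm.mul_apply, Equiv.swap_apply_of_ne_of_ne]
    · exact fun e => h (π.injective e)
    · exact fun e => h' (π.injective e)
  have hfπ : ∀ u, (f u : ℕ) = π u - 1 := fun u => rfl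
  -- The renumbering for `w` followed by a transposition serves for `w'`. Its sign cancels against
  -- that of the matching transposition of the collapsed graph, as no arrow of `E` ends at `v`.
  have key := collapse_eq m v w' h' E (Equiv.swap (π w) (π w') * π)
    (by rw [hv]; exact frontPerm_left)
    (by rw [Equiv.Perm.mul_apply, Equiv.swap_apply_right]; exact frontPerm_right h)
    (fun u => ⟨((Equiv.swap (π w) (π w') * π) u : ℕ) - 1, by
      have h1 := ((Equiv.swap (π w) (π w') * π) u).2
      have h2 := v.2
      have h3 := w.2
      have h4 : (v : ℕ) ≠ w := fun e => h (Fin.ext e)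
      omega⟩) (fun u => rfl)
  have hmap : mapArrows (fun u => ⟨((Equiv.swap (π w) (π w') * π) u : ℕ) - 1, by
      have h1 := ((Equiv.swap (π w) (π w') * π) u).2
      have h2 := v.2
      have h3 := w.2
      have h4 : (v : ℕ) ≠ w := fun e => h (Fin.ext e)
      omega⟩) E = mapArrows (Equiv.swap (f w) (f w')) (mapArrows f E) := by
    rw [mapArrows_mapArrows]
    have aux : ∀ u, u ≠ v → ((Equiv.swap (π w) (π w') * π) u : ℕ) - 1
        = (Equiv.swap (f w) (f w') (f u) : ℕ) := fun u hu => by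
      rw [Equiv.Perm.mul_apply]
      by_cases h1 : u = w
      · rw [h1, Equiv.swap_apply_left, Equiv.swap_apply_left, hfπ]
      by_cases h2 : u = w'
      · rw [h2, Equiv.swap_apply_right, Equiv.swap_apply_right, hfπ]
      rw [Equiv.swap_apply_of_ne_of_ne (fun e => h1 (π.injective e)) (fun e => h2 (π.injective e)),
        Equiv.swap_apply_of_ne_of_ne, hfπ]
      · intro e
        rcases (mergeMap_eq_iff h h.symm u).mp e with e | e
        · exact h1 e
        · exact hu e.1
      · intro e
        rcases (mergeMap_eq_iff h h'.symm u).mp e with e | e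
        · exact h2 e
        · exact hu e.1
    exact mapArrows_congr fun e he => ⟨Fin.ext (aux _ (hE e he).1), Fin.ext (aux _ (hE e he).2)⟩
  rw [key, hmap, sgn_swap_mul hπw, cls_relabel, collapse, dif_neg h, neg_smul,
    ← mul_one (Equiv.swap (f w) (f w')), sgn_swap_mul hfw, sgn_one, neg_smul, one_smul, smul_neg,
    neg_neg]

/-- Sliding the ends of arrows from `v` to the other end of the collapsed arrow does not change the
collapse, and after that only the resulting arrows matter. -/
theorem collapse_congr (m : ℕ) {k : ℕ} {v w w' : Fin k} (h : v ≠ w) (h' : v ≠ w')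
    {E E' : Multiset (Fin k × Fin k)}
    (hE : mapArrows (Function.update id v w) E = mapArrows (Function.update id v w') E') :
    collapse m v w E = collapse m v w' E' := by
  rw [← collapse_mapArrows_update m h, ← collapse_mapArrows_update m h', ← hE]
  have aux : ∀ u, Function.update id v w u ≠ v := fun u => by
    by_cases hu : u = v
    · rw [hu, Function.update_self]; exact h.symm
    · rw [Function.update_of_ne hu]; exact hu
  refine collapse_eq_collapse m h h' fun e he => ?_
  obtain ⟨e', _, rfl⟩ := Multiset.mem_map.mp he
  exact ⟨aux _, aux _⟩

/-- The vertices numbered 0 and 1 are merged anyway, so exchanging them affects only the sign of the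
renumbering. -/
theorem collapse_swap (m : ℕ) {k : ℕ} (i j : Fin k) (E : Multiset (Fin k × Fin k)) :
    collapse m j i E = - collapse m i j E := by
  by_cases h : i = j
  · simp [collapse, h]
  have hne : frontPerm i j i ≠ frontPerm i j j := fun e => h ((frontPerm i j).injective e)
  have h0 : (frontPerm i j i : ℕ) = 0 := frontPerm_left
  have h1 : (frontPerm i j j : ℕ) = 1 := frontPerm_right h
  rw [collapse_eq m j i (Ne.symm h) E (Equiv.swap (frontPerm i j i) (frontPerm i j j) * frontPerm i j)
    (by rw [Equiv.Perm.mul_apply, Equiv.swap_apply_right, h0])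
    (by rw [Equiv.Perm.mul_apply, Equiv.swap_apply_left, h1])
    (mergeMap i j h) (fun u => ?_), sgn_swap_mul hne, collapse, dif_neg h, neg_smul]
  rw [Equiv.Perm.mul_apply]
  by_cases hi : u = i
  · rw [hi, Equiv.swap_apply_left, h1]; exact mergeMap_left h
  by_cases hj : u = j
  · rw [hj, Equiv.swap_apply_right, h0]; exact mergeMap_right h
  rw [Equiv.swap_apply_of_ne_of_ne (fun e => hi ((frontPerm i j).injective e))
    (fun e => hj ((frontPerm i j).injective e))]
  rfl

/-- Both the collapsed and the new arrow are reversed, and the two signs cancel. -/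
theorem contractPair_symm (m : ℕ) {k : ℕ} (a : Fin k × Fin k) (s : Bool) (b : Fin k × Fin k)
    (t : Bool) (E : Multiset (Fin k × Fin k)) :
    contractPair m b t a s E = contractPair m a s b t E := by
  rw [contractPair, contractPair, collapse_swap, collapse_reversal, neg_neg]
  congr 1
  cases s <;> cases t <;> simp [halfSign]

theorem exists_contractPair_equiv (m : ℕ) {k l : ℕ} (e : Fin k ≃ Fin l) : ∃ c : ℝ, ∀ a s b t E,
    contractPair m (Prod.map e e a) s (Prod.map e e b) t (mapArrows e E)
      = c • contractPair m a s b t E := by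
  obtain rfl : k = l := Fin.equiv_iff_eq.mp ⟨e⟩
  exact ⟨sgn e, fun a s b t E => contractPair_relabel m a s b t E e⟩

/-- Serves to carry vanishing of the bracket from one argument to the other, so the constant need
not be identified. -/
theorem exists_bracketArrows_symm (m x y : ℕ) : ∃ c : ℝ, ∀ (E : Multiset (Fin x × Fin x))
    (F : Multiset (Fin y × Fin y)), bracketArrows m F E = c • bracketArrows m E F := by
  obtain ⟨c, hc⟩ := exists_contractPair_equiv m (finAddFlip (m := x) (n := y))
  refine ⟨c, fun E F => ?_⟩
  rw [bracketArrows, bracketArrows, Multiset.sum_map_sum_map, Multiset.smul_sum, Multiset.map_map]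
  refine congrArg Multiset.sum (Multiset.map_congr rfl fun a _ => ?_)
  rw [Function.comp_apply, Multiset.smul_sum, Multiset.map_map]
  refine congrArg Multiset.sum (Multiset.map_congr rfl fun b _ => ?_)
  rw [Function.comp_apply, Finset.smul_sum, Finset.sum_comm]
  refine Finset.sum_congr rfl fun s _ => ?_
  rw [Finset.smul_sum]
  refine Finset.sum_congr rfl fun t _ => ?_
  have h1 : (finAddFlip (m := x) (n := y)) ∘ Fin.castAdd y = Fin.natAdd y :=
    funext fun v => finAddFlip_apply_castAdd v y
  have h2 : (finAddFlip (m := x) (n := y)) ∘ Fin.natAdd x = Fin.castAdd x :=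
    funext fun v => finAddFlip_apply_natAdd v x
  have h3 : ∀ E F : Multiset (Fin (x + y) × Fin (x + y)), mapArrows (finAddFlip (m := x) (n := y))
      (E + F) = mapArrows (finAddFlip (m := x) (n := y)) E
        + mapArrows (finAddFlip (m := x) (n := y)) F := fun E F => Multiset.map_add _ _ _
  rw [← hc, contractPair_symm, h3, mapArrows_mapArrows, mapArrows_mapArrows, h1, h2, Prod.map_map,
    Prod.map_map, h1, h2, add_comm (mapArrows (Fin.castAdd x) _)]

/-! ### Vanishing of the bracket at a bivalent vertex -/

theorem valence_add {k : ℕ} (E F : Multiset (Fin k × Fin k)) (v : Fin k) :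
    LGraph.valence ⟨k, E + F⟩ v = LGraph.valence ⟨k, E⟩ v + LGraph.valence ⟨k, F⟩ v := by
  simp only [LGraph.valence, Multiset.countP_add]
  omega

theorem valence_cons {k : ℕ} (a : Fin k × Fin k) (E : Multiset (Fin k × Fin k)) (v : Fin k) :
    LGraph.valence ⟨k, a ::ₘ E⟩ v = LGraph.valence ⟨k, E⟩ v + ((if a.1 = v then 1 else 0)
      + if a.2 = v then 1 else 0) := by
  simp only [LGraph.valence, Multiset.countP_cons]
  omega

theorem valence_mapArrows {k l : ℕ} {f : Fin k → Fin l} {z : Fin k} {z' : Fin l}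
    (hf : ∀ u, f u = z' ↔ u = z) (E : Multiset (Fin k × Fin k)) :
    LGraph.valence ⟨l, mapArrows f E⟩ z' = LGraph.valence ⟨k, E⟩ z := by
  induction E using Multiset.induction_on with
  | empty => rfl
  | cons a E ih =>
    have : mapArrows f (a ::ₘ E) = Prod.map f f a ::ₘ mapArrows f E := Multiset.map_cons _ _ _
    rw [this, valence_cons, valence_cons, ih]
    simp only [Prod.map_fst, Prod.map_snd, hf]

theorem valence_mapArrows_eq_zero {k l : ℕ} {f : Fin k → Fin l} {z : Fin l}
    (hf : ∀ u, f u ≠ z) (E : Multiset (Fin k × Fin k)) :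
    LGraph.valence ⟨l, mapArrows f E⟩ z = 0 := by
  induction E using Multiset.induction_on with
  | empty => rfl
  | cons a E ih =>
    have : mapArrows f (a ::ₘ E) = Prod.map f f a ::ₘ mapArrows f E := Multiset.map_cons _ _ _
    rw [this, valence_cons, ih]
    simp [hf]

theorem collapse_eq_zero {m k : ℕ} {i j z : Fin k} (hi : z ≠ i) (hj : z ≠ j)
    {E : Multiset (Fin k × Fin k)} (hz : LGraph.valence ⟨k, E⟩ z < m) : collapse m i j E = 0 := by
  rw [collapse]
  split_ifs with h
  · rfl
  · rw [cls, dif_neg, smul_zero]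
    intro h'
    have := h' (mergeMap i j h z)
    rw [valence_mapArrows (z := z) (fun u => (mergeMap_eq_iff h hi u).trans (by simp [hj]))] at this
    omega

/-- A contraction at a half-edge away from `v` keeps the valence of `v`: if the removed arrow ended
at `v`, so does the new one. Too small a valence therefore persists. -/
theorem contractPair_eq_zero {m x y : ℕ} {E : Multiset (Fin x × Fin x)} {v : Fin x}
    (hv : LGraph.valence ⟨x, E⟩ v < m) {a : Fin x × Fin x} (ha : a ∈ E) {s : Bool}
    (hs : vtx a s ≠ v) (b : Fin y × Fin y) (t : Bool) (F : Multiset (Fin y × Fin y)) :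
    contractPair m (Prod.map (Fin.castAdd y) (Fin.castAdd y) a) s
      (Prod.map (Fin.natAdd x) (Fin.natAdd x) b) t
      (mapArrows (Fin.castAdd y) (E.erase a) + mapArrows (Fin.natAdd x) F) = 0 := by
  rw [contractPair, vtx_map, vtx_map, vtx_map, vtx_map]
  rw [collapse_eq_zero (z := Fin.castAdd y v), smul_zero]
  · exact fun e => hs (Fin.castAdd_injective _ _ e).symm
  · exact castAdd_ne_natAdd _ _
  · refine lt_of_le_of_lt (le_of_eq ?_) hv
    rw [valence_cons, valence_add, valence_mapArrows (z := v)
      (fun u => (Fin.castAdd_injective _ _).eq_iff), valence_mapArrows_eq_zero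
      (fun u => (castAdd_ne_natAdd v u).symm), if_neg (castAdd_ne_natAdd v _).symm]
    conv_rhs => rw [← Multiset.cons_erase ha]
    rw [valence_cons]
    simp only [(Fin.castAdd_injective x y).eq_iff]
    cases s <;> simp only [vtx, Bool.not_true, Bool.not_false, if_true, Bool.false_eq_true, if_false] at hs ⊢ <;> simp [hs]

/-- Contracting `(v, u)` with one half-edge of `b`, or `(v, u')` with the opposite one, gives the
same graph: `b` is cut, one of its ends is joined to `u` and the other to `u'`, and `v` disappears.
Passing to the opposite half-edge of `b` changes the sign. -/
theorem contractPair_cancel (m : ℕ) {k : ℕ} {v u u' : Fin k} {b : Fin k × Fin k}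
    (hu : u ≠ v) (hu' : u' ≠ v) (hb : b.1 ≠ v) (hb' : b.2 ≠ v) {R : Multiset (Fin k × Fin k)}
    (hR : ∀ e ∈ R, e.1 ≠ v ∧ e.2 ≠ v) :
    ∑ t, contractPair m (v, u) false b t ((v, u') ::ₘ R)
      + ∑ t, contractPair m (v, u') false b t ((v, u) ::ₘ R) = 0 := by
  have hmap : ∀ w, mapArrows (Function.update id v w) R = R := fun w => by
    conv_rhs => rw [← Multiset.map_id R]
    exact Multiset.map_congr rfl fun e he => Prod.ext
      (Function.update_of_ne (hR e he).1 _ _) (Function.update_of_ne (hR e he).2 _ _)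
  have hc : ∀ (w : Fin k) (p q : Fin k × Fin k), mapArrows (Function.update id v w) (p ::ₘ q ::ₘ R)
      = Prod.map (Function.update id v w) (Function.update id v w) p ::ₘ
        Prod.map (Function.update id v w) (Function.update id v w) q ::ₘ R := fun w p q => by
    conv_rhs => rw [← hmap w]
    simp [mapArrows]
  have h1 := collapse_congr m (Ne.symm hb) (Ne.symm hb') (E := (b.2, u) ::ₘ (v, u') ::ₘ R)
    (E' := (b.1, u') ::ₘ (v, u) ::ₘ R) (by
      rw [hc, hc, Multiset.cons_swap]
      simp [Function.update_of_ne, hu, hu', hb, hb'])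
  have h2 := collapse_congr m (Ne.symm hb) (Ne.symm hb') (E := (b.2, u') ::ₘ (v, u) ::ₘ R)
    (E' := (b.1, u) ::ₘ (v, u') ::ₘ R) (by
      rw [hc, hc, Multiset.cons_swap]
      simp [Function.update_of_ne, hu, hu', hb, hb'])
  simp only [Fintype.sum_bool, contractPair, vtx, halfSign, Bool.not_true, Bool.not_false,
    if_true, Bool.false_eq_true, if_false, h1, h2]
  module

theorem forall_mem_of_valence_eq_zero {k : ℕ} {E : Multiset (Fin k × Fin k)} {v : Fin k}
    (h : LGraph.valence ⟨k, E⟩ v = 0) : ∀ e ∈ E, e.1 ≠ v ∧ e.2 ≠ v := by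
  simp only [LGraph.valence, Nat.add_eq_zero_iff, Multiset.countP_eq_zero] at h
  exact fun e he => ⟨h.1 e he, h.2 e he⟩

theorem exists_arrow_of_valence {k : ℕ} {E : Multiset (Fin k × Fin k)} {v : Fin k}
    (h : 0 < LGraph.valence ⟨k, E⟩ v) :
    ∃ u E', E = (v, u) ::ₘ E' ∨ E = (u, v) ::ₘ E' := by
  rcases Nat.add_pos_iff_pos_or_pos.mp h with h | h
  · obtain ⟨⟨w, u⟩, he, rfl⟩ := Multiset.countP_pos.mp h
    exact ⟨u, E.erase _, Or.inl (Multiset.cons_erase he).symm⟩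
  · obtain ⟨⟨u, w⟩, he, rfl⟩ := Multiset.countP_pos.mp h
    exact ⟨u, E.erase _, Or.inr (Multiset.cons_erase he).symm⟩

theorem bracketArrows_bivalent_aux {x y : ℕ} {v u u' : Fin x} {E : Multiset (Fin x × Fin x)}
    (hv : LGraph.valence ⟨x, (v, u) ::ₘ (v, u') ::ₘ E⟩ v = 2) (F : Multiset (Fin y × Fin y)) :
    bracketArrows 3 ((v, u) ::ₘ (v, u') ::ₘ E) F = 0 := by
  have hv' := hv
  rw [valence_cons, valence_cons] at hv'
  simp only [if_true] at hv'
  -- A loop among these arrows would raise the valence of `v` above two.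
  have hu : u ≠ v := fun h => by rw [if_pos h] at hv'; omega
  have hu' : u' ≠ v := fun h => by rw [if_pos h] at hv'; omega
  rw [if_neg hu, if_neg hu'] at hv'
  have hE := forall_mem_of_valence_eq_zero (E := E) (v := v) (by omega)
  rw [bracketArrows, Multiset.sum_map_sum_map]
  refine Multiset.sum_eq_zero fun z hz => ?_
  obtain ⟨b, _, rfl⟩ := Multiset.mem_map.mp hz
  have hzero : ∀ a ∈ E, ∑ s, ∑ t, contractPair 3 (Prod.map (Fin.castAdd y) (Fin.castAdd y) a) s
      (Prod.map (Fin.natAdd x) (Fin.natAdd x) b) t (mapArrows (Fin.castAdd y)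
        (((v, u) ::ₘ (v, u') ::ₘ E).erase a) + mapArrows (Fin.natAdd x) (F.erase b)) = 0 := by
    intro a ha
    refine Finset.sum_eq_zero fun s _ => Finset.sum_eq_zero fun t _ => ?_
    refine contractPair_eq_zero (v := v) (by omega) (by simp [ha]) ?_ b t _
    cases s
    · exact (hE a ha).1
    · exact (hE a ha).2
  have hhead : ∀ a ∈ ((v, u) ::ₘ (v, u') ::ₘ E), a.2 ≠ v →
      ∑ s, ∑ t, contractPair 3 (Prod.map (Fin.castAdd y) (Fin.castAdd y) a) s
        (Prod.map (Fin.natAdd x) (Fin.natAdd x) b) t (mapArrows (Fin.castAdd y)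
        (((v, u) ::ₘ (v, u') ::ₘ E).erase a) + mapArrows (Fin.natAdd x) (F.erase b))
      = ∑ t, contractPair 3 (Prod.map (Fin.castAdd y) (Fin.castAdd y) a) false
        (Prod.map (Fin.natAdd x) (Fin.natAdd x) b) t (mapArrows (Fin.castAdd y)
        (((v, u) ::ₘ (v, u') ::ₘ E).erase a) + mapArrows (Fin.natAdd x) (F.erase b)) := by
    intro a ha ha2
    rw [Fintype.sum_bool, add_eq_right]
    exact Finset.sum_eq_zero fun t _ => contractPair_eq_zero (v := v) (by omega) ha
      (s := true) ha2 b t _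
  rw [Multiset.map_cons, Multiset.map_cons, Multiset.sum_cons, Multiset.sum_cons,
    Multiset.sum_eq_zero (s := E.map _), add_zero, hhead _ (by simp) hu, hhead _ (by simp) hu']
  · rw [Multiset.erase_cons_head, Multiset.cons_swap, Multiset.erase_cons_head]
    have hcons : ∀ e, mapArrows (Fin.castAdd y) (e ::ₘ E) + mapArrows (Fin.natAdd x) (F.erase b)
        = Prod.map (Fin.castAdd y) (Fin.castAdd y) e ::ₘ
          (mapArrows (Fin.castAdd y) E + mapArrows (Fin.natAdd x) (F.erase b)) := fun e => by
      simp [mapArrows]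
    rw [hcons, hcons]
    have hinj := Fin.castAdd_injective x y
    refine contractPair_cancel 3 (hinj.ne hu) (hinj.ne hu') (castAdd_ne_natAdd v _).symm
      (castAdd_ne_natAdd v _).symm fun e he => ?_
    rcases Multiset.mem_add.mp he with he | he
    · obtain ⟨e', he', rfl⟩ := Multiset.mem_map.mp he
      exact ⟨hinj.ne (hE e' he').1, hinj.ne (hE e' he').2⟩
    · obtain ⟨e', he', rfl⟩ := Multiset.mem_map.mp he
      exact ⟨(castAdd_ne_natAdd v _).symm, (castAdd_ne_natAdd v _).symm⟩
  · intro z hz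
    obtain ⟨a, ha, rfl⟩ := Multiset.mem_map.mp hz
    exact hzero a ha

theorem bracketArrows_bivalent_left {x y : ℕ} {v : Fin x} {E : Multiset (Fin x × Fin x)}
    (hv : LGraph.valence ⟨x, E⟩ v = 2) (F : Multiset (Fin y × Fin y)) :
    bracketArrows 3 E F = 0 := by
  -- A loop is its own reversal, so the bracket equals its negative. This settles the case where the
  -- two half-edges at `v` form a loop; otherwise both arrows are turned to start at `v`.
  have hloop : ∀ E', bracketArrows 3 ((v, v) ::ₘ E') F = 0 := fun E' => by
    have := bracketArrows_reversal_left 3 v v E' F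
    rw [eq_neg_iff_add_eq_zero, ← two_smul ℝ] at this
    exact (smul_eq_zero.mp this).resolve_left two_ne_zero
  obtain ⟨u, E₁, h⟩ := exists_arrow_of_valence (E := E) (v := v) (by omega)
  have h1 : LGraph.valence ⟨x, (v, u) ::ₘ E₁⟩ v = 2 := by
    rcases h with rfl | rfl
    · exact hv
    · rw [← valence_reversal]; exact hv
  suffices h2 : bracketArrows 3 ((v, u) ::ₘ E₁) F = 0 by
    rcases h with rfl | rfl
    · exact h2
    · rw [bracketArrows_reversal_left, h2, neg_zero]
  by_cases hu : u = v
  · rw [hu]; exact hloop E₁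
  have h3 := h1
  rw [valence_cons, if_pos rfl, if_neg hu] at h3
  obtain ⟨u', E₂, h⟩ := exists_arrow_of_valence (E := E₁) (v := v) (by omega)
  rcases h with rfl | rfl
  · exact bracketArrows_bivalent_aux h1 F
  · rw [Multiset.cons_swap, bracketArrows_reversal_left, Multiset.cons_swap,
      bracketArrows_bivalent_aux, neg_zero]
    rw [Multiset.cons_swap, ← valence_reversal, Multiset.cons_swap]
    exact h1

theorem bracketArrows_bivalent_right {x y : ℕ} {v : Fin y} (E : Multiset (Fin x × Fin x))
    {F : Multiset (Fin y × Fin y)} (hv : LGraph.valence ⟨y, F⟩ v = 2) :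
    bracketArrows 3 E F = 0 := by
  obtain ⟨c, hc⟩ := exists_bracketArrows_symm 3 y x
  rw [hc, bracketArrows_bivalent_left hv, smul_zero]

theorem exists_valence_eq_two {X : AGraph 2} (h : ¬ ∀ v, 3 ≤ X.1.valence v) :
    ∃ v, X.1.valence v = 2 := by
  push Not at h
  obtain ⟨v, hv⟩ := h
  exact ⟨v, by have := X.2 v; omega⟩

theorem reduce_graphBracket (x y : GraphSpace 2) :
    reduce (graphBracket 2 x y) = graphBracket 3 (reduce x) (reduce y) := by
  have h : (graphBracket 2).compr₂ reduce = (graphBracket 3).compl₁₂ reduce reduce :=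
    graphSpace_hom_ext fun X => graphSpace_hom_ext fun Y => by
      rw [LinearMap.compl₁₂_apply, LinearMap.compr₂_apply, graphBracket_cls, reduce_bracketArrows,
        reduce_cls, reduce_cls]
      by_cases hX : ∀ v, 3 ≤ X.1.valence v
      · by_cases hY : ∀ v, 3 ≤ Y.1.valence v
        · exact (graphBracket_cls 3 ⟨X.1, hX⟩ ⟨Y.1, hY⟩).symm
        · obtain ⟨v, hv⟩ := exists_valence_eq_two hY
          rw [cls, cls, dif_neg hY, map_zero]
          exact bracketArrows_bivalent_right _ hv
      · obtain ⟨v, hv⟩ := exists_valence_eq_two hX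
        rw [cls, dif_neg hX, map_zero, LinearMap.zero_apply]
        exact bracketArrows_bivalent_left hv _
  exact LinearMap.congr_fun (LinearMap.congr_fun h x) y

theorem collapse_mem_chains (m : ℕ) {k : ℕ} (i j : Fin k) (E : Multiset (Fin k × Fin k)) :
    collapse m i j E ∈ chains m (k - 1) := by
  rw [collapse]
  split_ifs with h
  · exact Submodule.zero_mem _
  · have hmem : cls m ⟨k - 1, mapArrows (mergeMap i j h) E⟩ ∈ chains m (k - 1) :=
      cls_mem_chains m ⟨k - 1, mapArrows (mergeMap i j h) E⟩
    exact Submodule.smul_mem (chains m (k - 1)) (sgn (frontPerm i j)) hmem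

theorem bracketArrows_mem_chains (m : ℕ) {x y : ℕ} (E : Multiset (Fin x × Fin x))
    (F : Multiset (Fin y × Fin y)) : bracketArrows m E F ∈ chains m (x + y - 1) := by
  rw [bracketArrows]
  refine multiset_sum_mem _ fun z hz => ?_
  obtain ⟨a, _, rfl⟩ := Multiset.mem_map.mp hz
  refine multiset_sum_mem _ fun z hz => ?_
  obtain ⟨b, _, rfl⟩ := Multiset.mem_map.mp hz
  exact Submodule.sum_mem _ fun s _ => Submodule.sum_mem _ fun t _ =>
    Submodule.smul_mem _ _ (collapse_mem_chains m _ _ _)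

theorem graphBracket_mem_chains {m p q : ℕ} {x y : GraphSpace m} (hx : x ∈ chains m p)
    (hy : y ∈ chains m q) : graphBracket m x y ∈ chains m (p + q - 1) := by
  have h1 : ∀ X : AGraph m, X.1.k = p →
      chains m q ≤ (chains m (p + q - 1)).comap (graphBracket m (cls m X.1)) := by
    intro X hX
    conv_lhs => rw [chains]
    rw [Submodule.span_le]
    rintro _ ⟨Y, hY, rfl⟩
    rw [SetLike.mem_coe, Submodule.mem_comap, graphBracket_cls, ← hX, ← hY]
    exact bracketArrows_mem_chains m _ _
  have h2 : chains m p ≤ (chains m (p + q - 1)).comap ((graphBracket m).flip y) := by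
    conv_lhs => rw [chains]
    rw [Submodule.span_le]
    rintro _ ⟨X, hX, rfl⟩
    exact h1 X hX hy
  exact h2 hx

/-- Lift both invariants to stable chains, apply `schouten_stateMap` upstairs, and project with
`reduce`; the graph bracket of the lifts is again in the range where φₙ inverts ψₙ. -/
theorem phi_schouten {n p q : ℕ} (hpq : p + q ≤ 2 * n + 2)
    {x y : ExteriorAlgebra ℝ (polyLie n)} (hx : x ∈ stableInvariants n)
    (hy : y ∈ stableInvariants n) (hxp : x ∈ ⋀[ℝ]^p (polyLie n)) (hyq : y ∈ ⋀[ℝ]^q (polyLie n)) :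
    ∃ h : schouten x y ∈ stableInvariants n,
      phi n ⟨schouten x y, h⟩ = graphBracket 3 (phi n ⟨x, hx⟩) (phi n ⟨y, hy⟩) := by
  -- A degree above `2n + 1` is possible when the other degree is zero; the invariant is then zero
  -- and is lifted by zero.
  have key : ∀ {k : ℕ} {x : ExteriorAlgebra ℝ (polyLie n)}, x ∈ stableInvariants n →
      x ∈ ⋀[ℝ]^k (polyLie n) → ∃ z ∈ chains 2 k, z ∈ stableChains n ∧ stateMap n z = x := by
    intro k x hx hk
    by_cases h : k ≤ 2 * n + 1
    · obtain ⟨z, hz, rfl⟩ := mem_map_chains hx.1 hk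
      exact ⟨z, hz, chains_le_stableChains h hz, rfl⟩
    · refine ⟨0, Submodule.zero_mem _, Submodule.zero_mem _, ?_⟩
      rw [eq_zero_of_mem_stableInvariants (by omega) hx hk, map_zero]
  obtain ⟨X, hX, hX', rfl⟩ := key hx hxp
  obtain ⟨Y, hY, hY', rfl⟩ := key hy hyq
  -- The bracket merges two vertices, so `p + q ≤ 2n + 2` gives at most `2n + 1` vertices.
  have hXY : graphBracket 2 X Y ∈ stableChains n :=
    chains_le_stableChains (by omega) (graphBracket_mem_chains hX hY)
  have h := stateMap_mem_stableInvariants hXY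
  refine ⟨(schouten_stateMap X Y).symm ▸ h, ?_⟩
  simp only [schouten_stateMap]
  rw [phi_stateMap hXY, phi_stateMap hX', phi_stateMap hY', reduce_graphBracket]

end Reduce

end KGraph

end

theorem mainTheorem12 (n : ℕ) :
    LinearMap.range (KGraph.stateMap n) = KGraph.spInvariants n ∧
    (∀ k ≤ 2 * n + 1, Set.BijOn (KGraph.stateMap n) (KGraph.chains 2 k)
      (KGraph.spInvariants n ⊓ ⋀[ℝ]^k (KGraph.polyLie n) :
        Submodule ℝ (ExteriorAlgebra ℝ (KGraph.polyLie n)))) ∧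
    (∀ x ∈ KGraph.stableChains n, ∃ h : KGraph.stateMap n x ∈ KGraph.stableInvariants n,
      KGraph.phi n ⟨KGraph.stateMap n x, h⟩ = KGraph.reduce x) ∧
    (∀ p q : ℕ, p + q ≤ 2 * n + 2 → ∀ (x y : ExteriorAlgebra ℝ (KGraph.polyLie n))
      (hx : x ∈ KGraph.stableInvariants n) (hy : y ∈ KGraph.stableInvariants n),
      x ∈ ⋀[ℝ]^p (KGraph.polyLie n) → y ∈ ⋀[ℝ]^q (KGraph.polyLie n) →
      ∃ h : KGraph.schouten x y ∈ KGraph.stableInvariants n,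
        KGraph.phi n ⟨KGraph.schouten x y, h⟩
          = KGraph.graphBracket 3 (KGraph.phi n ⟨x, hx⟩) (KGraph.phi n ⟨y, hy⟩)) ∧
    (∀ x y : KGraph.GraphSpace 2,
      KGraph.schouten (KGraph.stateMap n x) (KGraph.stateMap n y)
        = KGraph.stateMap n (KGraph.graphBracket 2 x y) ∧
      KGraph.reduce (KGraph.graphBracket 2 x y)
        = KGraph.graphBracket 3 (KGraph.reduce x) (KGraph.reduce y)) := by
  refine ⟨KGraph.range_stateMap, fun k hk => KGraph.bijOn_stateMap hk, fun x hx => ?_,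
    fun p q hpq x y hx hy hxp hyq => KGraph.phi_schouten hpq hx hy hxp hyq,
    fun x y => ⟨KGraph.schouten_stateMap x y, KGraph.reduce_graphBracket x y⟩⟩
  exact ⟨KGraph.stateMap_mem_stableInvariants hx, KGraph.phi_stateMap hx _⟩
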